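/- Setting. Fix a local dimension $d\ge 1$. For finite $\Lambda\subset\mathbb Z$ let $\mathcal H_\Lambda=\bigotimes_{x\in\Lambda}\mathbb C^d$ and $\mathfrak A_\Lambda=\mathcal B(\mathcal H_\Lambda)$, with the operator norm $\|\cdot\|$; for $X\subset\Lambda$ regard $\mathfrak A_X\subset\mathfrak A_\Lambda$ via $Q\mapsto Q\otimes\mathbb 1_{\Lambda\setminus X}$. An interaction $\Phi=(\Phi_X)_X$ assigns to every finite $X\subset\mathbb Z$ a self-adjoint $\Phi_X\in\mathfrak A_X$. It has range $r>0$ and strength $J>0$ if $\Phi_X=0$ whenever $\operatorname{diam}(X)>r$, and $\|\Phi_X\|\le J$ for all $X$. Put $H_\Lambda=\sum_{X\subset\Lambda}\Phi_X$ and $\rho^\Lambda=e^{-H_\Lambda}/\operatorname{Tr}(e^{-H_\Lambda})$. For a state $\rho$, $\rho_X$ denotes its reduced state on $X$. Write $I=ABC$ when the finite interval $I\subset\mathbb Z$ is split into adjacent subintervals $A,B,C$, in this order (possibly empty). Let $\operatorname{Corr}_\rho(A:C)=\sup\,|\operatorname{Tr}[(O_A\otimes O_C)(\rho_{AC}-\rho_A\otimes\rho_C)]|$,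 the supremum being over $O_A\in\mathfrak A_A$, $O_C\in\mathfrak A_C$ of norm one. For constants $\widetilde{\mathcal K},\widetilde\alpha>0$, $\Phi$ satisfies exponential uniform clustering with these constants if $\operatorname{Corr}_{\rho^I}(A:C)\le\widetilde{\mathcal K}e^{-\widetilde\alpha\ell}$ for every finite interval $I=ABC$ and every real $\ell$ with $0\le\ell\le|B|$. For full-rank states $\rho,\sigma$ let $$D(\rho\|\sigma)=\operatorname{Tr}[\rho(\log\rho-\log\sigma)],\qquad \widehat D(\rho\|\sigma)=\operatorname{Tr}[\rho\log(\rho^{1/2}\sigma^{-1}\rho^{1/2})],$$ $$\widehat D_q(\rho\|\sigma)=\frac1{q-1}\log\operatorname{Tr}\big[\sigma^{1/2}(\sigma^{-1/2}\rho\,\sigma^{-1/2})^q\sigma^{1/2}\big]\quad(q>1),\qquad \widehat D_1:=\widehat D=\lim_{q\to1^+}\widehat D_q,$$ and let $I_\rho(A:C)$, $\widehat I_\rho(A:C)$, $\widehat I^q_\rho(A:C)$ be the values of $D$, $\widehat D$, $\widehat D_q$ at $(\rho_{AC}\,\|\,\rho_A\otimes\rho_C)$. Theorem. For all $d\ge1$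 and $r,J,\widetilde{\mathcal K},\widetilde\alpha>0$ there are constants $\widehat{\mathcal K},\widehat\alpha>0$, depending only on $d,r,J,\widetilde{\mathcal K},\widetilde\alpha$, such that the following holds. Let $\Phi$ be an interaction on $\mathbb Z$ with local dimension $d$, range $r$ and strength $J$ that satisfies exponential uniform clustering with constants $\widetilde{\mathcal K},\widetilde\alpha$. Then for every finite interval $I=ABC$, every real $\ell$ with $|B|\ge3\ell\ge0$ and every $q\ge1$, the Gibbs state $\rho=\rho^I$ satisfies $$I_\rho(A:C)\;\le\;\widehat I_\rho(A:C)\;\le\;\widehat I^q_\rho(A:C)\;\le\;\widehat{\mathcal K}\,e^{-\widehat\alpha\,\ell}.$$ -/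

import Mathlib

open scoped Matrix.Norms.L2Operator

noncomputable section

namespace SpinChain

/-- Configurations of a spin system with `d` levels per site on the finite set `Λ` of sites; they
index the product basis of the Hilbert space `⨂_{x ∈ Λ} ℂ^d`. -/
abbrev Config (d : ℕ) (Λ : Finset ℤ) : Type := Λ → Fin d

/-- The algebra of all operators on `⨂_{x ∈ Λ} ℂ^d`, as matrices in the product basis.
Its norm is the operator norm with respect to the Hilbert space norm. -/
abbrev Obs (d : ℕ) (Λ : Finset ℤ) : Type := Matrix (Config d Λ) (Config d Λ) ℂ

/-- Restriction of a configuration to a smaller set of sites. -/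
def restr {d : ℕ} {X Λ : Finset ℤ} (h : X ⊆ Λ) (s : Config d Λ) : Config d X :=
  fun x => s ⟨x, h x.2⟩

/-- The canonical inclusion `Q ↦ Q ⊗ 1` of the operators on `X` into the operators on `Λ ⊇ X`. -/
def embed {d : ℕ} {X Λ : Finset ℤ} (h : X ⊆ Λ) (Q : Obs d X) : Obs d Λ :=
  Matrix.of fun s t =>
    if ∀ x : Λ, (x : ℤ) ∉ X → s x = t x then Q (restr h s) (restr h t) else 0

/-- The configuration on `Λ` which is `s` on `X` and `u` on `Λ \ X`. -/
def glue {d : ℕ} {X Λ : Finset ℤ} (s : Config d X) (u : Config d (Λ \ X)) : Config d Λ :=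
  fun x => if hx : (x : ℤ) ∈ X then s ⟨x, hx⟩ else u ⟨x, Finset.mem_sdiff.2 ⟨x.2, hx⟩⟩

/-- The (unnormalized) partial trace over `Λ \ X`; for a state `ρ` on `Λ ⊇ X` it is the reduced
state `ρ_X`. -/
def reduced {d : ℕ} {Λ : Finset ℤ} (X : Finset ℤ) (ρ : Obs d Λ) : Obs d X :=
  Matrix.of fun s t => ∑ u : Config d (Λ \ X), ρ (glue s u) (glue t u)

/-- The tensor product `Q ⊗ R` of operators on disjoint sets `A` and `C`, an operator on `A ∪ C`. -/
def tensor {d : ℕ} {A C : Finset ℤ} (Q : Obs d A) (R : Obs d C) : Obs d (A ∪ C) :=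
  Matrix.of fun s t =>
    Q (restr Finset.subset_union_left s) (restr Finset.subset_union_left t) *
      R (restr Finset.subset_union_right s) (restr Finset.subset_union_right t)

/-- A local interaction: a self-adjoint operator `Φ_X` on `X` for each finite set `X` of sites. -/
structure Interaction (d : ℕ) where
  term : (X : Finset ℤ) → Obs d X
  selfAdjoint : ∀ X, (term X).IsHermitian

namespace Interaction

variable {d : ℕ}

/-- `Φ` has range `r`: `Φ_X = 0` whenever the diameter of `X` exceeds `r`. -/
def HasRange (Φ : Interaction d) (r : ℝ) : Prop :=
  ∀ X : Finset ℤ, r < Metric.diam (X : Set ℤ) → Φ.term X = 0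

/-- `Φ` has strength `J`: `‖Φ_X‖ ≤ J` for all `X`. -/
def HasStrength (Φ : Interaction d) (J : ℝ) : Prop :=
  ∀ X : Finset ℤ, ‖Φ.term X‖ ≤ J

/-- The Hamiltonian `H_Λ = ∑_{X ⊆ Λ} Φ_X`. -/
def hamiltonian (Φ : Interaction d) (Λ : Finset ℤ) : Obs d Λ :=
  ∑ X ∈ Λ.powerset.attach, embed (Finset.mem_powerset.1 X.2) (Φ.term X)

/-- The Gibbs state `ρ^Λ = e^{-H_Λ} / Tr e^{-H_Λ}`. -/
def gibbs (Φ : Interaction d) (Λ : Finset ℤ) : Obs d Λ :=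
  (NormedSpace.exp (-Φ.hamiltonian Λ)).trace⁻¹ • NormedSpace.exp (-Φ.hamiltonian Λ)

end Interaction

/-- `IsSplit I A B C`: the finite interval `I` of `ℤ` is split into the adjacent subintervals
`A`, `B`, `C`, in this order. Subintervals may be empty. -/
def IsSplit (I A B C : Finset ℤ) : Prop :=
  ∃ x y z w : ℤ, x ≤ y ∧ y ≤ z ∧ z ≤ w ∧
    I = Finset.Ico x w ∧ A = Finset.Ico x y ∧ B = Finset.Ico y z ∧ C = Finset.Ico z w

/-- The covariance correlation `Corr_ρ(A : C)`: the supremum of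
`|Tr[(O_A ⊗ O_C) (ρ_{AC} - ρ_A ⊗ ρ_C)]|` over operators `O_A`, `O_C` of norm one. -/
def corr {d : ℕ} {I : Finset ℤ} (ρ : Obs d I) (A C : Finset ℤ) : ℝ :=
  sSup {v : ℝ | ∃ (Q : Obs d A) (R : Obs d C), ‖Q‖ = 1 ∧ ‖R‖ = 1 ∧
    v = ‖(tensor Q R *
      (reduced (A ∪ C) ρ - tensor (reduced A ρ) (reduced C ρ))).trace‖}

/-- Uniform clustering of `Φ` with the decay function `ε`, a positive decreasing function on
`[0, ∞)`. -/
def Interaction.UniformClustering {d : ℕ} (Φ : Interaction d) (ε : ℝ → ℝ) : Prop :=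
  (∀ l, 0 ≤ l → 0 < ε l) ∧ AntitoneOn ε (Set.Ici 0) ∧
    ∀ I A B C : Finset ℤ, IsSplit I A B C → ∀ l : ℝ, 0 ≤ l → l ≤ (B.card : ℝ) →
      corr (Φ.gibbs I) A C ≤ ε l

section Entropy

variable {n : Type*} [Fintype n] [DecidableEq n]

/-- The logarithm of a positive definite matrix, by functional calculus. -/
def matLog (M : Matrix n n ℂ) : Matrix n n ℂ := cfc Real.log M

/-- The real power `M ^ p` of a positive definite matrix, by functional calculus. -/
def matPow (M : Matrix n n ℂ) (p : ℝ) : Matrix n n ℂ := cfc (fun x : ℝ => x ^ p) M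

/-- Umegaki relative entropy `Tr[ρ (log ρ - log σ)]` of full-rank states. -/
def relEntropy (ρ σ : Matrix n n ℂ) : ℝ := (ρ * (matLog ρ - matLog σ)).trace.re

/-- Belavkin–Staszewski relative entropy `Tr[ρ log (ρ^{1/2} σ⁻¹ ρ^{1/2})]` of full-rank states. -/
def bsEntropy (ρ σ : Matrix n n ℂ) : ℝ :=
  (ρ * matLog (matPow ρ (1 / 2) * σ⁻¹ * matPow ρ (1 / 2))).trace.re

/-- The `q`-geometric Rényi divergence
`(q - 1)⁻¹ log Tr[σ^{1/2} (σ^{-1/2} ρ σ^{-1/2})^q σ^{1/2}]` of full-rank states for `q > 1`,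
with the usual convention that for `q = 1` it is its limit as `q → 1⁺`, the
Belavkin–Staszewski relative entropy. -/
def geomRenyi (q : ℝ) (ρ σ : Matrix n n ℂ) : ℝ :=
  if q = 1 then bsEntropy ρ σ
  else 1 / (q - 1) * Real.log (matPow σ (1 / 2) *
    matPow (matPow σ (-(1 / 2)) * ρ * matPow σ (-(1 / 2))) q * matPow σ (1 / 2)).trace.re

end Entropy

section MutualInformation

variable {d : ℕ} {I : Finset ℤ}

/-- Mutual information `I_ρ(A : C) = D(ρ_{AC} ‖ ρ_A ⊗ ρ_C)`. -/
def mutualInfo (ρ : Obs d I) (A C : Finset ℤ) : ℝ :=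
  relEntropy (reduced (A ∪ C) ρ) (tensor (reduced A ρ) (reduced C ρ))

/-- The mutual information arising from the Belavkin–Staszewski relative entropy. -/
def bsMutualInfo (ρ : Obs d I) (A C : Finset ℤ) : ℝ :=
  bsEntropy (reduced (A ∪ C) ρ) (tensor (reduced A ρ) (reduced C ρ))

/-- The mutual information arising from the `q`-geometric Rényi divergence. -/
def renyiMutualInfo (q : ℝ) (ρ : Obs d I) (A C : Finset ℤ) : ℝ :=
  geomRenyi q (reduced (A ∪ C) ρ) (tensor (reduced A ρ) (reduced C ρ))

end MutualInformation

end SpinChain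

end

/-!
The operator `e^{-H_I/2}` is the product of `e^{-H_A/2} ⊗ e^{-H_B/2} ⊗ e^{-H_C/2}` and a bridge `E`.
The bridge is a product of two of Araki's expansionals, one for each cut; expanding an expansional
in shells around its cut shows that it is bounded with bounded inverse, uniformly in the interval,
and exponentially close to an operator supported near the cut. Hence the reduced state on
`A ∪ C` is a conjugate of the slice `Tr_B[ρ^B E E*]`, up to normalization. Since `E E*` is nearly a
product of an operator near the left cut and one near the right cut, clustering of `ρ^B` makes this
slice nearly a product over `A` and `C`. It follows that `ρ_{AC} ≤ (1 + ε) ρ_A ⊗ ρ_C` with `ε`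
exponentially small, and `log (1 + ε)`, which bounds the max-relative entropy, bounds the three
divergences.
-/

noncomputable section

namespace SpinChain

open Matrix Finset NormedSpace
open scoped ComplexOrder MatrixOrder Kronecker

section ClassicalInequalities

variable {ι : Type*} [Fintype ι]

/-- The resolvent sum `∑ w / (x + t)` is the derivative of `t ↦ ∑ w log (x + t)`, which vanishes
at infinity. -/
theorem sum_mul_log_nonneg_of_sum_div_nonpos (w x : ι → ℝ) (hx : ∀ i, 0 < x i)
    (hw : ∑ i, w i = 0) (h : ∀ t : ℝ, 0 ≤ t → ∑ i, w i / (x i + t) ≤ 0) :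
    0 ≤ ∑ i, w i * Real.log (x i) := by
  let f : ℝ → ℝ := fun t => ∑ i, w i * Real.log (t + x i)
  have hlim : Filter.Tendsto f Filter.atTop (nhds 0) := by
    have hf : f = fun t => ∑ i, w i * (Real.log (t + x i) - Real.log t) := by
      funext t
      simp only [f, mul_sub, sum_sub_distrib, ← sum_mul, hw, zero_mul, sub_zero]
    simpa only [hf, mul_zero, sum_const_zero] using tendsto_finsetSum univ fun i _ =>
      (Real.tendsto_log_comp_add_sub_log (x i)).const_mul (w i)
  have hderiv (t : ℝ) (ht : 0 ≤ t) : HasDerivAt f (∑ i, w i / (x i + t)) t := by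
    refine HasDerivAt.fun_sum fun i _ => ?_
    have hne : t + x i ≠ 0 := (add_pos_of_nonneg_of_pos ht (hx i)).ne'
    simpa only [id_eq, add_comm t, mul_one_div] using
      (((hasDerivAt_id' t).add_const (x i)).log hne).const_mul (w i)
  have hanti : AntitoneOn f (Set.Ici 0) := by
    refine antitoneOn_of_hasDerivWithinAt_nonpos (convex_Ici 0)
      (fun t ht => (hderiv t ht).continuousAt.continuousWithinAt)
      (fun t ht => (hderiv t (interior_subset ht)).hasDerivWithinAt)
      fun t ht => h t (interior_subset ht)
  have h0 : 0 ≤ f 0 := le_of_tendsto hlim <| by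
    filter_upwards [Filter.eventually_ge_atTop 0] with t ht
    exact hanti Set.self_mem_Ici ht ht
  simpa only [f, zero_add] using h0

variable {p l : ι → ℝ} {q L : ℝ}

theorem sum_mul_log_le_log_of_le (hp : ∀ i, 0 < p i) (hp1 : ∑ i, p i = 1) (hl : ∀ i, 0 < l i)
    (hL : ∀ i, l i ≤ L) : ∑ i, p i * Real.log (l i) ≤ Real.log L :=
  calc ∑ i, p i * Real.log (l i) ≤ ∑ i, p i * Real.log L :=
        sum_le_sum fun i _ => mul_le_mul_of_nonneg_left (Real.log_le_log (hl i) (hL i)) (hp i).le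
    _ = Real.log L := by rw [← sum_mul, hp1, one_mul]

theorem sum_mul_log_le_div_log_sum_rpow (hp : ∀ i, 0 < p i) (hp1 : ∑ i, p i = 1)
    (hl : ∀ i, 0 < l i) (hq : 1 < q) :
    ∑ i, p i * Real.log (l i) ≤ 1 / (q - 1) * Real.log (∑ i, p i * l i ^ (q - 1)) := by
  have jensen := strictConcaveOn_log_Ioi.concaveOn.le_map_sum (t := univ) (w := p)
    (p := fun i => l i ^ (q - 1)) (fun i _ => (hp i).le) hp1
    (fun i _ => Real.rpow_pos_of_pos (hl i) _)
  rw [one_div, inv_mul_eq_div, le_div_iff₀ (sub_pos.2 hq), sum_mul]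
  simpa only [smul_eq_mul, Real.log_rpow (hl _), mul_left_comm, mul_comm] using jensen

theorem div_log_sum_rpow_le_log (hp : ∀ i, 0 < p i) (hp1 : ∑ i, p i = 1)
    (hl : ∀ i, 0 < l i) (hL : ∀ i, l i ≤ L) (hq : 1 < q) :
    1 / (q - 1) * Real.log (∑ i, p i * l i ^ (q - 1)) ≤ Real.log L := by
  obtain ⟨j, -⟩ : (univ : Finset ι).Nonempty :=
    nonempty_of_sum_ne_zero (hp1.trans_ne one_ne_zero)
  rw [one_div, inv_mul_eq_div, div_le_iff₀ (sub_pos.2 hq), mul_comm,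
    ← Real.log_rpow ((hl j).trans_le (hL j))]
  refine Real.log_le_log (sum_pos (fun i _ => mul_pos (hp i) (Real.rpow_pos_of_pos (hl i) _))
    ⟨j, mem_univ j⟩) ?_
  calc ∑ i, p i * l i ^ (q - 1) ≤ ∑ i, p i * L ^ (q - 1) := sum_le_sum fun i _ =>
        mul_le_mul_of_nonneg_left (Real.rpow_le_rpow (hl i).le (hL i) (sub_pos.2 hq).le) (hp i).le
    _ = L ^ (q - 1) := by rw [← sum_mul, hp1, one_mul]

end ClassicalInequalities

section FunctionalCalculus

variable {n : Type*} [Fintype n] [DecidableEq n]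

theorem continuousOn_spectrum (A : Matrix n n ℂ) (f : ℝ → ℝ) : ContinuousOn f (spectrum ℝ A) :=
  finite_real_spectrum.continuousOn f

theorem cfc_mul_eq_mul_cfc {A B Y : Matrix n n ℂ} (hA : A.IsHermitian) (hB : B.IsHermitian)
    (h : A * Y = Y * B) (f : ℝ → ℝ) : cfc f A * Y = Y * cfc f B := by
  have hS : (spectrum ℝ A ∪ spectrum ℝ B).Finite := finite_real_spectrum.union finite_real_spectrum
  let p := Lagrange.interpolate hS.toFinset id f
  have hp : Set.EqOn f p.eval (spectrum ℝ A ∪ spectrum ℝ B) := fun x hx =>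
    (Lagrange.eval_interpolate_at_node f (Set.injOn_id _) (hS.mem_toFinset.2 hx)).symm
  rw [cfc_congr (hp.mono Set.subset_union_left), cfc_congr (hp.mono Set.subset_union_right),
    cfc_polynomial p A hA.isSelfAdjoint, cfc_polynomial p B hB.isSelfAdjoint]
  induction p using Polynomial.induction_on' with
  | add p q hp hq => simp only [map_add, add_mul, mul_add, hp, hq]
  | monomial k c =>
    have hk : A ^ k * Y = Y * B ^ k := ((show SemiconjBy Y B A from h.symm).pow_right k).eq.symm
    simp only [Polynomial.aeval_monomial]
    rw [mul_assoc, hk, ← mul_assoc, ← mul_assoc, Algebra.commutes]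

/-- The diagonal matrix with the real entries `a`, the normal form of a Hermitian matrix. -/
abbrev realDiag (a : n → ℝ) : Matrix n n ℂ := diagonal fun i => (a i : ℂ)

/-- `A = U diag(a) Uᴴ` with `U` unitary: an orthonormal eigenbasis of `A` (the columns of `U`)
together with the eigenvalues. -/
structure Diagonalizes (U : Matrix n n ℂ) (a : n → ℝ) (A : Matrix n n ℂ) : Prop where
  conjTranspose_mul_self : Uᴴ * U = 1
  eq : A = U * realDiag a * Uᴴ

theorem exists_diagonalizes {A : Matrix n n ℂ} (hA : A.PosDef) :
    ∃ (U : Matrix n n ℂ) (a : n → ℝ), Diagonalizes U a A ∧ ∀ i, 0 < a i :=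
  ⟨hA.isHermitian.eigenvectorUnitary, hA.isHermitian.eigenvalues,
    ⟨Unitary.coe_star_mul_self _,
      hA.isHermitian.spectral_theorem.trans (Unitary.conjStarAlgAut_apply _ _)⟩,
    hA.eigenvalues_pos⟩

theorem re_trace_mul_realDiag_mul (A B : Matrix n n ℂ) (a : n → ℝ) :
    (A * realDiag a * B).trace.re = ∑ i, a i * ((B * A) i i).re := by
  rw [trace_mul_comm, ← mul_assoc, trace, Complex.re_sum]
  refine sum_congr rfl fun i _ => ?_
  rw [diag_apply, mul_diagonal, mul_comm, Complex.re_ofReal_mul]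

omit [DecidableEq n] in
theorem re_conjTranspose_mul_self_apply (P : Matrix n n ℂ) (i : n) :
    ((Pᴴ * P) i i).re = ∑ j, ‖P j i‖ ^ 2 := by
  simp only [mul_apply, conjTranspose_apply, Complex.re_sum, RCLike.star_def,
    ← Complex.normSq_eq_conj_mul_self, Complex.ofReal_re, Complex.normSq_eq_norm_sq]

omit [DecidableEq n] in
theorem re_mul_conjTranspose_self_apply (P : Matrix n n ℂ) (i : n) :
    ((P * Pᴴ) i i).re = ∑ j, ‖P i j‖ ^ 2 := by
  simpa only [conjTranspose_conjTranspose, conjTranspose_apply, norm_star] using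
    re_conjTranspose_mul_self_apply Pᴴ i

namespace Diagonalizes

variable {U A : Matrix n n ℂ} {a : n → ℝ}

theorem mul_conjTranspose_self (h : Diagonalizes U a A) : U * Uᴴ = 1 :=
  mul_eq_one_comm.1 h.conjTranspose_mul_self

theorem conjTranspose_mul_mul (h : Diagonalizes U a A) : Uᴴ * A * U = realDiag a :=
  calc Uᴴ * A * U = (Uᴴ * U) * realDiag a * (Uᴴ * U) := by rw [h.eq]; simp only [mul_assoc]
    _ = realDiag a := by rw [h.conjTranspose_mul_self, one_mul, mul_one]

theorem isHermitian (h : Diagonalizes U a A) : A.IsHermitian := by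
  rw [h.eq]
  exact isHermitian_mul_mul_conjTranspose _ <|
    isHermitian_diagonal_of_self_adjoint _ <| funext fun i => Complex.conj_ofReal (a i)

theorem cfc_eq (h : Diagonalizes U a A) (f : ℝ → ℝ) :
    cfc f A = U * realDiag (fun i => f (a i)) * Uᴴ := by
  have heigen : A * U = U * realDiag a := by
    rw [h.eq, mul_assoc, h.conjTranspose_mul_self, mul_one]
  have hcolumn (i : n) : cfc f A * (U * single i i 1) = (U * single i i 1) * (f (a i) : ℂ) • 1 := by
    have hi : A * (U * single i i 1) = (U * single i i 1) * algebraMap ℝ _ (a i) := by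
      have hi' : realDiag a * single i i 1 = (a i : ℂ) • single i i 1 := by
        ext j k
        by_cases hj : i = j <;> simp [hj]
      rw [← mul_assoc, heigen, mul_assoc, hi', ← Algebra.commutes, ← Algebra.smul_def,
        Complex.coe_smul, mul_smul_comm]
    rw [cfc_mul_eq_mul_cfc h.isHermitian (IsSelfAdjoint.algebraMap _ (.all _)) hi, cfc_algebraMap,
      Algebra.algebraMap_eq_smul_one, Complex.coe_smul]
  have hdiag (b : n → ℂ) : ∑ i, b i • single i i (1 : ℂ) = diagonal b := by
    simp [← sum_single_eq_diagonal]
  calc cfc f A = ∑ i, cfc f A * (U * single i i 1) * Uᴴ := by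
        rw [← sum_mul, ← mul_sum, ← mul_sum, sum_single_one, mul_one, mul_assoc,
          h.mul_conjTranspose_self, mul_one]
    _ = U * realDiag (fun i => f (a i)) * Uᴴ := by
        simp only [hcolumn, realDiag, ← hdiag, mul_sum, sum_mul, mul_smul_comm, mul_one]

theorem re_trace_mul_cfc (h : Diagonalizes U a A) (S : Matrix n n ℂ) (f : ℝ → ℝ) :
    (S * cfc f A).trace.re = ∑ i, f (a i) * ((Uᴴ * S * U) i i).re := by
  rw [h.cfc_eq, ← mul_assoc, ← mul_assoc, re_trace_mul_realDiag_mul]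
  simp only [mul_assoc]

theorem le_of_le_smul_one (h : Diagonalizes U a A) {L : ℝ} (hL : A ≤ L • 1) (i : n) : a i ≤ L := by
  have hconj := star_left_conjugate_le_conjugate hL U
  rw [star_eq_conjTranspose, h.conjTranspose_mul_mul, mul_smul_comm, smul_mul_assoc, mul_one,
    h.conjTranspose_mul_self, Matrix.le_iff] at hconj
  have hentry := hconj.diag_nonneg (i := i)
  rwa [Matrix.sub_apply, realDiag, diagonal_apply_eq, Matrix.smul_apply, one_apply_eq,
    Complex.real_smul, mul_one, sub_nonneg, Complex.real_le_real] at hentry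

end Diagonalizes

end FunctionalCalculus

section RelativeEntropy

variable {n : Type*} [Fintype n] [DecidableEq n] {ρ σ : Matrix n n ℂ}

omit [DecidableEq n] in
theorem sq_re_conjTranspose_mul_apply_le (P Q : Matrix n n ℂ) (i : n) :
    ((Pᴴ * Q) i i).re ^ 2 ≤ ((Pᴴ * P) i i).re * ((Qᴴ * Q) i i).re := by
  have htriangle : |((Pᴴ * Q) i i).re| ≤ ∑ j, ‖P j i‖ * ‖Q j i‖ := by
    refine (Complex.abs_re_le_norm _).trans ?_
    rw [mul_apply]
    refine (norm_sum_le _ _).trans_eq (sum_congr rfl fun j _ => ?_)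
    rw [norm_mul, conjTranspose_apply, norm_star]
  rw [re_conjTranspose_mul_self_apply, re_conjTranspose_mul_self_apply, ← sq_abs]
  exact (pow_le_pow_left₀ (abs_nonneg _) htriangle 2).trans (sum_mul_sq_le_sq_mul_sq _ _ _)

theorem two_mul_sub_sub_le_div {l q z a b t : ℝ} (hl : 0 < l) (hq : 0 < q) (ht : 0 ≤ t)
    (ha : z ^ 2 ≤ q * a) (hb : z ^ 2 ≤ q * b) :
    2 * (l * z) - a - t * (l * b) ≤ l * q / (1 / l + t) := by
  have ha' : z ^ 2 / q ≤ a := (div_le_iff₀' hq).2 ha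
  have hb' : z ^ 2 / q ≤ b := (div_le_iff₀' hq).2 hb
  have hsquare : l * q / (1 / l + t) - (2 * (l * z) - z ^ 2 / q - t * (l * (z ^ 2 / q))) =
      (l * q - (1 + t * l) * z) ^ 2 / (q * (1 + t * l)) := by
    field_simp
    ring
  have hnonneg : 0 ≤ (l * q - (1 + t * l) * z) ^ 2 / (q * (1 + t * l)) := by positivity
  have : t * (l * (z ^ 2 / q)) ≤ t * (l * b) := by gcongr
  linarith

/-- The quadratic form in the trial operator `X` whose supremum over `X` is the resolvent
`Tr[ρ^{1/2} (Δ + t)⁻¹ ρ^{1/2}]` of the relative modular operator `Δ = L_σ R_ρ⁻¹`; the relative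
entropy is an integral over `t` of these suprema. -/
def resolventForm (ρ σ : Matrix n n ℂ) (t : ℝ) (X : Matrix n n ℂ) : ℝ :=
  2 * (X * ρ).trace.re - (Xᴴ * σ * X).trace.re - t * (X * ρ * Xᴴ).trace.re

/-- Monotonicity of the resolvent under the channel that prepares the columns of `G`. -/
theorem resolventForm_congr_le {G : Matrix n n ℂ} {l : n → ℝ} (hl : ∀ i, 0 < l i)
    (hG : ∀ i, 0 < ((Gᴴ * G) i i).re) {t : ℝ} (ht : 0 ≤ t) (X : Matrix n n ℂ) :
    resolventForm (G * realDiag l * Gᴴ) (G * Gᴴ) t X ≤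
      ∑ i, l i * ((Gᴴ * G) i i).re / (1 / l i + t) := by
  have hlin : (X * (G * realDiag l * Gᴴ)).trace.re = ∑ i, l i * ((Gᴴ * (X * G)) i i).re := by
    rw [← re_trace_mul_realDiag_mul]
    simp only [mul_assoc]
  have hσ : (Xᴴ * (G * Gᴴ) * X).trace.re = ∑ i, (((Xᴴ * G)ᴴ * (Xᴴ * G)) i i).re := by
    rw [conjTranspose_mul, conjTranspose_conjTranspose, ← mul_assoc, mul_assoc, trace_mul_comm,
      trace, Complex.re_sum]
    rfl
  have hρ : (X * (G * realDiag l * Gᴴ) * Xᴴ).trace.re =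
      ∑ i, l i * (((X * G)ᴴ * (X * G)) i i).re := by
    rw [← re_trace_mul_realDiag_mul, conjTranspose_mul]
    simp only [mul_assoc]
  rw [resolventForm, hlin, hσ, hρ, mul_sum, mul_sum, ← sum_sub_distrib, ← sum_sub_distrib]
  refine sum_le_sum fun i _ => two_mul_sub_sub_le_div (hl i) (hG i) ht ?_ ?_
  · have := sq_re_conjTranspose_mul_apply_le (Xᴴ * G) G i
    rw [conjTranspose_mul, conjTranspose_conjTranspose, mul_assoc Gᴴ X G] at this
    rwa [mul_comm, conjTranspose_mul, conjTranspose_conjTranspose]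
  · exact sq_re_conjTranspose_mul_apply_le G (X * G) i

section Eigenbases

variable {U V : Matrix n n ℂ} {r s : n → ℝ}

theorem resolventForm_conj (hU : Uᴴ * U = 1) (hV : Vᴴ * V = 1) (ρ σ : Matrix n n ℂ) (t : ℝ)
    (Y : Matrix n n ℂ) :
    resolventForm (U * ρ * Uᴴ) (V * σ * Vᴴ) t (V * Y * Uᴴ) =
      2 * (Y * ρ * (Vᴴ * U)ᴴ).trace.re - (Yᴴ * σ * Y).trace.re - t * (Y * ρ * Yᴴ).trace.re := by
  have hcancelU (Z : Matrix n n ℂ) : Uᴴ * (U * Z) = Z := by rw [← mul_assoc, hU, one_mul]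
  have hcancelV (Z : Matrix n n ℂ) : Vᴴ * (V * Z) = Z := by rw [← mul_assoc, hV, one_mul]
  have hcycleU (Z : Matrix n n ℂ) : (U * Z).trace = (Z * U).trace := trace_mul_comm _ _
  have hcycleV (Z : Matrix n n ℂ) : (V * Z).trace = (Z * V).trace := trace_mul_comm _ _
  simp only [resolventForm, conjTranspose_mul, conjTranspose_conjTranspose, mul_assoc, hcancelU,
    hcancelV, hcycleU, hcycleV, hU, hV, mul_one]

theorem exists_resolventForm_eq (hρ : Diagonalizes U r ρ) (hσ : Diagonalizes V s σ)
    (hr : ∀ a, 0 < r a) (hs : ∀ b, 0 < s b) {t : ℝ} (ht : 0 ≤ t) :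
    ∃ X, resolventForm ρ σ t X =
      ∑ a, ∑ b, ‖(Vᴴ * U) b a‖ ^ 2 * r a / (s b / r a + t) := by
  set P := Vᴴ * U with hP
  let c : n → n → ℝ := fun b a => r a / (s b + t * r a)
  let Y : Matrix n n ℂ := Matrix.of fun b a => (c b a : ℂ) * P b a
  have hYnorm (b a : n) : ‖Y b a‖ ^ 2 = c b a ^ 2 * ‖P b a‖ ^ 2 := by
    simp only [Y, of_apply, norm_mul, mul_pow, Complex.norm_real, Real.norm_eq_abs, sq_abs]
  have hYP : (Y * realDiag r * Pᴴ).trace.re = ∑ a, ∑ b, r a * (c b a * ‖P b a‖ ^ 2) := by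
    rw [re_trace_mul_realDiag_mul]
    refine sum_congr rfl fun a _ => ?_
    rw [mul_apply, Complex.re_sum, mul_sum]
    refine sum_congr rfl fun b _ => ?_
    rw [conjTranspose_apply, show Y b a = c b a * P b a from rfl, mul_left_comm, RCLike.star_def,
      ← Complex.normSq_eq_conj_mul_self, ← Complex.ofReal_mul, Complex.ofReal_re,
      Complex.normSq_eq_norm_sq]
  have hYs : (Yᴴ * realDiag s * Y).trace.re = ∑ a, ∑ b, s b * ‖Y b a‖ ^ 2 := by
    simp only [re_trace_mul_realDiag_mul, re_mul_conjTranspose_self_apply, mul_sum]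
    exact sum_comm
  have hYr : (Y * realDiag r * Yᴴ).trace.re = ∑ a, ∑ b, r a * ‖Y b a‖ ^ 2 := by
    simp only [re_trace_mul_realDiag_mul, re_conjTranspose_mul_self_apply, mul_sum]
  refine ⟨V * Y * Uᴴ, ?_⟩
  rw [hρ.eq, hσ.eq, resolventForm_conj hρ.conjTranspose_mul_self hσ.conjTranspose_mul_self, ← hP,
    hYP, hYs, hYr]
  simp only [hYnorm, mul_sum, ← sum_sub_distrib]
  refine sum_congr rfl fun a _ => sum_congr rfl fun b _ => ?_
  have hr' := hr a
  have hs' := hs b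
  rw [div_add' _ _ _ hr'.ne']
  simp only [c]
  field_simp
  ring

theorem re_conjTranspose_mul_mul_apply (hρ : Diagonalizes U r ρ) (V : Matrix n n ℂ) (b : n) :
    ((Vᴴ * ρ * V) b b).re = ∑ a, ‖(Vᴴ * U) b a‖ ^ 2 * r a := by
  have hconj : Vᴴ * ρ * V = (Vᴴ * U) * realDiag r * (Vᴴ * U)ᴴ := by
    rw [hρ.eq, conjTranspose_mul, conjTranspose_conjTranspose]
    simp only [mul_assoc]
  rw [hconj, mul_apply, Complex.re_sum]
  refine sum_congr rfl fun a _ => ?_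
  rw [mul_diagonal, conjTranspose_apply, RCLike.star_def, mul_right_comm, Complex.mul_conj,
    Complex.normSq_eq_norm_sq, ← Complex.ofReal_mul, Complex.ofReal_re]

theorem sum_sq_norm_conjTranspose_mul_apply (hU : Uᴴ * U = 1) (hV : V * Vᴴ = 1) (a : n) :
    ∑ b, ‖(Vᴴ * U) b a‖ ^ 2 = 1 := by
  have hunitary : (Vᴴ * U)ᴴ * (Vᴴ * U) = 1 := by
    rw [conjTranspose_mul, conjTranspose_conjTranspose, mul_assoc, ← mul_assoc V, hV, one_mul, hU]
  rw [← re_conjTranspose_mul_self_apply, hunitary, one_apply_eq, Complex.one_re]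

theorem relEntropy_eq_sum (hρ : Diagonalizes U r ρ) (hσ : Diagonalizes V s σ) :
    relEntropy ρ σ =
      ∑ a, ∑ b, ‖(Vᴴ * U) b a‖ ^ 2 * r a * (Real.log (r a) - Real.log (s b)) := by
  have hentropy : (ρ * matLog ρ).trace.re =
      ∑ a, ∑ b, ‖(Vᴴ * U) b a‖ ^ 2 * r a * Real.log (r a) := by
    rw [matLog, hρ.re_trace_mul_cfc]
    refine sum_congr rfl fun a _ => ?_
    rw [hρ.conjTranspose_mul_mul, realDiag, diagonal_apply_eq, Complex.ofReal_re, ← sum_mul,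
      ← sum_mul, sum_sq_norm_conjTranspose_mul_apply hρ.conjTranspose_mul_self
        hσ.mul_conjTranspose_self, one_mul, mul_comm]
  have hcross : (ρ * matLog σ).trace.re =
      ∑ a, ∑ b, ‖(Vᴴ * U) b a‖ ^ 2 * r a * Real.log (s b) := by
    rw [matLog, hσ.re_trace_mul_cfc, sum_comm]
    refine sum_congr rfl fun b _ => ?_
    rw [re_conjTranspose_mul_mul_apply hρ, ← sum_mul, mul_comm]
  simp only [relEntropy, mul_sub, trace_sub, Complex.sub_re, hentropy, hcross, sum_sub_distrib]

theorem re_trace_eq_sum (hρ : Diagonalizes U r ρ) (hV : V * Vᴴ = 1) :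
    ρ.trace.re = ∑ a, ∑ b, ‖(Vᴴ * U) b a‖ ^ 2 * r a := by
  have hcycle : (Vᴴ * ρ * V).trace = ρ.trace := by
    rw [trace_mul_comm, ← mul_assoc, hV, one_mul]
  rw [← hcycle, trace, Complex.re_sum, sum_comm]
  exact sum_congr rfl fun b _ => re_conjTranspose_mul_mul_apply hρ V b

end Eigenbases

/-- Monotonicity of the relative entropy under the channel that prepares the columns of `G`. -/
theorem relEntropy_congr_le {G : Matrix n n ℂ} {l : n → ℝ} (hl : ∀ i, 0 < l i)
    (hG : ∀ i, 0 < ((Gᴴ * G) i i).re) (hρ : (G * realDiag l * Gᴴ).PosDef)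
    (hσ : (G * Gᴴ).PosDef) :
    relEntropy (G * realDiag l * Gᴴ) (G * Gᴴ) ≤
      ∑ i, l i * ((Gᴴ * G) i i).re * Real.log (l i) := by
  obtain ⟨U, r, hUρ, hr⟩ := exists_diagonalizes hρ
  obtain ⟨V, s, hVσ, hs⟩ := exists_diagonalizes hσ
  have htrace := (re_trace_eq_sum hUρ hVσ.mul_conjTranspose_self).symm.trans
    (re_trace_mul_realDiag_mul G Gᴴ l)
  have hlog := sum_mul_log_nonneg_of_sum_div_nonpos
    (Sum.elim (fun ab : n × n => ‖(Vᴴ * U) ab.2 ab.1‖ ^ 2 * r ab.1)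
      fun i => -(l i * ((Gᴴ * G) i i).re))
    (Sum.elim (fun ab => s ab.2 / r ab.1) fun i => 1 / l i)
    (Sum.rec (fun ab => div_pos (hs _) (hr _)) fun i => one_div_pos.2 (hl i))
    (by simp only [Fintype.sum_sum_type, Fintype.sum_prod_type, Sum.elim_inl, Sum.elim_inr,
          sum_neg_distrib, htrace, add_neg_cancel])
    fun t ht => by
      obtain ⟨X, hX⟩ := exists_resolventForm_eq hUρ hVσ hr hs ht
      have := hX.symm.trans_le (resolventForm_congr_le hl hG ht X)
      simpa only [Fintype.sum_sum_type, Fintype.sum_prod_type, Sum.elim_inl, Sum.elim_inr, neg_div,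
        sum_neg_distrib, ← sub_eq_add_neg, sub_nonpos] using this
  simp only [Fintype.sum_sum_type, Fintype.sum_prod_type, Sum.elim_inl, Sum.elim_inr, one_div,
    Real.log_inv, neg_mul_neg, Real.log_div (hs _).ne' (hr _).ne'] at hlog
  rw [relEntropy_eq_sum hUρ hVσ, ← sub_nonneg]
  convert hlog using 1
  simp only [sub_eq_add_neg, ← sum_neg_distrib, ← mul_neg, neg_add_rev, neg_neg, add_comm]

end RelativeEntropy

section ReverseTest

variable {n : Type*} [Fintype n] [DecidableEq n] {ρ σ : Matrix n n ℂ}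

theorem matPow_eq_rpow {A : Matrix n n ℂ} (hA : A.PosDef) (p : ℝ) : matPow A p = A ^ p :=
  (CFC.rpow_eq_cfc_real hA.posSemidef.nonneg).symm

theorem conjTranspose_matPow (A : Matrix n n ℂ) (p : ℝ) : (matPow A p)ᴴ = matPow A p :=
  cfc_predicate (R := ℝ) (p := IsSelfAdjoint) (fun x : ℝ => x ^ p) A

theorem matPow_mul_matPow {A : Matrix n n ℂ} (hA : A.PosDef) (p q : ℝ) :
    matPow A p * matPow A q = matPow A (p + q) := by
  rw [matPow_eq_rpow hA, matPow_eq_rpow hA, matPow_eq_rpow hA, CFC.rpow_add hA.isUnit]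

theorem matPow_half_mul_self {A : Matrix n n ℂ} (hA : A.PosDef) :
    matPow A (1 / 2) * matPow A (1 / 2) = A := by
  rw [matPow_mul_matPow hA, add_halves, matPow_eq_rpow hA, CFC.rpow_one A hA.posSemidef.nonneg]

theorem matPow_mul_matPow_neg {A : Matrix n n ℂ} (hA : A.PosDef) (p : ℝ) :
    matPow A p * matPow A (-p) = 1 := by
  rw [matPow_mul_matPow hA, add_neg_cancel, matPow_eq_rpow hA,
    CFC.rpow_zero A hA.posSemidef.nonneg]

theorem matPow_neg_mul_matPow {A : Matrix n n ℂ} (hA : A.PosDef) (p : ℝ) :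
    matPow A (-p) * matPow A p = 1 :=
  mul_eq_one_comm.1 (matPow_mul_matPow_neg hA p)

theorem inv_eq_matPow_mul_matPow {A : Matrix n n ℂ} (hA : A.PosDef) :
    A⁻¹ = matPow A (-(1 / 2)) * matPow A (-(1 / 2)) := by
  refine inv_eq_right_inv ?_
  conv_lhs => enter [1]; rw [← matPow_half_mul_self hA]
  rw [mul_assoc, ← mul_assoc (matPow A (1 / 2)) (matPow A (-(1 / 2))), matPow_mul_matPow_neg hA,
    one_mul, matPow_mul_matPow_neg hA]

/-- The noncommutative density `σ^{-1/2} ρ σ^{-1/2}` of `ρ` with respect to `σ`. -/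
def relDensity (ρ σ : Matrix n n ℂ) : Matrix n n ℂ :=
  matPow σ (-(1 / 2)) * ρ * matPow σ (-(1 / 2))

theorem matPow_half_mul_relDensity_mul_matPow_half (hσ : σ.PosDef) :
    matPow σ (1 / 2) * relDensity ρ σ * matPow σ (1 / 2) = ρ := by
  rw [relDensity, mul_assoc, mul_assoc _ (matPow _ _), matPow_neg_mul_matPow hσ, mul_one,
    ← mul_assoc, matPow_mul_matPow_neg hσ, one_mul]

theorem relDensity_posDef (hρ : ρ.PosDef) (hσ : σ.PosDef) : (relDensity ρ σ).PosDef := by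
  have hunit : IsUnit (matPow σ (-(1 / 2))) :=
    IsUnit.of_mul_eq_one _ (matPow_neg_mul_matPow hσ (1 / 2))
  simpa only [relDensity, conjTranspose_matPow] using
    hρ.conjTranspose_mul_mul_same (mulVec_injective_of_isUnit hunit)

theorem relDensity_le {L : ℝ} (hσ : σ.PosDef) (h : ρ ≤ L • σ) : relDensity ρ σ ≤ L • 1 := by
  have hunit : matPow σ (-(1 / 2)) * σ * matPow σ (-(1 / 2)) = 1 := by
    conv_lhs => enter [1, 2]; rw [← matPow_half_mul_self hσ]
    rw [← mul_assoc, matPow_neg_mul_matPow hσ, one_mul, matPow_mul_matPow_neg hσ]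
  have hconj := star_left_conjugate_le_conjugate h (matPow σ (-(1 / 2)))
  rwa [star_eq_conjTranspose, conjTranspose_matPow, mul_smul_comm, smul_mul_assoc, hunit] at hconj

theorem geomRenyi_of_ne_one {q : ℝ} (hq : q ≠ 1) (hσ : σ.PosDef) :
    geomRenyi q ρ σ =
      1 / (q - 1) * Real.log (σ * cfc (fun x : ℝ => x ^ q) (relDensity ρ σ)).trace.re := by
  rw [geomRenyi, if_neg hq, trace_mul_comm, ← mul_assoc, matPow_half_mul_self hσ]
  rfl

theorem bsEntropy_eq_trace (hρ : ρ.PosDef) (hσ : σ.PosDef) :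
    bsEntropy ρ σ = (σ * cfc (fun x => x * Real.log x) (relDensity ρ σ)).trace.re := by
  set r := matPow ρ (1 / 2) with hr
  set s := matPow σ (1 / 2)
  set s' := matPow σ (-(1 / 2)) with hs'
  have hrH : rᴴ = r := conjTranspose_matPow _ _
  have hsH : sᴴ = s := conjTranspose_matPow _ _
  have hs'H : s'ᴴ = s' := conjTranspose_matPow _ _
  have hrr : r * r = ρ := matPow_half_mul_self hρ
  have hss : s * s = σ := matPow_half_mul_self hσ
  have hs's : s' * s = 1 := matPow_neg_mul_matPow hσ _
  obtain ⟨Y, hY⟩ : ∃ Y, Y = r * s' := ⟨_, rfl⟩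
  have hYs : Y * s = r := by rw [hY, mul_assoc, hs's, mul_one]
  have hsY : s * Yᴴ = r := by
    simpa only [conjTranspose_mul, hsH, hrH] using congrArg conjTranspose hYs
  have hYYH : r * σ⁻¹ * r = Y * Yᴴ := by
    rw [hY, conjTranspose_mul, hrH, hs'H, inv_eq_matPow_mul_matPow hσ, ← hs']
    simp only [mul_assoc]
  have hYHY : Yᴴ * Y = relDensity ρ σ := by
    rw [hY, conjTranspose_mul, hrH, hs'H, relDensity, ← hrr]
    simp only [mul_assoc, ← hs']
  have hdensity := isHermitian_conjTranspose_mul_self Y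
  have hswap : cfc Real.log (Y * Yᴴ) * Y = Y * cfc Real.log (Yᴴ * Y) :=
    cfc_mul_eq_mul_cfc (isHermitian_mul_conjTranspose_self Y) hdensity (mul_assoc _ _ _) _
  rw [bsEntropy, ← hr, hYYH, ← hYHY, cfc_mul _ _ _ (continuousOn_spectrum _ _)
    (continuousOn_spectrum _ _), cfc_id' ℝ (Yᴴ * Y) hdensity.isSelfAdjoint, matLog]
  congr 1
  calc (ρ * cfc Real.log (Y * Yᴴ)).trace
      = (r * (cfc Real.log (Y * Yᴴ) * Y) * s).trace := by
        rw [← hrr, mul_assoc, trace_mul_comm, mul_assoc r _ s, mul_assoc (cfc _ _) Y s, hYs,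
          ← mul_assoc]
    _ = (s * r * (Y * cfc Real.log (Yᴴ * Y))).trace := by
        rw [hswap, trace_mul_comm, ← mul_assoc]
    _ = (σ * (Yᴴ * Y * cfc Real.log (Yᴴ * Y))).trace := by
        rw [← hss, ← hsY]
        simp only [mul_assoc]

/-- Testing `σ` and `ρ` in the eigenbasis of `σ^{-1/2} ρ σ^{-1/2}` gives distributions
`(pᵢ / lᵢ)` and `(pᵢ)` with likelihood ratios `lᵢ`: Matsumoto's optimal reverse test. -/
theorem exists_reverse_test (hρ : ρ.PosDef) (hσ : σ.PosDef) :
    ∃ p l : n → ℝ, (∀ i, 0 < p i) ∧ (∀ i, 0 < l i) ∧ ∑ i, p i = ρ.trace.re ∧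
      (∀ L : ℝ, ρ ≤ L • σ → ∀ i, l i ≤ L) ∧
      relEntropy ρ σ ≤ ∑ i, p i * Real.log (l i) ∧
      bsEntropy ρ σ = ∑ i, p i * Real.log (l i) ∧
      ∀ q ≠ 1, geomRenyi q ρ σ = 1 / (q - 1) * Real.log (∑ i, p i * l i ^ (q - 1)) := by
  obtain ⟨W, l, hW, hl⟩ := exists_diagonalizes (relDensity_posDef hρ hσ)
  set s := matPow σ (1 / 2) with hs
  have hsH : sᴴ = s := conjTranspose_matPow _ _
  have hσG : (s * W) * (s * W)ᴴ = σ := by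
    rw [conjTranspose_mul, hsH, mul_assoc, ← mul_assoc W, hW.mul_conjTranspose_self, one_mul,
      matPow_half_mul_self hσ]
  have hρG : (s * W) * realDiag l * (s * W)ᴴ = ρ := by
    rw [conjTranspose_mul, hsH, mul_assoc s, mul_assoc s, ← mul_assoc _ Wᴴ, ← hW.eq, ← mul_assoc,
      matPow_half_mul_relDensity_mul_matPow_half hσ]
  have hGG : (s * W)ᴴ * (s * W) = Wᴴ * σ * W := by
    rw [conjTranspose_mul, hsH, ← matPow_half_mul_self hσ]
    simp only [mul_assoc, hs]
  have hweight (i : n) : 0 < ((Wᴴ * σ * W) i i).re := by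
    have hWunit : IsUnit W := IsUnit.of_mul_eq_one _ hW.mul_conjTranspose_self
    exact (Complex.pos_iff.1
      (hσ.conjTranspose_mul_mul_same (mulVec_injective_of_isUnit hWunit)).diag_pos).1
  refine ⟨fun i => l i * ((Wᴴ * σ * W) i i).re, l, fun i => mul_pos (hl i) (hweight i), hl,
    ?_, fun L hL => hW.le_of_le_smul_one (relDensity_le hσ hL), ?_, ?_, fun q hq => ?_⟩
  · rw [← hGG, ← re_trace_mul_realDiag_mul, hρG]
  · have := relEntropy_congr_le hl (fun i => (hGG ▸ hweight i : _)) (hρG ▸ hρ) (hσG ▸ hσ)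
    rwa [hρG, hσG, hGG] at this
  · rw [bsEntropy_eq_trace hρ hσ, hW.re_trace_mul_cfc]
    exact sum_congr rfl fun i _ => by ring
  · rw [geomRenyi_of_ne_one hq hσ, hW.re_trace_mul_cfc]
    congr 3 with i
    rw [Real.rpow_sub_one (hl i).ne']
    field_simp [(hl i).ne']

end ReverseTest

theorem relEntropy_le_bsEntropy_le_geomRenyi_le {n : Type*} [Fintype n] [DecidableEq n]
    {ρ σ : Matrix n n ℂ} (hρ : ρ.PosDef) (hσ : σ.PosDef) (htr : ρ.trace = 1) {L : ℝ}
    (hL : ρ ≤ L • σ) {q : ℝ} (hq : 1 ≤ q) :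
    relEntropy ρ σ ≤ bsEntropy ρ σ ∧ bsEntropy ρ σ ≤ geomRenyi q ρ σ ∧
      geomRenyi q ρ σ ≤ Real.log L := by
  obtain ⟨p, l, hp, hl, hsum, hlL, hrel, hbs, hrenyi⟩ := exists_reverse_test hρ hσ
  have hp1 : ∑ i, p i = 1 := by rw [hsum, htr, Complex.one_re]
  refine ⟨hrel.trans_eq hbs.symm, ?_⟩
  obtain rfl | hq1 := hq.eq_or_lt
  · rw [geomRenyi, if_pos rfl, hbs]
    exact ⟨le_rfl, sum_mul_log_le_log_of_le hp hp1 hl (hlL L hL)⟩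
  · rw [hbs, hrenyi q hq1.ne']
    exact ⟨sum_mul_log_le_div_log_sum_rpow hp hp1 hl hq1,
      div_log_sum_rpow_le_log hp hp1 hl (hlL L hL) hq1⟩

section Expansionals

variable {𝔸 : Type*} [NormedRing 𝔸]

/-- The imaginary-time evolution `e^H V e^{-H}` of `V` under `H`. -/
def evolve (H V : 𝔸) : 𝔸 := exp H * V * exp (-H)

/-- Araki's expansional `e^H e^{-K}`. -/
def expansional (H K : 𝔸) : 𝔸 := exp H * exp (-K)

variable [NormedAlgebra ℝ 𝔸]

/-- The inner derivation `[H, ·]` as a continuous linear map. -/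
def commutatorCLM (H : 𝔸) : 𝔸 →L[ℝ] 𝔸 :=
  ContinuousLinearMap.mul ℝ 𝔸 H - (ContinuousLinearMap.mul ℝ 𝔸).flip H

theorem commutatorCLM_smul (s : ℝ) (H : 𝔸) : commutatorCLM (s • H) = s • commutatorCLM H := by
  simp only [commutatorCLM, map_smul, smul_sub]

variable [CompleteSpace 𝔸]

theorem exp_add_of_commute_real {x y : 𝔸} (h : Commute x y) : exp (x + y) = exp x * exp y := by
  let : NormedAlgebra ℚ 𝔸 := .restrictScalars ℚ ℝ 𝔸
  exact exp_add_of_commute h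

theorem exp_mul_exp_neg (x : 𝔸) : exp x * exp (-x) = 1 := by
  rw [← exp_add_of_commute_real (Commute.neg_right rfl), add_neg_cancel, exp_zero]

theorem exp_neg_mul_exp (x : 𝔸) : exp (-x) * exp x = 1 := by
  simpa only [neg_neg] using exp_mul_exp_neg (-x)

theorem expansional_mul_expansional (H K L : 𝔸) :
    expansional H K * expansional K L = expansional H L := by
  rw [expansional, expansional, mul_assoc, ← mul_assoc (exp (-K)), exp_neg_mul_exp, one_mul]
  rfl

theorem expansional_self (H : 𝔸) : expansional H H = 1 := exp_mul_exp_neg H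

theorem evolve_mul_expansional (H V K : 𝔸) :
    evolve H V * expansional H K = exp H * V * exp (-K) := by
  rw [evolve, expansional, mul_assoc, ← mul_assoc (exp (-H)), exp_neg_mul_exp, one_mul]

theorem expansional_mul_evolve (K H V : 𝔸) :
    expansional K H * evolve H V = exp K * V * exp (-H) := by
  rw [evolve, expansional, mul_assoc, mul_assoc (exp H), ← mul_assoc (exp (-H)), exp_neg_mul_exp,
    one_mul, mul_assoc]

theorem hasDerivAt_expansional_smul (H K : 𝔸) (s : ℝ) :
    HasDerivAt (fun s : ℝ => expansional (s • H) (s • K))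
      (exp (s • H) * (H - K) * exp (-(s • K))) s := by
  have h := (hasDerivAt_exp_smul_const (𝕂 := ℝ) H s).mul
    (hasDerivAt_exp_smul_const' (𝕂 := ℝ) (-K) s)
  simp only [smul_neg] at h
  refine h.congr_deriv ?_
  simp only [mul_add, add_mul, mul_assoc, neg_mul, mul_neg, sub_eq_add_neg]

theorem hasDerivAt_expansional_inv_mul (H H' V : 𝔸) (s : ℝ) :
    HasDerivAt (fun s : ℝ =>
        expansional (s • (H + V)) (s • H) * expansional (s • H') (s • (H' + V)))
      (expansional (s • (H + V)) (s • H) * (evolve (s • H) V - evolve (s • H') V) *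
        expansional (s • H') (s • (H' + V))) s := by
  refine ((hasDerivAt_expansional_smul _ _ s).mul
    (hasDerivAt_expansional_smul _ _ s)).congr_deriv ?_
  rw [add_sub_cancel_left, sub_add_cancel_left, ← expansional_mul_evolve,
    ← evolve_mul_expansional, evolve, evolve, evolve]
  noncomm_ring

theorem hasSum_exp_apply {E : Type*} [NormedAddCommGroup E] [NormedSpace ℝ E] [CompleteSpace E]
    (T : E →L[ℝ] E) (x : E) :
    HasSum (fun k : ℕ => (k.factorial⁻¹ : ℝ) • (T ^ k) x) (exp T x) :=
  (exp_series_hasSum_exp' (𝕂 := ℝ) T).mapL (ContinuousLinearMap.apply ℝ E x)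

theorem exp_mulLeft_apply (H x : 𝔸) : exp (ContinuousLinearMap.mul ℝ 𝔸 H) x = exp H * x := by
  refine (hasSum_exp_apply _ x).unique
    (((exp_series_hasSum_exp' (𝕂 := ℝ) H).mul_right x).congr_fun fun k => ?_)
  rw [smul_mul_assoc]
  congr 1
  induction k with
  | zero => rw [pow_zero, pow_zero, one_mul, one_apply_eq_self]
  | succ k ih =>
    rw [pow_succ', pow_succ', mul_assoc, ← ih]
    rfl

theorem exp_mulRight_apply (H x : 𝔸) :
    exp ((ContinuousLinearMap.mul ℝ 𝔸).flip H) x = x * exp H := by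
  refine (hasSum_exp_apply _ x).unique
    (((exp_series_hasSum_exp' (𝕂 := ℝ) H).mul_left x).congr_fun fun k => ?_)
  rw [mul_smul_comm]
  congr 1
  induction k with
  | zero => rw [pow_zero, pow_zero, mul_one, one_apply_eq_self]
  | succ k ih =>
    rw [pow_succ', pow_succ, ← mul_assoc, ← ih]
    rfl

theorem exp_commutatorCLM_apply (H V : 𝔸) : exp (commutatorCLM H) V = evolve H V := by
  have hcomm : Commute (ContinuousLinearMap.mul ℝ 𝔸 H)
      ((ContinuousLinearMap.mul ℝ 𝔸).flip (-H)) := by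
    ext y
    exact (mul_assoc H y (-H)).symm
  rw [commutatorCLM, sub_eq_add_neg, ← map_neg, exp_add_of_commute_real hcomm, evolve, mul_assoc]
  exact (exp_mulLeft_apply _ _).trans (congrArg _ (exp_mulRight_apply _ _))

theorem hasSum_evolve_smul (H V : 𝔸) (s : ℝ) :
    HasSum (fun k : ℕ => (s ^ k / k.factorial) • (commutatorCLM H ^ k) V) (evolve (s • H) V) := by
  rw [← exp_commutatorCLM_apply, commutatorCLM_smul]
  refine (hasSum_exp_apply _ V).congr_fun fun k => ?_
  rw [smul_pow, _root_.smul_apply, smul_smul, inv_mul_eq_div]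

end Expansionals

section Shells

variable {𝔸 : Type*} [NormedRing 𝔸]

/-- The part of `[H, ·]^k V` that has spread exactly to the `n`-th neighbourhood, for a Hamiltonian
`H = ∑ D k` that is decomposed into shells. -/
def nestedComm (D : ℕ → 𝔸) (V : 𝔸) : ℕ → ℕ → 𝔸
  | 0, 0 => V
  | 0, _ + 1 => 0
  | _ + 1, 0 => 0
  | k + 1, n + 1 => ((∑ j ∈ range (n + 1), D j) * nestedComm D V k (n + 1) -
      nestedComm D V k (n + 1) * ∑ j ∈ range (n + 1), D j) +
      (D n * nestedComm D V k n - nestedComm D V k n * D n)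

/-- A Hamiltonian `∑ D k` in shells around a local operator `V`, with the algebras `S n` of
operators on increasing neighbourhoods. -/
structure IsShelling (D : ℕ → 𝔸) (V : 𝔸) (S : ℕ → Subring 𝔸) (b : ℝ) : Prop where
  mono : Monotone S
  mem_zero : V ∈ S 0
  mem_succ : ∀ k, D k ∈ S (k + 1)
  commute : ∀ k n, n < k → ∀ x ∈ S n, Commute (D k) x
  norm_le : ∀ k, ‖D k‖ ≤ b

/-- The constant in the locality estimate for the imaginary-time evolution: it bounds
`∑ e^{4bn} e^n / n!`. -/
def shellConst (b : ℝ) : ℝ := Real.exp (Real.exp (4 * b + 1))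

theorem shellConst_pos (b : ℝ) : 0 < shellConst b := Real.exp_pos _

theorem norm_commutator_le (x y : 𝔸) {b : ℝ} (h : ‖x‖ ≤ b) : ‖x * y - y * x‖ ≤ 2 * b * ‖y‖ :=
  calc ‖x * y - y * x‖ ≤ ‖x‖ * ‖y‖ + ‖y‖ * ‖x‖ :=
        (norm_sub_le _ _).trans (add_le_add (norm_mul_le x y) (norm_mul_le y x))
    _ = 2 * ‖x‖ * ‖y‖ := by ring
    _ ≤ 2 * b * ‖y‖ := by gcongr

theorem pow_div_factorial_le_succ {b : ℝ} (hb : 0 ≤ b) (k n : ℕ) :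
    (4 * b * n) ^ k / n.factorial ≤
      (n + 1 : ℕ) * ((4 * b * (n + 1 : ℕ)) ^ k / (n + 1).factorial) := by
  have hcancel : ((n + 1 : ℕ) : ℝ) * ((4 * b * (n + 1 : ℕ)) ^ k / (n + 1).factorial) =
      (4 * b * (n + 1 : ℕ)) ^ k / n.factorial := by
    rw [Nat.factorial_succ, Nat.cast_mul]
    field_simp
  rw [hcancel]
  gcongr
  exact n.le_succ

theorem sum_exp_mul_div_factorial_le (x : ℝ) (M N : ℕ) :
    ∑ n ∈ Ico M N, Real.exp (x * n) / n.factorial ≤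
      Real.exp (Real.exp (x + 1)) * Real.exp (-M) := by
  calc ∑ n ∈ Ico M N, Real.exp (x * n) / n.factorial
      ≤ ∑ n ∈ Ico M N, Real.exp (x + 1) ^ n / n.factorial * Real.exp (-M) := by
        refine sum_le_sum fun n hn => ?_
        have hMn : (M : ℝ) ≤ n := mod_cast (mem_Ico.1 hn).1
        rw [div_mul_eq_mul_div, ← Real.exp_nat_mul, ← Real.exp_add]
        gcongr
        linarith
    _ ≤ (∑ n ∈ range N, Real.exp (x + 1) ^ n / n.factorial) * Real.exp (-M) := by
        rw [← sum_mul]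
        gcongr
        exact fun n hn => mem_range.2 (mem_Ico.1 hn).2
    _ ≤ Real.exp (Real.exp (x + 1)) * Real.exp (-M) := by
        gcongr
        exact Real.sum_le_exp_of_nonneg (Real.exp_pos _).le N

theorem norm_le_exp_of_norm_deriv_le [NormOneClass 𝔸] [NormedSpace ℝ 𝔸] {f f' : ℝ → 𝔸} {c : ℝ}
    (hf : ∀ s, HasDerivAt f (f' s) s) (h0 : f 0 = 1) (hc : 0 ≤ c)
    (hb : ∀ s, 0 ≤ s → s ≤ 1 → ‖f' s‖ ≤ c * ‖f s‖) {s : ℝ} (hs : 0 ≤ s) (hs1 : s ≤ 1) :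
    ‖f s‖ ≤ Real.exp c := by
  have gronwall := norm_le_gronwallBound_of_norm_deriv_right_le (f := f) (f' := f') (δ := 1)
    (K := c) (ε := 0) (a := 0) (b := 1) (fun x _ => (hf x).continuousAt.continuousWithinAt)
    (fun x _ => (hf x).hasDerivWithinAt) (by rw [h0, norm_one])
    (fun x hx => by rw [add_zero]; exact hb x hx.1 hx.2.le) s ⟨hs, hs1⟩
  rw [gronwallBound_ε0, one_mul, sub_zero] at gronwall
  exact gronwall.trans (Real.exp_le_exp.2 (mul_le_of_le_one_right hc hs1))

namespace IsShelling

variable {D : ℕ → 𝔸} {V : 𝔸} {S : ℕ → Subring 𝔸} {b : ℝ}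

theorem nonneg (h : IsShelling D V S b) : 0 ≤ b := (norm_nonneg _).trans (h.norm_le 0)

theorem sum_mem (h : IsShelling D V S b) (n : ℕ) : ∑ j ∈ range n, D j ∈ S n :=
  _root_.sum_mem fun j hj => h.mono (mem_range.1 hj) (h.mem_succ j)

theorem nestedComm_mem (h : IsShelling D V S b) (k n : ℕ) : nestedComm D V k n ∈ S n := by
  induction k generalizing n with
  | zero => cases n with
    | zero => exact h.mem_zero
    | succ n => exact zero_mem _
  | succ k ih => cases n with
    | zero => exact zero_mem _
    | succ n =>
      have hsum := h.sum_mem (n + 1)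
      have hn := h.mono n.le_succ (ih n)
      exact add_mem (sub_mem (mul_mem hsum (ih _)) (mul_mem (ih _) hsum))
        (sub_mem (mul_mem (h.mem_succ n) hn) (mul_mem hn (h.mem_succ n)))

theorem norm_sum_le (h : IsShelling D V S b) (n : ℕ) : ‖∑ j ∈ range n, D j‖ ≤ n * b := by
  simpa only [sum_const, card_range, nsmul_eq_mul] using
    norm_sum_le_of_le (range n) fun j _ => h.norm_le j

theorem norm_nestedComm_le (h : IsShelling D V S b) (k n : ℕ) :
    ‖nestedComm D V k n‖ ≤ ‖V‖ * ((4 * b * n) ^ k / n.factorial) := by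
  have hb := h.nonneg
  induction k generalizing n with
  | zero => cases n with
    | zero => simp only [nestedComm, pow_zero, Nat.factorial_zero, Nat.cast_one, div_one, mul_one,
        le_refl]
    | succ n =>
      rw [nestedComm, norm_zero]
      positivity
  | succ k ih => cases n with
    | zero =>
      rw [nestedComm, norm_zero]
      positivity
    | succ n =>
      set X := ‖V‖ * ((4 * b * (n + 1 : ℕ)) ^ k / (n + 1).factorial) with hX
      have hstay := (norm_commutator_le _ (nestedComm D V k (n + 1)) (h.norm_sum_le (n + 1))).trans
        (mul_le_mul_of_nonneg_left (ih (n + 1)) (by positivity))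
      have hspread : ‖D n * nestedComm D V k n - nestedComm D V k n * D n‖ ≤
          2 * ((n + 1 : ℕ) * b) * X :=
        calc _ ≤ 2 * b * (‖V‖ * ((4 * b * n) ^ k / n.factorial)) :=
              (norm_commutator_le _ _ (h.norm_le n)).trans
                (mul_le_mul_of_nonneg_left (ih n) (by positivity))
          _ ≤ 2 * b * (‖V‖ *
                ((n + 1 : ℕ) * ((4 * b * (n + 1 : ℕ)) ^ k / (n + 1).factorial))) := by
              gcongr
              exact pow_div_factorial_le_succ hb k n
          _ = 2 * ((n + 1 : ℕ) * b) * X := by rw [hX]; ring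
      calc ‖nestedComm D V (k + 1) (n + 1)‖
          ≤ 2 * ((n + 1 : ℕ) * b) * X + 2 * ((n + 1 : ℕ) * b) * X :=
            norm_add_le_of_le hstay hspread
        _ = ‖V‖ * ((4 * b * (n + 1 : ℕ)) ^ (k + 1) / (n + 1).factorial) := by rw [hX]; ring

theorem sum_nestedComm_succ (h : IsShelling D V S b) (N k : ℕ) :
    ∑ n ∈ range (N + 1), nestedComm D V (k + 1) n =
      (∑ j ∈ range N, D j) * (∑ n ∈ range (N + 1), nestedComm D V k n) -
      (∑ n ∈ range (N + 1), nestedComm D V k n) * ∑ j ∈ range N, D j := by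
  induction N with
  | zero => simp only [zero_add, sum_range_one, nestedComm, range_zero, sum_empty, zero_mul,
      mul_zero, sub_self]
  | succ N ih =>
    have houter (n : ℕ) (hn : n ∈ range N) :
        D N * nestedComm D V k n - nestedComm D V k n * D N = 0 := by
      rw [(h.commute N n (mem_range.1 hn) _ (h.nestedComm_mem k n)).eq, sub_self]
    have hshell : D N * (∑ n ∈ range (N + 1), nestedComm D V k n) -
        (∑ n ∈ range (N + 1), nestedComm D V k n) * D N =
        D N * nestedComm D V k N - nestedComm D V k N * D N := by
      rw [mul_sum, sum_mul, ← sum_sub_distrib, sum_range_succ, sum_eq_zero houter, zero_add]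
    rw [sum_range_succ _ (N + 1), ih, nestedComm, ← hshell,
      sum_range_succ (nestedComm D V k) (N + 1), sum_range_succ D N]
    noncomm_ring

variable [NormedAlgebra ℝ 𝔸]

theorem commutatorCLM_pow_apply (h : IsShelling D V S b) (N k : ℕ) :
    (commutatorCLM (∑ j ∈ range N, D j) ^ k) V = ∑ n ∈ range (N + 1), nestedComm D V k n := by
  induction k with
  | zero => simp only [pow_zero, one_apply_eq_self, sum_range_succ', nestedComm,
      sum_const_zero, zero_add]
  | succ k ih =>
    rw [h.sum_nestedComm_succ, ← ih, pow_succ']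
    rfl

theorem norm_le_of_hasSum_nestedComm (h : IsShelling D V S b) {s : ℝ} (h0 : 0 ≤ s) (h1 : s ≤ 1)
    {T : Finset ℕ} {a : 𝔸}
    (ha : HasSum (fun k : ℕ => (s ^ k / k.factorial) • ∑ n ∈ T, nestedComm D V k n) a) :
    ‖a‖ ≤ ‖V‖ * ∑ n ∈ T, Real.exp (4 * b * n) / n.factorial := by
  have hbound : HasSum (fun k : ℕ => ‖V‖ * ∑ n ∈ T, (4 * b * n) ^ k / k.factorial / n.factorial)
      (‖V‖ * ∑ n ∈ T, Real.exp (4 * b * n) / n.factorial) := by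
    refine HasSum.mul_left _ (hasSum_sum fun n _ => HasSum.div_const ?_ _)
    rw [Real.exp_eq_exp_ℝ]
    exact expSeries_div_hasSum_exp (4 * b * n)
  refine ha.norm_le_of_bounded hbound fun k => ?_
  have hs : ‖s ^ k / k.factorial‖ ≤ 1 / k.factorial := by
    rw [Real.norm_of_nonneg (by positivity)]
    gcongr
    exact pow_le_one₀ h0 h1
  calc ‖(s ^ k / k.factorial) • ∑ n ∈ T, nestedComm D V k n‖
      ≤ (1 / k.factorial) * ∑ n ∈ T, ‖V‖ * ((4 * b * n) ^ k / n.factorial) := by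
        rw [norm_smul]
        gcongr
        exact norm_sum_le_of_le _ fun n _ => h.norm_nestedComm_le k n
    _ = ‖V‖ * ∑ n ∈ T, (4 * b * n) ^ k / k.factorial / n.factorial := by
        rw [mul_sum, mul_sum]
        refine sum_congr rfl fun n _ => ?_
        ring

variable [CompleteSpace 𝔸]

theorem hasSum_evolve (h : IsShelling D V S b) (N : ℕ) (s : ℝ) :
    HasSum (fun k : ℕ => (s ^ k / k.factorial) • ∑ n ∈ range (N + 1), nestedComm D V k n)
      (evolve (s • ∑ j ∈ range N, D j) V) := by
  simpa only [h.commutatorCLM_pow_apply] using hasSum_evolve_smul (∑ j ∈ range N, D j) V s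

theorem norm_evolve_le (h : IsShelling D V S b) {s : ℝ} (h0 : 0 ≤ s) (h1 : s ≤ 1) (N : ℕ) :
    ‖evolve (s • ∑ j ∈ range N, D j) V‖ ≤ ‖V‖ * shellConst b := by
  refine (h.norm_le_of_hasSum_nestedComm h0 h1 (h.hasSum_evolve N s)).trans ?_
  gcongr
  simpa only [range_eq_Ico, shellConst, CharP.cast_eq_zero, neg_zero, Real.exp_zero, mul_one] using
    sum_exp_mul_div_factorial_le (4 * b) 0 (N + 1)

theorem norm_evolve_sub_le (h : IsShelling D V S b) {s : ℝ} (h0 : 0 ≤ s) (h1 : s ≤ 1) {M N : ℕ}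
    (hMN : M ≤ N) :
    ‖evolve (s • ∑ j ∈ range N, D j) V - evolve (s • ∑ j ∈ range M, D j) V‖ ≤
      ‖V‖ * shellConst b * Real.exp (-M) := by
  have hsum := (h.hasSum_evolve N s).sub (h.hasSum_evolve M s)
  simp only [← smul_sub, ← sum_Ico_eq_sub _ (Nat.succ_le_succ hMN)] at hsum
  calc _ ≤ ‖V‖ * ∑ n ∈ Ico (M + 1) (N + 1), Real.exp (4 * b * n) / n.factorial :=
        h.norm_le_of_hasSum_nestedComm h0 h1 hsum
    _ ≤ ‖V‖ * (shellConst b * Real.exp (-(M + 1 : ℕ))) := by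
        gcongr
        exact sum_exp_mul_div_factorial_le (4 * b) (M + 1) (N + 1)
    _ ≤ ‖V‖ * shellConst b * Real.exp (-M) := by
        rw [mul_assoc]
        gcongr
        · exact (shellConst_pos b).le
        · exact M.le_succ

variable [NormOneClass 𝔸]

theorem norm_expansional_le (h : IsShelling D V S b) {s : ℝ} (h0 : 0 ≤ s) (h1 : s ≤ 1) (N : ℕ) :
    ‖expansional (s • ∑ j ∈ range N, D j) (s • (∑ j ∈ range N, D j + V))‖ ≤
      Real.exp (‖V‖ * shellConst b) := by
  refine norm_le_exp_of_norm_deriv_le (hasDerivAt_expansional_smul _ _)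
    (by simp only [zero_smul, expansional_self])
    (mul_nonneg (norm_nonneg V) (shellConst_pos b).le) (fun s h0 h1 => ?_) h0 h1
  rw [← evolve_mul_expansional, sub_add_cancel_left, evolve, mul_neg, neg_mul, neg_mul, norm_neg]
  exact norm_mul_le_of_le (h.norm_evolve_le h0 h1 N) le_rfl

theorem norm_expansional_inv_le (h : IsShelling D V S b) {s : ℝ} (h0 : 0 ≤ s) (h1 : s ≤ 1)
    (N : ℕ) :
    ‖expansional (s • (∑ j ∈ range N, D j + V)) (s • ∑ j ∈ range N, D j)‖ ≤
      Real.exp (‖V‖ * shellConst b) := by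
  refine norm_le_exp_of_norm_deriv_le (hasDerivAt_expansional_smul _ _)
    (by simp only [zero_smul, expansional_self])
    (mul_nonneg (norm_nonneg V) (shellConst_pos b).le) (fun s h0 h1 => ?_) h0 h1
  rw [add_sub_cancel_left, ← expansional_mul_evolve, mul_comm (‖V‖ * shellConst b)]
  exact norm_mul_le_of_le le_rfl (h.norm_evolve_le h0 h1 N)

theorem norm_expansional_sub_le (h : IsShelling D V S b) {M N : ℕ} (hMN : M ≤ N) :
    ‖expansional (∑ j ∈ range N, D j) (∑ j ∈ range N, D j + V) -
        expansional (∑ j ∈ range M, D j) (∑ j ∈ range M, D j + V)‖ ≤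
      Real.exp (‖V‖ * shellConst b) ^ 3 * (‖V‖ * shellConst b) * Real.exp (-M) := by
  set g := Real.exp (‖V‖ * shellConst b)
  set c := ‖V‖ * shellConst b
  set H := fun n => ∑ j ∈ range n, D j
  have hderiv (s : ℝ) (hs : s ∈ Set.Ico (0 : ℝ) 1) :
      ‖expansional (s • (H M + V)) (s • H M) * (evolve (s • H M) V - evolve (s • H N) V) *
        expansional (s • H N) (s • (H N + V))‖ ≤ g * (c * Real.exp (-M)) * g := by
    refine norm_mul_le_of_le (norm_mul_le_of_le (h.norm_expansional_inv_le hs.1 hs.2.le M) ?_)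
      (h.norm_expansional_le hs.1 hs.2.le N)
    rw [norm_sub_rev]
    exact h.norm_evolve_sub_le hs.1 hs.2.le hMN
  have hquotient : ‖expansional (H M + V) (H M) * expansional (H N) (H N + V) - 1‖ ≤
      g * (c * Real.exp (-M)) * g := by
    simpa only [one_smul, zero_smul, expansional_self, one_mul, sub_zero, mul_one] using
      norm_image_sub_le_of_norm_deriv_le_segment'
        (fun s _ => (hasDerivAt_expansional_inv_mul (H M) (H N) V s).hasDerivWithinAt) hderiv 1
        ⟨zero_le_one, le_rfl⟩
  have hE : ‖expansional (H M) (H M + V)‖ ≤ g := by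
    simpa only [one_smul] using h.norm_expansional_le zero_le_one le_rfl M
  calc ‖expansional (H N) (H N + V) - expansional (H M) (H M + V)‖
      = ‖expansional (H M) (H M + V) *
          (expansional (H M + V) (H M) * expansional (H N) (H N + V) - 1)‖ := by
        rw [mul_sub, ← mul_assoc, expansional_mul_expansional, expansional_self, one_mul, mul_one]
    _ ≤ g * (g * (c * Real.exp (-M)) * g) := norm_mul_le_of_le hE hquotient
    _ = g ^ 3 * c * Real.exp (-M) := by ring

end IsShelling

end Shells

section Embedding

variable {d : ℕ} {X Y Λ : Finset ℤ}

theorem restr_glue (h : X ⊆ Λ) (p : Config d X) (u : Config d (Λ \ X)) :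
    restr h (glue p u) = p :=
  funext fun x => dif_pos x.2

theorem restr_sdiff_glue (p : Config d X) (u : Config d (Λ \ X)) :
    restr sdiff_subset (glue p u) = u :=
  funext fun x => dif_neg (mem_sdiff.1 x.2).2

theorem glue_restr (h : X ⊆ Λ) (s : Config d Λ) : glue (restr h s) (restr sdiff_subset s) = s :=
  funext fun x => by by_cases hx : (x : ℤ) ∈ X <;> simp [hx, restr, glue]

/-- The bijection splitting a configuration on `Λ` into its parts inside and outside of `X`. -/
def glueEquiv (d : ℕ) (h : X ⊆ Λ) : Config d X × Config d (Λ \ X) ≃ Config d Λ where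
  toFun p := glue p.1 p.2
  invFun s := (restr h s, restr sdiff_subset s)
  left_inv p := Prod.ext (restr_glue h p.1 p.2) (restr_sdiff_glue p.1 p.2)
  right_inv := glue_restr h

theorem embed_apply_eq (h : X ⊆ Λ) (Q : Obs d X) (s t : Config d Λ) :
    embed h Q s t = if restr (sdiff_subset (t := X)) s = restr sdiff_subset t then
      Q (restr h s) (restr h t) else 0 := by
  rw [embed, of_apply]
  congr 1
  refine propext ⟨fun H => funext fun x => ?_, fun H x hx => ?_⟩
  · exact H ⟨x, (mem_sdiff.1 x.2).1⟩ (mem_sdiff.1 x.2).2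
  · exact congrFun H ⟨x, mem_sdiff.2 ⟨x.2, hx⟩⟩

theorem embed_glue (h : X ⊆ Λ) (Q : Obs d X) (p p' : Config d X) (u u' : Config d (Λ \ X)) :
    embed h Q (glue p u) (glue p' u') = if u = u' then Q p p' else 0 := by
  rw [embed_apply_eq]
  simp only [restr_glue, restr_sdiff_glue]

theorem embed_eq_kronecker (h : X ⊆ Λ) (Q : Obs d X) :
    embed h Q = (Q ⊗ₖ (1 : Obs d (Λ \ X))).submatrix
      (glueEquiv d h).symm (glueEquiv d h).symm := by
  ext s t
  rw [embed_apply_eq, submatrix_apply, kronecker_apply, one_apply, mul_ite, mul_one, mul_zero]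
  rfl

/-- `embed` as a homomorphism of `*`-algebras. -/
def embedHom (d : ℕ) (h : X ⊆ Λ) : Obs d X →⋆ₐ[ℂ] Obs d Λ where
  toFun := embed h
  map_one' := by rw [embed_eq_kronecker, one_kronecker_one, submatrix_one_equiv]
  map_mul' Q R := by
    rw [embed_eq_kronecker, embed_eq_kronecker, embed_eq_kronecker, submatrix_mul_equiv,
      ← mul_kronecker_mul, mul_one]
  map_zero' := by rw [embed_eq_kronecker, zero_kronecker]; rfl
  map_add' Q R := by
    rw [embed_eq_kronecker, embed_eq_kronecker, embed_eq_kronecker, add_kronecker]; rfl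
  commutes' c := by
    rw [Algebra.algebraMap_eq_smul_one, Algebra.algebraMap_eq_smul_one, embed_eq_kronecker,
      smul_kronecker, one_kronecker_one, submatrix_smul, Pi.smul_apply, Pi.smul_apply,
      submatrix_one_equiv]
  map_star' Q := by
    rw [star_eq_conjTranspose, star_eq_conjTranspose, embed_eq_kronecker, embed_eq_kronecker,
      conjTranspose_submatrix, conjTranspose_kronecker, conjTranspose_one]

theorem embedHom_apply (h : X ⊆ Λ) (Q : Obs d X) : embedHom d h Q = embed h Q := rfl

theorem embed_mul (h : X ⊆ Λ) (Q R : Obs d X) : embed h (Q * R) = embed h Q * embed h R :=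
  map_mul (embedHom d h) Q R

theorem embed_one (h : X ⊆ Λ) : embed h (1 : Obs d X) = 1 := map_one (embedHom d h)

theorem embed_add (h : X ⊆ Λ) (Q R : Obs d X) : embed h (Q + R) = embed h Q + embed h R :=
  map_add (embedHom d h) Q R

theorem embed_sub (h : X ⊆ Λ) (Q R : Obs d X) : embed h (Q - R) = embed h Q - embed h R :=
  map_sub (embedHom d h) Q R

theorem embed_smul (h : X ⊆ Λ) (c : ℂ) (Q : Obs d X) : embed h (c • Q) = c • embed h Q :=
  map_smul (embedHom d h) c Q

theorem embed_conjTranspose (h : X ⊆ Λ) (Q : Obs d X) : embed h Qᴴ = (embed h Q)ᴴ :=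
  map_star (embedHom d h) Q

theorem isHermitian_embed (h : X ⊆ Λ) {Q : Obs d X} (hQ : Q.IsHermitian) :
    (embed h Q).IsHermitian := by
  rw [IsHermitian, ← embed_conjTranspose, hQ.eq]

theorem embed_nonneg (h : X ⊆ Λ) {Q : Obs d X} (hQ : 0 ≤ Q) : 0 ≤ embed h Q :=
  map_nonneg (embedHom d h) hQ

theorem continuous_embed (h : X ⊆ Λ) : Continuous (embed (d := d) h) :=
  (embedHom d h).toLinearMap.continuous_of_finiteDimensional

theorem embed_exp (h : X ⊆ Λ) (Q : Obs d X) :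
    embed h (NormedSpace.exp Q) = NormedSpace.exp (embed h Q) := by
  let : NormedAlgebra ℚ (Obs d X) := .restrictScalars ℚ ℂ _
  exact NormedSpace.map_exp (embedHom d h) (continuous_embed h) Q

theorem embed_injective [NeZero d] (h : X ⊆ Λ) : Function.Injective (embed (d := d) h) := by
  intro Q R hQR
  ext p p'
  simpa only [embed_glue, if_true] using congrFun₂ hQR (glue p 0) (glue p' 0)

theorem norm_embed [NeZero d] (h : X ⊆ Λ) (Q : Obs d X) : ‖embed h Q‖ = ‖Q‖ :=
  NonUnitalStarAlgHom.norm_map (embedHom d h) (embed_injective h) Q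

theorem embed_embed (h : X ⊆ Y) (h' : Y ⊆ Λ) (Q : Obs d X) :
    embed h' (embed h Q) = embed (h.trans h') Q := by
  ext s t
  simp only [embed, of_apply, ← ite_and]
  refine if_congr ⟨fun ⟨hY, hX⟩ x hx => ?_, fun hX => ⟨fun x hx => hX x (mt (@h _) hx), ?_⟩⟩ rfl rfl
  · by_cases hxY : (x : ℤ) ∈ Y
    · exact hX ⟨x, hxY⟩ hx
    · exact hY x hxY
  · exact fun x hx => hX ⟨x, h' x.2⟩ hx

theorem embed_mul_embed_apply (hX : X ⊆ Λ) (hY : Y ⊆ Λ) (hd : Disjoint X Y) (Q : Obs d X)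
    (R : Obs d Y) (s t : Config d Λ) :
    (embed hX Q * embed hY R) s t =
      if ∀ x : Λ, (x : ℤ) ∉ X → (x : ℤ) ∉ Y → s x = t x then
        Q (restr hX s) (restr hX t) * R (restr hY s) (restr hY t) else 0 := by
  let u : Config d Λ := fun x => if (x : ℤ) ∈ X then t x else s x
  have hinter (v : Config d Λ) :
      ((∀ x : Λ, (x : ℤ) ∉ Y → v x = t x) ∧ ∀ x : Λ, (x : ℤ) ∉ X → s x = v x) ↔
        u = v ∧ ∀ x : Λ, (x : ℤ) ∉ X → (x : ℤ) ∉ Y → s x = t x := by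
    refine ⟨fun ⟨hv, hs⟩ => ⟨funext fun x => ?_, fun x hx hx' => (hs x hx).trans (hv x hx')⟩, ?_⟩
    · by_cases hx : (x : ℤ) ∈ X
      · exact (if_pos hx).trans (hv x (disjoint_left.1 hd hx)).symm
      · exact (if_neg hx).trans (hs x hx)
    · rintro ⟨rfl, hst⟩
      refine ⟨fun x hx => ?_, fun x hx => (if_neg hx).symm⟩
      by_cases hxX : (x : ℤ) ∈ X
      · exact if_pos hxX
      · exact (if_neg hxX).trans (hst x hxX hx)
  have huX : restr hX u = restr hX t := funext fun x => if_pos x.2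
  have huY : restr hY u = restr hY s := funext fun x => if_neg (disjoint_right.1 hd x.2)
  simp only [mul_apply, embed, of_apply, mul_ite, ite_mul, zero_mul, mul_zero, ← ite_and, hinter]
  simp only [ite_and, sum_ite_eq, mem_univ, if_true, huX, huY]

theorem embed_commute (hX : X ⊆ Λ) (hY : Y ⊆ Λ) (hd : Disjoint X Y) (Q : Obs d X)
    (R : Obs d Y) : Commute (embed hX Q) (embed hY R) := by
  ext s t
  rw [embed_mul_embed_apply hX hY hd, embed_mul_embed_apply hY hX hd.symm, mul_comm]
  exact if_congr (forall_congr' fun _ => forall_comm) rfl rfl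

theorem tensor_eq (hd : Disjoint X Y) (Q : Obs d X) (R : Obs d Y) :
    tensor Q R = embed subset_union_left Q * embed subset_union_right R := by
  ext s t
  rw [embed_mul_embed_apply _ _ hd, if_pos, tensor, of_apply]
  exact fun x hX hY => ((mem_union.1 x.2).elim hX hY).elim

end Embedding

section PartialTrace

variable {d : ℕ} {X Y Λ : Finset ℤ}

theorem trace_reduced_mul (h : X ⊆ Λ) (M : Obs d Λ) (Q : Obs d X) :
    (reduced X M * Q).trace = (M * embed h Q).trace := by
  simp only [trace, diag_apply, mul_apply]
  rw [← Equiv.sum_comp (glueEquiv d h), Fintype.sum_prod_type]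
  refine sum_congr rfl fun p _ => ?_
  simp_rw [reduced, of_apply, sum_mul]
  rw [sum_comm]
  refine sum_congr rfl fun u _ => ?_
  rw [← Equiv.sum_comp (glueEquiv d h), Fintype.sum_prod_type]
  refine sum_congr rfl fun p' _ => ?_
  simp only [glueEquiv, Equiv.coe_fn_mk, embed_glue, mul_ite, mul_zero, sum_ite_eq', mem_univ,
    if_true]

theorem trace_embed_mul_embed (hX : X ⊆ Λ) (hY : Y ⊆ Λ) (hd : Disjoint X Y) (hu : Λ ⊆ X ∪ Y)
    (Q : Obs d X) (R : Obs d Y) : (embed hX Q * embed hY R).trace = Q.trace * R.trace := by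
  obtain rfl : Y = Λ \ X := Subset.antisymm (subset_sdiff.2 ⟨hY, hd.symm⟩)
    fun x hx => (mem_union.1 (hu (mem_sdiff.1 hx).1)).resolve_left (mem_sdiff.1 hx).2
  rw [trace, trace, trace, sum_mul_sum, ← Fintype.sum_prod_type',
    ← Equiv.sum_comp (glueEquiv d hX).symm]
  refine sum_congr rfl fun s _ => ?_
  rw [diag_apply, embed_mul_embed_apply hX hY hd, if_pos fun _ _ _ => rfl]
  rfl

theorem reduced_add (M N : Obs d Λ) : reduced X (M + N) = reduced X M + reduced X N := by
  ext s t
  exact sum_add_distrib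

theorem reduced_smul (c : ℂ) (M : Obs d Λ) : reduced X (c • M) = c • reduced X M := by
  ext s t
  exact (mul_sum _ _ _).symm

theorem reduced_posSemidef {M : Obs d Λ} (hM : M.PosSemidef) : (reduced X M).PosSemidef := by
  have hsum : reduced X M = ∑ u : Config d (Λ \ X), M.submatrix (glue · u) (glue · u) := by
    ext s t
    rw [Matrix.sum_apply]
    rfl
  rw [hsum]
  exact posSemidef_sum _ fun u _ => hM.submatrix _

theorem reduced_embed_mul (h : X ⊆ Λ) (a : Obs d X) (M : Obs d Λ) :
    reduced X (embed h a * M) = a * reduced X M := by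
  refine ext_iff_trace_mul_right.2 fun Q => ?_
  rw [trace_reduced_mul h, mul_assoc, trace_mul_comm, mul_assoc, ← embed_mul, ← trace_reduced_mul,
    ← mul_assoc, trace_mul_comm, mul_assoc]

theorem reduced_mul_embed (h : X ⊆ Λ) (a : Obs d X) (M : Obs d Λ) :
    reduced X (M * embed h a) = reduced X M * a := by
  refine ext_iff_trace_mul_right.2 fun Q => ?_
  rw [trace_reduced_mul h, mul_assoc, ← embed_mul, ← trace_reduced_mul, ← mul_assoc]

theorem reduced_mul_comm (hX : X ⊆ Λ) (hY : Y ⊆ Λ) (hd : Disjoint X Y) (b : Obs d Y)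
    (M : Obs d Λ) : reduced X (M * embed hY b) = reduced X (embed hY b * M) := by
  refine ext_iff_trace_mul_right.2 fun Q => ?_
  rw [trace_reduced_mul hX, trace_reduced_mul hX, mul_assoc,
    ← (embed_commute hX hY hd Q b).eq, ← mul_assoc, trace_mul_comm, mul_assoc]

theorem reduced_reduced (h : X ⊆ Y) (h' : Y ⊆ Λ) (M : Obs d Λ) :
    reduced X (reduced Y M) = reduced X M := by
  refine ext_iff_trace_mul_right.2 fun Q => ?_
  rw [trace_reduced_mul h, trace_reduced_mul h', trace_reduced_mul (h.trans h'), embed_embed]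

theorem trace_reduced (h : X ⊆ Λ) (M : Obs d Λ) : (reduced X M).trace = M.trace := by
  simpa only [mul_one, embed_one] using trace_reduced_mul h M 1

theorem reduced_embed (hX : X ⊆ Λ) (hY : Y ⊆ Λ) (hd : Disjoint X Y) (hu : Λ ⊆ X ∪ Y)
    (b : Obs d Y) : reduced X (embed hY b) = b.trace • (1 : Obs d X) := by
  refine ext_iff_trace_mul_right.2 fun Q => ?_
  rw [trace_reduced_mul hX, trace_embed_mul_embed hY hX hd.symm (by rwa [union_comm]), smul_mul,
    one_mul, trace_smul, smul_eq_mul]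

end PartialTrace

section HalfSums

variable {d : ℕ} {Φ : Interaction d} {r J : ℝ} {I Z : Finset ℤ}

/-- Half of the interaction term `Φ_Z` as an operator on `I`, and `0` if `Z` does not lie in `I`. -/
def halfTerm (Φ : Interaction d) (I Z : Finset ℤ) : Obs d I :=
  if h : Z ⊆ I then embed h ((1 / 2 : ℂ) • Φ.term Z) else 0

/-- Half of the Hamiltonian that contains the interaction terms of the family `T`. -/
def halfSum (Φ : Interaction d) (I : Finset ℤ) (T : Finset (Finset ℤ)) : Obs d I :=
  ∑ Z ∈ T, halfTerm Φ I Z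

theorem isHermitian_halfTerm (Φ : Interaction d) (I Z : Finset ℤ) :
    (halfTerm Φ I Z).IsHermitian := by
  rw [halfTerm]
  split_ifs with h
  · refine isHermitian_embed h ?_
    rw [IsHermitian, conjTranspose_smul, (Φ.selfAdjoint Z).eq, star_div₀, star_one, star_ofNat]
  · exact isHermitian_zero

theorem isHermitian_halfSum (Φ : Interaction d) (I : Finset ℤ) (T : Finset (Finset ℤ)) :
    (halfSum Φ I T).IsHermitian := by
  rw [halfSum, IsHermitian, conjTranspose_sum]
  exact sum_congr rfl fun Z _ => (isHermitian_halfTerm Φ I Z).eq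

theorem halfSum_add_halfSum_sdiff (Φ : Interaction d) (I : Finset ℤ) {T₀ T₁ : Finset (Finset ℤ)}
    (h : T₀ ⊆ T₁) : halfSum Φ I T₀ + halfSum Φ I (T₁ \ T₀) = halfSum Φ I T₁ :=
  (add_comm _ _).trans (sum_sdiff h)

/-- An integer length that exceeds the range. -/
def rangeLen (r : ℝ) : ℕ := ⌈r⌉₊ + 1

theorem one_le_rangeLen (r : ℝ) : 1 ≤ rangeLen r := Nat.succ_pos _

theorem abs_sub_lt_rangeLen (hr : Φ.HasRange r) (hZ : Φ.term Z ≠ 0) {a b : ℤ} (ha : a ∈ Z)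
    (hb : b ∈ Z) : |a - b| < rangeLen r := by
  have hdiam : Metric.diam (Z : Set ℤ) ≤ r := not_lt.1 fun h => hZ (hr Z h)
  have hdist := Metric.dist_le_diam_of_mem Z.finite_toSet.isBounded (mem_coe.2 ha) (mem_coe.2 hb)
  rw [Int.dist_eq] at hdist
  have hlt : ((|a - b| : ℤ) : ℝ) < ((rangeLen r : ℕ) : ℝ) := by
    push_cast [rangeLen]
    linarith [Nat.le_ceil r]
  exact_mod_cast hlt

theorem term_ne_zero_of_halfTerm_ne_zero (h : halfTerm Φ I Z ≠ 0) : Φ.term Z ≠ 0 := by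
  contrapose! h
  rw [halfTerm, h, smul_zero]
  split_ifs with hZ
  · exact map_zero (embedHom d hZ)
  · rfl

theorem norm_halfTerm_le [NeZero d] (hJ : Φ.HasStrength J) (I Z : Finset ℤ) :
    ‖halfTerm Φ I Z‖ ≤ J := by
  have h0 := norm_nonneg (Φ.term Z)
  have hZJ := hJ Z
  rw [halfTerm]
  split_ifs with hZ
  · rw [norm_embed, norm_smul, norm_div, norm_one, RCLike.norm_ofNat]
    linarith
  · rw [norm_zero]
    exact h0.trans hZJ

theorem card_filter_halfTerm_ne_zero_le (hr : Φ.HasRange r) (I : Finset ℤ)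
    {T : Finset (Finset ℤ)} {P : Finset ℤ} (hP : ∀ Z ∈ T, Φ.term Z ≠ 0 → ∃ p ∈ P, p ∈ Z) :
    (T.filter fun Z => halfTerm Φ I Z ≠ 0).card ≤ P.card * 2 ^ (2 * rangeLen r + 1) := by
  have hsub : (T.filter fun Z => halfTerm Φ I Z ≠ 0) ⊆
      P.biUnion fun p => (Icc (p - (rangeLen r : ℤ)) (p + rangeLen r)).powerset := by
    intro Z hZ
    obtain ⟨hZT, hZ0⟩ := mem_filter.1 hZ
    have hterm := term_ne_zero_of_halfTerm_ne_zero hZ0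
    obtain ⟨p, hp, hpZ⟩ := hP Z hZT hterm
    refine mem_biUnion.2 ⟨p, hp, mem_powerset.2 fun a ha => ?_⟩
    have := abs_lt.1 (abs_sub_lt_rangeLen hr hterm ha hpZ)
    rw [mem_Icc]
    omega
  refine (card_le_card hsub).trans (card_biUnion_le_card_mul _ _ _ fun p _ => ?_)
  rw [card_powerset, Int.card_Icc]
  exact (congrArg _ (by omega)).le

theorem norm_halfSum_le [NeZero d] (hr : Φ.HasRange r) (hJ : Φ.HasStrength J) (I : Finset ℤ)
    {T : Finset (Finset ℤ)} {P : Finset ℤ} (hP : ∀ Z ∈ T, Φ.term Z ≠ 0 → ∃ p ∈ P, p ∈ Z) :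
    ‖halfSum Φ I T‖ ≤ P.card * 2 ^ (2 * rangeLen r + 1) * J := by
  have hJ0 : 0 ≤ J := (norm_nonneg _).trans (hJ ∅)
  calc ‖halfSum Φ I T‖ = ‖∑ Z ∈ T.filter fun Z => halfTerm Φ I Z ≠ 0, halfTerm Φ I Z‖ := by
        rw [sum_filter_ne_zero, halfSum]
    _ ≤ ∑ _Z ∈ T.filter fun Z => halfTerm Φ I Z ≠ 0, J :=
        norm_sum_le_of_le _ fun Z _ => norm_halfTerm_le hJ I Z
    _ = (T.filter fun Z => halfTerm Φ I Z ≠ 0).card * J := by rw [sum_const, nsmul_eq_mul]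
    _ ≤ P.card * 2 ^ (2 * rangeLen r + 1) * J := by
        gcongr
        exact_mod_cast card_filter_halfTerm_ne_zero_le hr I hP

end HalfSums

section CutShells

variable {d : ℕ} {Φ : Interaction d} {r J : ℝ} {I Z : Finset ℤ} {y : ℤ}

/-- `Z` has sites on both sides of the cut between `y - 1` and `y`. -/
def CrossesCut (y : ℤ) (Z : Finset ℤ) : Prop := (∃ a ∈ Z, a < y) ∧ ∃ b ∈ Z, y ≤ b

/-- The sites at distance at most `n * rangeLen r` from the cut between `y - 1` and `y`. -/
def window (r : ℝ) (y : ℤ) (n : ℕ) : Finset ℤ := Ico (y - n * rangeLen r) (y + n * rangeLen r)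

theorem mem_window {n : ℕ} {a : ℤ} :
    a ∈ window r y n ↔ y - n * rangeLen r ≤ a ∧ a < y + n * rangeLen r := mem_Ico

theorem window_mono (r : ℝ) (y : ℤ) : Monotone (window r y) := by
  intro m n hmn
  have : (m : ℤ) * rangeLen r ≤ n * rangeLen r := by gcongr
  exact Ico_subset_Ico (by linarith) (by linarith)

theorem card_window (r : ℝ) (y : ℤ) (n : ℕ) : (window r y n).card = 2 * (n * rangeLen r) := by
  rw [window, Int.card_Ico, ← Nat.cast_mul]
  omega

theorem card_window_succ_sdiff (r : ℝ) (y : ℤ) (n : ℕ) :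
    (window r y (n + 1) \ window r y n).card = 2 * rangeLen r := by
  rw [card_sdiff_of_subset (window_mono r y n.le_succ), card_window, card_window, ← Nat.mul_sub,
    ← Nat.sub_mul, Nat.succ_eq_add_one, Nat.add_sub_cancel_left, one_mul]

theorem exists_mem_window (r : ℝ) (y a : ℤ) : ∃ n, a ∈ window r y (n + 1) := by
  have h1 : (1 : ℤ) ≤ rangeLen r := mod_cast one_le_rangeLen r
  have h2 : ((a - y).natAbs : ℤ) + 1 ≤ (((a - y).natAbs : ℤ) + 1) * rangeLen r :=
    le_mul_of_one_le_right (by positivity) h1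
  refine ⟨(a - y).natAbs, mem_window.2 ?_⟩
  rw [Nat.cast_succ]
  omega

theorem subset_window_succ (hr : Φ.HasRange r) (hZ : Φ.term Z ≠ 0) {n : ℕ} {a : ℤ} (ha : a ∈ Z)
    (ha' : a ∈ window r y n) : Z ⊆ window r y (n + 1) := by
  intro x hx
  have hxa := abs_lt.1 (abs_sub_lt_rangeLen hr hZ hx ha)
  rw [mem_window] at ha' ⊢
  push_cast
  constructor <;> linarith [hxa.1, hxa.2, ha'.1, ha'.2]

theorem CrossesCut.subset_window (h : CrossesCut y Z) (hr : Φ.HasRange r) (hZ : Φ.term Z ≠ 0) :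
    Z ⊆ window r y 1 := by
  obtain ⟨⟨a, ha, hay⟩, b, hb, hby⟩ := h
  intro x hx
  have hxa := abs_lt.1 (abs_sub_lt_rangeLen hr hZ hx ha)
  have hxb := abs_lt.1 (abs_sub_lt_rangeLen hr hZ hx hb)
  rw [mem_window]
  push_cast
  constructor <;> linarith [hxa.1, hxa.2, hxb.1, hxb.2]

/-- The number of the shell `window (k + 1) \ window k` around the cut which `Z` meets first. -/
def level (r : ℝ) (y : ℤ) (Z : Finset ℤ) : ℕ := sInf {n | ¬ Disjoint Z (window r y (n + 1))}

theorem disjoint_of_lt_level {n : ℕ} (h : n < level r y Z) : Disjoint Z (window r y (n + 1)) :=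
  not_not.1 fun hd => (Nat.sInf_le (s := {n | ¬ Disjoint Z (window r y (n + 1))}) hd).not_gt h

theorem exists_mem_window_level (r : ℝ) (y : ℤ) (hZ : Z.Nonempty) :
    ∃ a ∈ window r y (level r y Z + 1) \ window r y (level r y Z), a ∈ Z := by
  have hmeets : ¬ Disjoint Z (window r y (level r y Z + 1)) := by
    obtain ⟨a, ha⟩ := hZ
    obtain ⟨n, hn⟩ := exists_mem_window r y a
    exact Nat.sInf_mem (s := {n | ¬ Disjoint Z (window r y (n + 1))})
      ⟨n, not_disjoint_iff.2 ⟨a, ha, hn⟩⟩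
  obtain ⟨a, haZ, ha⟩ := not_disjoint_iff.1 hmeets
  refine ⟨a, mem_sdiff.2 ⟨ha, fun ha' => ?_⟩, haZ⟩
  rcases hk : level r y Z with _ | k
  · rw [hk, mem_window] at ha'
    push_cast at ha'
    omega
  · rw [hk] at ha'
    exact disjoint_left.1 (disjoint_of_lt_level (by omega)) haZ ha'

/-- The part in `I` of the `n`-th neighbourhood of the cut between `y - 1` and `y`. -/
def nbhd (r : ℝ) (I : Finset ℤ) (y : ℤ) (n : ℕ) : Finset ℤ := I ∩ window r y (n + 1)

theorem nbhd_subset (r : ℝ) (I : Finset ℤ) (y : ℤ) (n : ℕ) : nbhd r I y n ⊆ I :=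
  inter_subset_left

theorem nbhd_mono (r : ℝ) (I : Finset ℤ) (y : ℤ) : Monotone (nbhd r I y) := fun _ _ hmn =>
  inter_subset_inter_left (window_mono r y (Nat.succ_le_succ hmn))

/-- The operators on the `n`-th neighbourhood of the cut, as a subring of the operators on `I`. -/
def localRing (d : ℕ) (r : ℝ) (I : Finset ℤ) (y : ℤ) (n : ℕ) : Subring (Obs d I) :=
  (embedHom d (nbhd_subset r I y n) : Obs d (nbhd r I y n) →+* Obs d I).range

theorem mem_localRing {n : ℕ} {M : Obs d I} :
    M ∈ localRing d r I y n ↔ ∃ Q, embed (nbhd_subset r I y n) Q = M := Iff.rfl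

theorem localRing_mono (d : ℕ) (r : ℝ) (I : Finset ℤ) (y : ℤ) : Monotone (localRing d r I y) := by
  rintro m n hmn _ ⟨Q, rfl⟩
  exact mem_localRing.2 ⟨embed (nbhd_mono r I y hmn) Q, embed_embed _ _ _⟩

theorem halfTerm_mem_localRing {n : ℕ} (h : Φ.term Z ≠ 0 → Z ⊆ window r y (n + 1)) :
    halfTerm Φ I Z ∈ localRing d r I y n := by
  by_cases h0 : halfTerm Φ I Z = 0
  · rw [h0]
    exact zero_mem _
  have hZI : Z ⊆ I := by
    by_contra hZI
    exact h0 (dif_neg hZI)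
  have hZn : Z ⊆ nbhd r I y n := subset_inter hZI (h (term_ne_zero_of_halfTerm_ne_zero h0))
  refine mem_localRing.2 ⟨embed hZn ((1 / 2 : ℂ) • Φ.term Z), ?_⟩
  rw [embed_embed, halfTerm, dif_pos]

/-- The terms of the family `T` that meet the `k`-th shell around the cut first. -/
def shell (Φ : Interaction d) (r : ℝ) (I : Finset ℤ) (y : ℤ) (T : Finset (Finset ℤ)) (k : ℕ) :
    Obs d I :=
  halfSum Φ I (T.filter fun Z => level r y Z = k)

theorem exists_forall_ge_sum_shell_eq (Φ : Interaction d) (r : ℝ) (I : Finset ℤ) (y : ℤ)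
    (T : Finset (Finset ℤ)) :
    ∃ N₀, ∀ N ≥ N₀, ∑ k ∈ range N, shell Φ r I y T k = halfSum Φ I T :=
  ⟨T.sup (level r y) + 1, fun _ hN => sum_fiberwise_of_maps_to
    (fun _ hZ => mem_range.2 ((Nat.lt_succ_of_le (le_sup hZ)).trans_le hN)) _⟩

/-- The bound for the norms of the shells. -/
def shellBound (r J : ℝ) : ℝ := (2 * rangeLen r) * 2 ^ (2 * rangeLen r + 1) * J

theorem shell_mem_localRing (hr : Φ.HasRange r) {T : Finset (Finset ℤ)}
    (hT : ∀ Z ∈ T, Z.Nonempty) (k : ℕ) : shell Φ r I y T k ∈ localRing d r I y (k + 1) := by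
  refine sum_mem fun Z hZ => halfTerm_mem_localRing fun hterm => ?_
  obtain ⟨hZT, rfl⟩ := mem_filter.1 hZ
  obtain ⟨a, ha, haZ⟩ := exists_mem_window_level r y (hT Z hZT)
  exact subset_window_succ hr hterm haZ (mem_sdiff.1 ha).1

theorem commute_shell {T : Finset (Finset ℤ)} {k n : ℕ} (hnk : n < k) {M : Obs d I}
    (hM : M ∈ localRing d r I y n) : Commute (shell Φ r I y T k) M := by
  obtain ⟨Q, rfl⟩ := mem_localRing.1 hM
  refine Commute.sum_left _ _ _ fun Z hZ => ?_
  rw [halfTerm]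
  split_ifs with hZI
  · refine embed_commute _ _ (Disjoint.mono_right inter_subset_right ?_) _ _
    exact disjoint_of_lt_level ((mem_filter.1 hZ).2 ▸ hnk)
  · exact Commute.zero_left _

theorem norm_shell_le [NeZero d] (hr : Φ.HasRange r) (hJ : Φ.HasStrength J)
    {T : Finset (Finset ℤ)} (hT : ∀ Z ∈ T, Z.Nonempty) (k : ℕ) :
    ‖shell Φ r I y T k‖ ≤ shellBound r J := by
  refine (norm_halfSum_le hr hJ I (P := window r y (k + 1) \ window r y k)
    fun Z hZ _ => ?_).trans ?_
  · obtain ⟨hZT, rfl⟩ := mem_filter.1 hZ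
    exact exists_mem_window_level r y (hT Z hZT)
  · rw [card_window_succ_sdiff, shellBound, Nat.cast_mul, Nat.cast_ofNat]

theorem norm_halfSum_le_shellBound [NeZero d] (hr : Φ.HasRange r) (hJ : Φ.HasStrength J)
    {T : Finset (Finset ℤ)} (hT : ∀ Z ∈ T, CrossesCut y Z) :
    ‖halfSum Φ I T‖ ≤ shellBound r J := by
  refine (norm_halfSum_le hr hJ I (P := window r y 1) fun Z hZ hterm => ?_).trans ?_
  · obtain ⟨a, ha, -⟩ := (hT Z hZ).1
    exact ⟨a, (hT Z hZ).subset_window hr hterm ha, ha⟩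
  · rw [card_window, one_mul, shellBound, Nat.cast_mul, Nat.cast_ofNat]

theorem isShelling_shell [NeZero d] (hr : Φ.HasRange r) (hJ : Φ.HasStrength J) (I : Finset ℤ)
    {T T' : Finset (Finset ℤ)} (hT : ∀ Z ∈ T, Z.Nonempty) (hT' : ∀ Z ∈ T', CrossesCut y Z) :
    IsShelling (shell Φ r I y T) (halfSum Φ I T') (localRing d r I y) (shellBound r J) where
  mono := localRing_mono d r I y
  mem_zero := sum_mem fun Z hZ => halfTerm_mem_localRing ((hT' Z hZ).subset_window hr)
  mem_succ := shell_mem_localRing hr hT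
  commute _ _ hnk _ := commute_shell hnk
  norm_le := norm_shell_le hr hJ hT

end CutShells

section CutExpansionals

variable {d : ℕ} [NeZero d] {Φ : Interaction d} {r J : ℝ} {y : ℤ} {T₀ T₁ : Finset (Finset ℤ)}

/-- The constant in the estimates for the expansional at a cut. -/
def expansionalBound (r J : ℝ) : ℝ :=
  Real.exp (shellBound r J * shellConst (shellBound r J)) ^ 3 *
    (shellBound r J * shellConst (shellBound r J) + 1)

theorem shellBound_mul_shellConst_nonneg (r : ℝ) (hJ : 0 ≤ J) :
    0 ≤ shellBound r J * shellConst (shellBound r J) :=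
  mul_nonneg (by rw [shellBound]; positivity) (shellConst_pos _).le

theorem expansionalBound_pos (r : ℝ) (hJ : 0 ≤ J) : 0 < expansionalBound r J := by
  have := shellBound_mul_shellConst_nonneg r hJ
  rw [expansionalBound]
  positivity

theorem exp_le_expansionalBound (hJ : 0 ≤ J) {v : ℝ} (hv : v ≤ shellBound r J) :
    Real.exp (v * shellConst (shellBound r J)) ≤ expansionalBound r J := by
  have hc := shellBound_mul_shellConst_nonneg r hJ
  calc Real.exp (v * shellConst (shellBound r J))
      ≤ Real.exp (shellBound r J * shellConst (shellBound r J)) := by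
        have := shellConst_pos (shellBound r J)
        gcongr
    _ ≤ Real.exp (shellBound r J * shellConst (shellBound r J)) ^ 3 :=
        le_self_pow₀ (Real.one_le_exp hc) three_ne_zero
    _ ≤ expansionalBound r J := le_mul_of_one_le_right (by positivity) (by linarith)

theorem norm_expansional_cut_le (hr : Φ.HasRange r) (hJ : Φ.HasStrength J) (I : Finset ℤ)
    (hsub : T₀ ⊆ T₁) (hT : ∀ Z ∈ T₀, Z.Nonempty) (hcross : ∀ Z ∈ T₁ \ T₀, CrossesCut y Z) :
    ‖expansional (halfSum Φ I T₀) (halfSum Φ I T₁)‖ ≤ expansionalBound r J := by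
  obtain ⟨N, hN⟩ := exists_forall_ge_sum_shell_eq Φ r I y T₀
  have h := (isShelling_shell hr hJ I hT hcross).norm_expansional_le zero_le_one le_rfl N
  rw [hN N le_rfl, one_smul, one_smul, halfSum_add_halfSum_sdiff Φ I hsub] at h
  exact h.trans (exp_le_expansionalBound ((norm_nonneg _).trans (hJ ∅))
    (norm_halfSum_le_shellBound hr hJ hcross))

theorem norm_expansional_cut_inv_le (hr : Φ.HasRange r) (hJ : Φ.HasStrength J) (I : Finset ℤ)
    (hsub : T₀ ⊆ T₁) (hT : ∀ Z ∈ T₀, Z.Nonempty) (hcross : ∀ Z ∈ T₁ \ T₀, CrossesCut y Z) :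
    ‖expansional (halfSum Φ I T₁) (halfSum Φ I T₀)‖ ≤ expansionalBound r J := by
  obtain ⟨N, hN⟩ := exists_forall_ge_sum_shell_eq Φ r I y T₀
  have h := (isShelling_shell hr hJ I hT hcross).norm_expansional_inv_le zero_le_one le_rfl N
  rw [hN N le_rfl, one_smul, one_smul, halfSum_add_halfSum_sdiff Φ I hsub] at h
  exact h.trans (exp_le_expansionalBound ((norm_nonneg _).trans (hJ ∅))
    (norm_halfSum_le_shellBound hr hJ hcross))

theorem exists_norm_expansional_cut_sub_le (hr : Φ.HasRange r) (hJ : Φ.HasStrength J)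
    (I : Finset ℤ) (hsub : T₀ ⊆ T₁) (hT : ∀ Z ∈ T₀, Z.Nonempty)
    (hcross : ∀ Z ∈ T₁ \ T₀, CrossesCut y Z) (M : ℕ) :
    ∃ f : Obs d (nbhd r I y M), ‖f‖ ≤ expansionalBound r J ∧
      ‖expansional (halfSum Φ I T₀) (halfSum Φ I T₁) - embed (nbhd_subset r I y M) f‖ ≤
        expansionalBound r J * Real.exp (-M) := by
  have hJ0 : 0 ≤ J := (norm_nonneg _).trans (hJ ∅)
  have hV := norm_halfSum_le_shellBound (I := I) hr hJ hcross
  have hshell := isShelling_shell hr hJ I hT hcross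
  obtain ⟨h, hh⟩ := mem_localRing.1 (hshell.sum_mem M)
  obtain ⟨v, hv⟩ := mem_localRing.1 (hshell.mono (Nat.zero_le M) hshell.mem_zero)
  have hf : embed (nbhd_subset r I y M) (expansional h (h + v)) =
      expansional (∑ k ∈ range M, shell Φ r I y T₀ k)
        (∑ k ∈ range M, shell Φ r I y T₀ k + halfSum Φ I (T₁ \ T₀)) := by
    rw [expansional, expansional, ← hh, ← hv, embed_mul, embed_exp, embed_exp, ← embed_add,
      ← embedHom_apply _ (-(h + v)), map_neg, embedHom_apply]
  refine ⟨expansional h (h + v), ?_, ?_⟩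
  · rw [← norm_embed (nbhd_subset r I y M), hf]
    simpa only [one_smul] using (hshell.norm_expansional_le zero_le_one le_rfl M).trans
      (exp_le_expansionalBound hJ0 hV)
  · obtain ⟨N₀, hN₀⟩ := exists_forall_ge_sum_shell_eq Φ r I y T₀
    have hdiff := hshell.norm_expansional_sub_le (le_max_right N₀ M)
    rw [hN₀ _ (le_max_left _ _), halfSum_add_halfSum_sdiff Φ I hsub, ← hf] at hdiff
    have hc := (shellConst_pos (shellBound r J)).le
    refine hdiff.trans ?_
    rw [expansionalBound]
    gcongr
    exact (mul_le_mul_of_nonneg_right hV hc).trans (le_add_of_nonneg_right zero_le_one)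

end CutExpansionals

section OperatorNorm

theorem norm_le_of_neg_smul_one_le_of_le_smul_one {𝔸 : Type*} [CStarAlgebra 𝔸] [PartialOrder 𝔸]
    [StarOrderedRing 𝔸] {a : 𝔸} {c : ℝ} (hc : 0 ≤ c) (ha : IsSelfAdjoint a)
    (h1 : -(c • (1 : 𝔸)) ≤ a) (h2 : a ≤ c • (1 : 𝔸)) : ‖a‖ ≤ c := by
  rw [← neg_smul, ← Algebra.algebraMap_eq_smul_one, algebraMap_le_iff_le_spectrum] at h1
  rw [← Algebra.algebraMap_eq_smul_one, le_algebraMap_iff_spectrum_le] at h2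
  rw [← cfc_id ℝ a]
  exact norm_cfc_le hc fun x hx => abs_le.2 ⟨h1 x hx, h2 x hx⟩

variable {n : Type*} [Fintype n] [DecidableEq n]

theorem le_norm_smul_one {a : Matrix n n ℂ} (ha : a.IsHermitian) :
    a ≤ ‖a‖ • (1 : Matrix n n ℂ) :=
  (IsSelfAdjoint.le_algebraMap_norm_self ha).trans_eq (Algebra.algebraMap_eq_smul_one _)

theorem neg_norm_smul_one_le {a : Matrix n n ℂ} (ha : a.IsHermitian) :
    -(‖a‖ • (1 : Matrix n n ℂ)) ≤ a := by
  rw [neg_le, ← norm_neg]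
  exact le_norm_smul_one ha.neg

theorem norm_single_one (s t : n) : ‖single s t (1 : ℂ)‖ = 1 := by
  have h := l2_opNorm_conjTranspose_mul_self (single s t (1 : ℂ))
  rw [conjTranspose_single, star_one, single_mul_single_same, mul_one, ← diagonal_single,
    l2_opNorm_diagonal, Pi.norm_single, norm_one] at h
  nlinarith [norm_nonneg (single s t (1 : ℂ))]

theorem norm_apply_le_norm (M : Matrix n n ℂ) (s t : n) : ‖M s t‖ ≤ ‖M‖ :=
  calc ‖M s t‖ = ‖single s s (1 : ℂ) * M * single t t (1 : ℂ)‖ := by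
        rw [single_mul_mul_single, one_mul, mul_one, ← mul_one (M s t), ← smul_eq_mul,
          ← smul_single, norm_smul, norm_smul, norm_single_one, norm_one]
    _ ≤ 1 * ‖M‖ * 1 := by
        refine norm_mul_le_of_le (norm_mul_le_of_le ?_ le_rfl) ?_ <;> rw [norm_single_one]
    _ = ‖M‖ := by rw [one_mul, mul_one]

end OperatorNorm

section Slice

variable {d : ℕ} {X Y Λ : Finset ℤ}

theorem reduced_conjTranspose (M : Obs d Λ) : reduced X Mᴴ = (reduced X M)ᴴ := by
  ext s t
  rw [conjTranspose_apply, reduced, reduced, of_apply, of_apply, star_sum]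
  rfl

/-- A density matrix. -/
structure IsState (τ : Obs d Y) : Prop where
  nonneg : 0 ≤ τ
  trace_eq_one : τ.trace = 1

/-- The slice map `M ↦ Tr_Y[τ M]` to the operators on `X` for a density matrix `τ` on `Y`. -/
def slice (X : Finset ℤ) (hY : Y ⊆ Λ) (τ : Obs d Y) : Obs d Λ →ₗ[ℂ] Obs d X where
  toFun M := reduced X (embed hY τ * M)
  map_add' M N := by rw [mul_add, reduced_add]
  map_smul' c M := by rw [mul_smul_comm, reduced_smul, RingHom.id_apply]

theorem slice_apply (hY : Y ⊆ Λ) (τ : Obs d Y) (M : Obs d Λ) :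
    slice X hY τ M = reduced X (embed hY τ * M) := rfl

theorem slice_embed_mul (hX : X ⊆ Λ) (hY : Y ⊆ Λ) (hd : Disjoint X Y) (τ : Obs d Y) (a : Obs d X)
    (M : Obs d Λ) : slice X hY τ (embed hX a * M) = a * slice X hY τ M := by
  rw [slice_apply, ← mul_assoc, ← (embed_commute hX hY hd a τ).eq, mul_assoc, reduced_embed_mul,
    slice_apply]

theorem slice_embed (hX : X ⊆ Λ) (hY : Y ⊆ Λ) (hd : Disjoint X Y) (hu : Λ ⊆ X ∪ Y) (τ m : Obs d Y) :
    slice X hY τ (embed hY m) = (τ * m).trace • (1 : Obs d X) := by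
  rw [slice_apply, ← embed_mul, reduced_embed hX hY hd hu]

theorem slice_embed_mul_embed (hX : X ⊆ Λ) (hY : Y ⊆ Λ) (hd : Disjoint X Y) (hu : Λ ⊆ X ∪ Y)
    (τ : Obs d Y) (P : Obs d X) (Q : Obs d Y) :
    slice X hY τ (embed hX P * embed hY Q) = (τ * Q).trace • P := by
  rw [slice_embed_mul hX hY hd, slice_embed hX hY hd hu, mul_smul_comm, mul_one]

theorem slice_one (hX : X ⊆ Λ) (hY : Y ⊆ Λ) (hd : Disjoint X Y) (hu : Λ ⊆ X ∪ Y) {τ : Obs d Y}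
    (hτ : IsState τ) : slice X hY τ 1 = 1 := by
  rw [← embed_one hY, slice_embed hX hY hd hu, mul_one, hτ.trace_eq_one, one_smul]

theorem slice_conjTranspose_mul_self (hX : X ⊆ Λ) (hY : Y ⊆ Λ) (hd : Disjoint X Y) (b : Obs d Y)
    (M : Obs d Λ) :
    slice X hY (bᴴ * b) M = reduced X (embed hY b * M * (embed hY b)ᴴ) := by
  rw [← embed_conjTranspose, reduced_mul_comm hX hY hd, slice_apply, embed_mul, mul_assoc]

theorem slice_nonneg (hX : X ⊆ Λ) (hY : Y ⊆ Λ) (hd : Disjoint X Y) {τ : Obs d Y} (hτ : 0 ≤ τ)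
    {M : Obs d Λ} (hM : 0 ≤ M) : 0 ≤ slice X hY τ M := by
  obtain ⟨b, rfl⟩ := CStarAlgebra.nonneg_iff_eq_star_mul_self.1 hτ
  rw [star_eq_conjTranspose, slice_conjTranspose_mul_self hX hY hd, nonneg_iff_posSemidef]
  exact reduced_posSemidef ((nonneg_iff_posSemidef.1 hM).mul_mul_conjTranspose_same _)

theorem slice_mono (hX : X ⊆ Λ) (hY : Y ⊆ Λ) (hd : Disjoint X Y) {τ : Obs d Y} (hτ : 0 ≤ τ) :
    Monotone (slice X hY τ) := fun M N hMN => by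
  rw [← sub_nonneg, ← map_sub]
  exact slice_nonneg hX hY hd hτ (sub_nonneg.2 hMN)

theorem isHermitian_slice (hX : X ⊆ Λ) (hY : Y ⊆ Λ) (hd : Disjoint X Y) {τ : Obs d Y}
    (hτ : 0 ≤ τ) {M : Obs d Λ} (hM : M.IsHermitian) : (slice X hY τ M).IsHermitian := by
  obtain ⟨b, rfl⟩ := CStarAlgebra.nonneg_iff_eq_star_mul_self.1 hτ
  rw [star_eq_conjTranspose, slice_conjTranspose_mul_self hX hY hd, IsHermitian,
    ← reduced_conjTranspose, (isHermitian_mul_mul_conjTranspose _ hM).eq]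

theorem smul_one_le_slice (hX : X ⊆ Λ) (hY : Y ⊆ Λ) (hd : Disjoint X Y) (hu : Λ ⊆ X ∪ Y)
    {τ : Obs d Y} (hτ : IsState τ) {M : Obs d Λ} {g : ℝ} (hM : g • (1 : Obs d Λ) ≤ M) :
    g • (1 : Obs d X) ≤ slice X hY τ M := by
  have h := slice_mono hX hY hd hτ.nonneg hM
  rwa [LinearMap.map_smul_of_tower, slice_one hX hY hd hu hτ] at h

theorem slice_le_smul_one (hX : X ⊆ Λ) (hY : Y ⊆ Λ) (hd : Disjoint X Y) (hu : Λ ⊆ X ∪ Y)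
    {τ : Obs d Y} (hτ : IsState τ) {M : Obs d Λ} {g : ℝ} (hM : M ≤ g • (1 : Obs d Λ)) :
    slice X hY τ M ≤ g • (1 : Obs d X) := by
  have h := slice_mono hX hY hd hτ.nonneg hM
  rwa [LinearMap.map_smul_of_tower, slice_one hX hY hd hu hτ] at h

theorem norm_slice_le (hX : X ⊆ Λ) (hY : Y ⊆ Λ) (hd : Disjoint X Y) (hu : Λ ⊆ X ∪ Y)
    {τ : Obs d Y} (hτ : IsState τ) {M : Obs d Λ} (hM : M.IsHermitian) :
    ‖slice X hY τ M‖ ≤ ‖M‖ := by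
  refine norm_le_of_neg_smul_one_le_of_le_smul_one (norm_nonneg _)
    (isHermitian_slice hX hY hd hτ.nonneg hM) ?_
    (slice_le_smul_one hX hY hd hu hτ (le_norm_smul_one hM))
  rw [← neg_smul]
  exact smul_one_le_slice hX hY hd hu hτ (by simpa only [neg_smul] using neg_norm_smul_one_le hM)

theorem norm_trace_mul_le [NeZero d] {τ : Obs d Y} (hτ : IsState τ) {M : Obs d Y}
    (hM : M.IsHermitian) : ‖(τ * M).trace‖ ≤ ‖M‖ := by
  have hcover : Y ⊆ ∅ ∪ Y := (empty_union Y).ge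
  have h := norm_slice_le (empty_subset Y) (subset_refl Y) (disjoint_empty_left Y) hcover hτ
    (isHermitian_embed (subset_refl Y) hM)
  rwa [slice_embed (empty_subset Y) _ (disjoint_empty_left Y) hcover, norm_smul, norm_embed,
    CStarRing.norm_one, mul_one] at h

end Slice

section SliceDefect

variable {d : ℕ}

theorem isHermitian_embed_mul_embed {X Y Λ : Finset ℤ} (hX : X ⊆ Λ) (hY : Y ⊆ Λ)
    (hd : Disjoint X Y) {P : Obs d X} {Q : Obs d Y} (hP : P.IsHermitian) (hQ : Q.IsHermitian) :
    (embed hX P * embed hY Q).IsHermitian := by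
  rw [IsHermitian, conjTranspose_mul, (isHermitian_embed hX hP).eq, (isHermitian_embed hY hQ).eq,
    (embed_commute hX hY hd P Q).eq]

theorem norm_slice_sub_smul_le {X Y Λ : Finset ℤ} (hX : X ⊆ Λ) (hY : Y ⊆ Λ) (hd : Disjoint X Y)
    (hu : Λ ⊆ X ∪ Y) {τ : Obs d Y} (hτ : IsState τ) {S : Obs d Λ} (hS : S.IsHermitian)
    {P : Obs d X} {Q : Obs d Y} (hP : P.IsHermitian) (hQ : Q.IsHermitian) :
    ‖slice X hY τ S - (τ * Q).trace • P‖ ≤ ‖S - embed hX P * embed hY Q‖ := by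
  rw [← slice_embed_mul_embed hX hY hd hu, ← map_sub]
  exact norm_slice_le hX hY hd hu hτ (hS.sub (isHermitian_embed_mul_embed hX hY hd hP hQ))

variable {A C : Finset ℤ}

/-- The operator `Tr[(τA ⊗ τC) S] S - Tr_C[τC S] ⊗ Tr_A[τA S]`, which vanishes if `S` is a
product. -/
def sliceDefect (τA : Obs d A) (τC : Obs d C) (S : Obs d (A ∪ C)) : Obs d (A ∪ C) :=
  (τA * slice A subset_union_right τC S).trace • S -
    embed subset_union_left (slice A subset_union_right τC S) *
      embed subset_union_right (slice C subset_union_left τA S)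

theorem sliceDefect_eq (τA : Obs d A) (τC : Obs d C) (S : Obs d (A ∪ C)) (P : Obs d A)
    (Q : Obs d C) (p q : ℂ) :
    sliceDefect τA τC S = ((τA * slice A subset_union_right τC S).trace - p * q) • S +
      (p * q) • (S - embed subset_union_left P * embed subset_union_right Q) +
      (embed subset_union_left (q • P - slice A subset_union_right τC S) *
          embed subset_union_right (p • Q) +
        embed subset_union_left (slice A subset_union_right τC S) *
          embed subset_union_right (p • Q - slice C subset_union_left τA S)) := by
  rw [sliceDefect, embed_sub, embed_sub, embed_smul, embed_smul]
  simp only [sub_mul, mul_sub, sub_smul, smul_sub, smul_mul_smul_comm, mul_comm p q]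
  abel

variable [NeZero d] {τA : Obs d A} {τC : Obs d C} {S : Obs d (A ∪ C)}

theorem norm_sliceDefect_le_of_near_product (hd : Disjoint A C) (hA : IsState τA)
    (hC : IsState τC) (hS : S.IsHermitian) {P : Obs d A} {Q : Obs d C} (hP : P.IsHermitian)
    (hQ : Q.IsHermitian) {k ε : ℝ} (hSk : ‖S‖ ≤ k ^ 2) (hPk : ‖P‖ ≤ k) (hQk : ‖Q‖ ≤ k)
    (hε : ‖S - embed subset_union_left P * embed subset_union_right Q‖ ≤ ε) :
    ‖sliceDefect τA τC S‖ ≤ 4 * k ^ 2 * ε := by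
  have hAs : A ⊆ A ∪ C := subset_union_left
  have hCs : C ⊆ A ∪ C := subset_union_right
  have hk : 0 ≤ k := (norm_nonneg _).trans hPk
  have hε0 : 0 ≤ ε := (norm_nonneg _).trans hε
  set SA := slice A hCs τC S
  set SC := slice C hAs τA S
  set p := (τA * P).trace
  set q := (τC * Q).trace
  have hpk : ‖p‖ ≤ k := (norm_trace_mul_le hA hP).trans hPk
  have hqk : ‖q‖ ≤ k := (norm_trace_mul_le hC hQ).trans hQk
  have hSA : ‖SA - q • P‖ ≤ ε :=
    (norm_slice_sub_smul_le hAs hCs hd subset_rfl hC hS hP hQ).trans hε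
  have hSC : ‖SC - p • Q‖ ≤ ε := by
    refine (norm_slice_sub_smul_le hCs hAs hd.symm (union_comm A C).le hA hS hQ hP).trans ?_
    rwa [← (embed_commute hAs hCs hd P Q).eq]
  have hSAk : ‖SA‖ ≤ k ^ 2 := (norm_slice_le hAs hCs hd subset_rfl hC hS).trans hSk
  have htrace : ‖(τA * SA).trace - p * q‖ ≤ ε := by
    have hqP : (q • P).IsHermitian := by
      rw [← slice_embed_mul_embed hAs hCs hd subset_rfl]
      exact isHermitian_slice hAs hCs hd hC.nonneg (isHermitian_embed_mul_embed hAs hCs hd hP hQ)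
    have h := (norm_trace_mul_le hA ((isHermitian_slice hAs hCs hd hC.nonneg hS).sub hqP)).trans hSA
    rwa [mul_sub, trace_sub, mul_smul_comm, trace_smul, smul_eq_mul, mul_comm q] at h
  rw [sliceDefect_eq τA τC S P Q p q]
  calc _ ≤ ε * k ^ 2 + k * k * ε + (ε * (k * k) + k ^ 2 * ε) := by
        refine norm_add_le_of_le (norm_add_le_of_le ?_ ?_)
          (norm_add_le_of_le (norm_mul_le_of_le ?_ ?_) (norm_mul_le_of_le ?_ ?_))
        · rw [norm_smul]; gcongr
        · rw [norm_smul, norm_mul]; gcongr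
        · exact (norm_embed _ _).trans_le ((norm_sub_rev _ _).trans_le hSA)
        · rw [norm_embed, norm_smul]; gcongr
        · exact (norm_embed _ _).trans_le hSAk
        · exact (norm_embed _ _).trans_le ((norm_sub_rev _ _).trans_le hSC)
    _ = 4 * k ^ 2 * ε := by ring

theorem norm_sliceDefect_le (hd : Disjoint A C) (hA : IsState τA) (hC : IsState τC)
    (hS : S.IsHermitian) {k : ℝ} (hSk : ‖S‖ ≤ k) : ‖sliceDefect τA τC S‖ ≤ 2 * k ^ 2 := by
  have hAs : A ⊆ A ∪ C := subset_union_left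
  have hCs : C ⊆ A ∪ C := subset_union_right
  have hk : 0 ≤ k := (norm_nonneg _).trans hSk
  have hSA := (norm_slice_le hAs hCs hd subset_rfl hC hS).trans hSk
  have hSC := (norm_slice_le hCs hAs hd.symm (union_comm A C).le hA hS).trans hSk
  have htrace := (norm_trace_mul_le hA (isHermitian_slice hAs hCs hd hC.nonneg hS)).trans hSA
  calc ‖sliceDefect τA τC S‖ ≤ k * k + k * k := by
        refine norm_sub_le_of_le ?_ (norm_mul_le_of_le ?_ ?_)
        · rw [norm_smul]; gcongr
        · exact (norm_embed _ _).trans_le hSA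
        · exact (norm_embed _ _).trans_le hSC
    _ = 2 * k ^ 2 := by ring

end SliceDefect

section OperatorOrder

theorem posDef_of_smul_one_le {n : Type*} [DecidableEq n] {M : Matrix n n ℂ} {g : ℝ} (hg : 0 < g)
    (h : g • (1 : Matrix n n ℂ) ≤ M) : M.PosDef := by
  simpa only [add_sub_cancel] using (PosDef.one.smul hg).add_posSemidef (le_iff.1 h)

variable {n : Type*} [Fintype n] [DecidableEq n] {M T : Matrix n n ℂ} {g : ℝ}

theorem sq_smul_one_le_mul (hc : Commute M T) (hg : 0 ≤ g) (hM : g • (1 : Matrix n n ℂ) ≤ M)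
    (hT : g • (1 : Matrix n n ℂ) ≤ T) : g ^ 2 • (1 : Matrix n n ℂ) ≤ M * T := by
  have hT0 : 0 ≤ T := (smul_nonneg hg zero_le_one).trans hT
  have hleft : 0 ≤ (M - g • (1 : Matrix n n ℂ)) * T :=
    (hc.sub_left ((Commute.one_left T).smul_left g)).mul_nonneg (sub_nonneg.2 hM) hT0
  calc g ^ 2 • (1 : Matrix n n ℂ) = g • g • (1 : Matrix n n ℂ) := by rw [pow_two, mul_smul]
    _ ≤ g • T := smul_le_smul_of_nonneg_left hT hg
    _ ≤ M * T := by rwa [sub_mul, smul_one_mul, sub_nonneg] at hleft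

theorem le_one_add_div_smul_of_norm_sub_le (hM : M.IsHermitian) (hT : T.IsHermitian) {δ : ℝ}
    (hg : 0 < g) (hTg : g • (1 : Matrix n n ℂ) ≤ T) (hδ : ‖M - T‖ ≤ δ) :
    M ≤ (1 + δ / g) • T := by
  have hδ0 : 0 ≤ δ / g := div_nonneg ((norm_nonneg _).trans hδ) hg.le
  have hsub : M - T ≤ (δ / g) • T :=
    calc M - T ≤ ‖M - T‖ • (1 : Matrix n n ℂ) := le_norm_smul_one (hM.sub hT)
      _ ≤ δ • (1 : Matrix n n ℂ) := smul_le_smul_of_nonneg_right hδ zero_le_one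
      _ = (δ / g) • g • (1 : Matrix n n ℂ) := by rw [smul_smul, div_mul_cancel₀ _ hg.ne']
      _ ≤ (δ / g) • T := smul_le_smul_of_nonneg_left hTg hδ0
  rwa [add_smul, one_smul, ← sub_le_iff_le_add']

theorem smul_one_le_embed {d : ℕ} {X Λ : Finset ℤ} (h : X ⊆ Λ) {Q : Obs d X}
    (hQ : g • (1 : Obs d X) ≤ Q) : g • (1 : Obs d Λ) ≤ embed h Q := by
  have hmap := embed_nonneg h (sub_nonneg.2 hQ)
  rwa [embed_sub, ← Complex.coe_smul, embed_smul, embed_one, sub_nonneg, Complex.coe_smul] at hmap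

end OperatorOrder

section Marginals

variable {d : ℕ}

theorem embed_mul_embed_mul_embed_mul_embed {X Y Λ : Finset ℤ} (hX : X ⊆ Λ) (hY : Y ⊆ Λ)
    (hd : Disjoint X Y) (P P' : Obs d X) (Q Q' : Obs d Y) :
    embed hX P * embed hY Q * (embed hX P' * embed hY Q') =
      embed hX (P * P') * embed hY (Q * Q') := by
  rw [embed_mul, embed_mul, (embed_commute hX hY hd P' Q).symm.mul_mul_mul_comm]

theorem reduced_conj {X Y Λ : Finset ℤ} (hX : X ⊆ Λ) (hY : Y ⊆ Λ) (hd : Disjoint X Y) (a : Obs d X)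
    (b : Obs d Y) (M : Obs d Λ) :
    reduced X (embed hX a * embed hY b * M * (embed hX a * embed hY b)ᴴ) =
      a * slice X hY (bᴴ * b) M * aᴴ := by
  rw [slice_conjTranspose_mul_self hX hY hd, ← reduced_embed_mul hX, ← reduced_mul_embed hX,
    embed_conjTranspose, conjTranspose_mul]
  simp only [mul_assoc]

variable {A C : Finset ℤ} {a : Obs d A} {c : Obs d C} {R S : Obs d (A ∪ C)}

theorem reduced_left_conj (hd : Disjoint A C)
    (hR : R = embed subset_union_left a * embed subset_union_right c * S *
      (embed subset_union_left a * embed subset_union_right c)ᴴ) :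
    reduced A R = a * slice A subset_union_right (cᴴ * c) S * aᴴ := by
  rw [hR, reduced_conj _ _ hd]

theorem reduced_right_conj (hd : Disjoint A C)
    (hR : R = embed subset_union_left a * embed subset_union_right c * S *
      (embed subset_union_left a * embed subset_union_right c)ᴴ) :
    reduced C R = c * slice C subset_union_left (aᴴ * a) S * cᴴ := by
  rw [hR, (embed_commute _ _ hd a c).eq, reduced_conj _ _ hd.symm]

theorem tensor_reduced_conj (hd : Disjoint A C)
    (hR : R = embed subset_union_left a * embed subset_union_right c * S *
      (embed subset_union_left a * embed subset_union_right c)ᴴ) :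
    tensor (reduced A R) (reduced C R) =
      embed subset_union_left a * embed subset_union_right c *
        (embed subset_union_left (slice A subset_union_right (cᴴ * c) S) *
          embed subset_union_right (slice C subset_union_left (aᴴ * a) S)) *
        (embed subset_union_left a * embed subset_union_right c)ᴴ := by
  have hstar : (embed (subset_union_left : A ⊆ A ∪ C) a * embed subset_union_right c)ᴴ =
      embed subset_union_left aᴴ * embed subset_union_right cᴴ := by
    rw [conjTranspose_mul, ← embed_conjTranspose, ← embed_conjTranspose,
      (embed_commute _ _ hd aᴴ cᴴ).eq]
  rw [tensor_eq hd, reduced_left_conj hd hR, reduced_right_conj hd hR, hstar,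
    embed_mul_embed_mul_embed_mul_embed _ _ hd, embed_mul_embed_mul_embed_mul_embed _ _ hd]

theorem trace_mul_slice_eq_one (hd : Disjoint A C)
    (hR : R = embed subset_union_left a * embed subset_union_right c * S *
      (embed subset_union_left a * embed subset_union_right c)ᴴ) (htr : R.trace = 1) :
    (aᴴ * a * slice A subset_union_right (cᴴ * c) S).trace = 1 := by
  rw [← htr, ← trace_reduced (subset_union_left : A ⊆ A ∪ C), reduced_left_conj hd hR,
    mul_assoc, trace_mul_comm]

theorem sq_smul_one_le_embed_slice_mul_embed_slice (hd : Disjoint A C) {τA : Obs d A}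
    {τC : Obs d C} (hA : IsState τA) (hC : IsState τC) {g : ℝ} (hg : 0 ≤ g)
    (hSg : g • (1 : Obs d (A ∪ C)) ≤ S) :
    g ^ 2 • (1 : Obs d (A ∪ C)) ≤ embed subset_union_left (slice A subset_union_right τC S) *
      embed subset_union_right (slice C subset_union_left τA S) :=
  have hAs : A ⊆ A ∪ C := subset_union_left
  have hCs : C ⊆ A ∪ C := subset_union_right
  sq_smul_one_le_mul (embed_commute hAs hCs hd _ _) hg
    (smul_one_le_embed hAs (smul_one_le_slice hAs hCs hd subset_rfl hC hSg))
    (smul_one_le_embed hCs (smul_one_le_slice hCs hAs hd.symm (union_comm A C).le hA hSg))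

theorem le_smul_tensor_reduced (hd : Disjoint A C) (hA : IsState (aᴴ * a)) (hC : IsState (cᴴ * c))
    (hR : R = embed subset_union_left a * embed subset_union_right c * S *
      (embed subset_union_left a * embed subset_union_right c)ᴴ) (htr : R.trace = 1) {g δ : ℝ}
    (hg : 0 < g) (hSg : g • (1 : Obs d (A ∪ C)) ≤ S)
    (hδ : ‖sliceDefect (aᴴ * a) (cᴴ * c) S‖ ≤ δ) :
    R ≤ (1 + δ / g ^ 2) • tensor (reduced A R) (reduced C R) := by
  have hTg := sq_smul_one_le_embed_slice_mul_embed_slice hd hA hC hg.le hSg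
  have hST := le_one_add_div_smul_of_norm_sub_le (posDef_of_smul_one_le hg hSg).isHermitian
    (posDef_of_smul_one_le (by positivity) hTg).isHermitian (by positivity) hTg (δ := δ) (by
      rwa [sliceDefect, trace_mul_slice_eq_one hd hR htr, one_smul] at hδ)
  have hconj := star_right_conjugate_le_conjugate hST
    (embed subset_union_left a * embed subset_union_right c)
  rwa [star_eq_conjTranspose, ← hR, mul_smul_comm, smul_mul_assoc,
    ← tensor_reduced_conj hd hR] at hconj

theorem relEntropy_le_bsEntropy_le_geomRenyi_tensor_reduced_le (hd : Disjoint A C)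
    (ha : IsUnit a) (hc : IsUnit c) (hA : IsState (aᴴ * a)) (hC : IsState (cᴴ * c))
    (hR : R = embed subset_union_left a * embed subset_union_right c * S *
      (embed subset_union_left a * embed subset_union_right c)ᴴ) (htr : R.trace = 1) {g δ : ℝ}
    (hg : 0 < g) (hSg : g • (1 : Obs d (A ∪ C)) ≤ S)
    (hδ : ‖sliceDefect (aᴴ * a) (cᴴ * c) S‖ ≤ δ) {q : ℝ} (hq : 1 ≤ q) :
    relEntropy R (tensor (reduced A R) (reduced C R)) ≤
        bsEntropy R (tensor (reduced A R) (reduced C R)) ∧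
      bsEntropy R (tensor (reduced A R) (reduced C R)) ≤
        geomRenyi q R (tensor (reduced A R) (reduced C R)) ∧
      geomRenyi q R (tensor (reduced A R) (reduced C R)) ≤ δ / g ^ 2 := by
  have hu : IsUnit (embed (subset_union_left : A ⊆ A ∪ C) a * embed subset_union_right c) :=
    (ha.map (embedHom d _)).mul (hc.map (embedHom d _))
  have hTg := sq_smul_one_le_embed_slice_mul_embed_slice hd hA hC hg.le hSg
  have hRpos : R.PosDef := by
    rw [hR]
    exact hu.posDef_star_right_conjugate_iff.2 (posDef_of_smul_one_le hg hSg)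
  have hσpos : (tensor (reduced A R) (reduced C R)).PosDef := by
    rw [tensor_reduced_conj hd hR]
    exact hu.posDef_star_right_conjugate_iff.2 (posDef_of_smul_one_le (by positivity) hTg)
  obtain ⟨h₁, h₂, h₃⟩ := relEntropy_le_bsEntropy_le_geomRenyi_le hRpos hσpos htr
    (le_smul_tensor_reduced hd hA hC hR htr hg hSg hδ) hq
  have hδ0 : 0 ≤ δ / g ^ 2 := div_nonneg ((norm_nonneg _).trans hδ) (by positivity)
  have hlog := Real.log_le_sub_one_of_pos (x := 1 + δ / g ^ 2) (by positivity)
  exact ⟨h₁, h₂, h₃.trans (by linarith)⟩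

end Marginals

section GibbsStates

variable {d : ℕ}

/-- The nonempty subsets of `X`. -/
def subsets (X : Finset ℤ) : Finset (Finset ℤ) := X.powerset.erase ∅

theorem mem_subsets {X Z : Finset ℤ} : Z ∈ subsets X ↔ Z ≠ ∅ ∧ Z ⊆ X := by
  rw [subsets, mem_erase, mem_powerset]

/-- The square root `e^{-H/2}` of the unnormalized Gibbs state, where the scalar contribution of
`Φ_∅` to the Hamiltonian is left out. -/
def boltz (Φ : Interaction d) (X : Finset ℤ) : Obs d X := exp (-halfSum Φ X (subsets X))

theorem isHermitian_boltz (Φ : Interaction d) (X : Finset ℤ) : (boltz Φ X).IsHermitian :=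
  (isHermitian_halfSum Φ X _).neg.exp

theorem isUnit_boltz (Φ : Interaction d) (X : Finset ℤ) : IsUnit (boltz Φ X) :=
  IsUnit.of_mul_eq_one _ (exp_neg_mul_exp (halfSum Φ X (subsets X)))

theorem hamiltonian_eq (Φ : Interaction d) (X : Finset ℤ) :
    Φ.hamiltonian X = halfSum Φ X (subsets X) + halfSum Φ X (subsets X) +
      Φ.term ∅ default default • (1 : Obs d X) := by
  have htwo (Z : Finset ℤ) (hZ : Z ⊆ X) :
      halfTerm Φ X Z + halfTerm Φ X Z = embed hZ (Φ.term Z) := by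
    rw [halfTerm, dif_pos hZ, ← embed_add, ← add_smul, add_halves, one_smul]
  have hempty : embed (empty_subset X) (Φ.term ∅) =
      Φ.term ∅ default default • (1 : Obs d X) := by
    rw [← embed_one (empty_subset X), ← embed_smul]
    congr 1
    ext s t
    rw [Subsingleton.elim s default, Subsingleton.elim t default, Matrix.smul_apply, one_apply_eq,
      smul_eq_mul, mul_one]
  calc Φ.hamiltonian X = ∑ Z ∈ X.powerset, (halfTerm Φ X Z + halfTerm Φ X Z) := by
        rw [Interaction.hamiltonian, ← sum_attach X.powerset]
        exact sum_congr rfl fun Z _ => (htwo Z (mem_powerset.1 Z.2)).symm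
    _ = _ := by
        rw [← sum_erase_add _ _ (empty_mem_powerset X), sum_add_distrib, htwo ∅ (empty_subset X),
          hempty]
        rfl

theorem exp_neg_hamiltonian (Φ : Interaction d) (X : Finset ℤ) :
    exp (-Φ.hamiltonian X) =
      Complex.exp (-Φ.term ∅ default default) • (boltz Φ X * boltz Φ X) := by
  have hscalar (z : ℂ) : exp (z • (1 : Obs d X)) = Complex.exp z • (1 : Obs d X) := by
    rw [← Algebra.algebraMap_eq_smul_one, ← Algebra.algebraMap_eq_smul_one, ← algebraMap_exp_comm,
      Complex.exp_eq_exp_ℂ]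
  rw [hamiltonian_eq, neg_add, ← neg_smul,
    exp_add_of_commute_real ((Commute.one_right _).smul_right _), hscalar, mul_smul_comm, mul_one,
    neg_add, exp_add_of_commute_real (Commute.refl _), boltz]

theorem boltz_mul_boltz_posDef (Φ : Interaction d) (X : Finset ℤ) :
    (boltz Φ X * boltz Φ X).PosDef := by
  have hconj := (isUnit_boltz Φ X).posDef_star_left_conjugate_iff.2 PosDef.one
  rwa [mul_one, star_eq_conjTranspose, (isHermitian_boltz Φ X).eq] at hconj

variable [NeZero d]

theorem exists_pos_gibbs_eq_smul (Φ : Interaction d) (X : Finset ℤ) :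
    ∃ z : ℝ, 0 < z ∧ (boltz Φ X * boltz Φ X).trace = z ∧
      Φ.gibbs X = z⁻¹ • (boltz Φ X * boltz Φ X) := by
  obtain ⟨hpos, him⟩ := Complex.pos_iff.1 (boltz_mul_boltz_posDef Φ X).trace_pos
  have hz : (boltz Φ X * boltz Φ X).trace = ((boltz Φ X * boltz Φ X).trace.re : ℂ) :=
    Complex.ext rfl him.symm
  refine ⟨_, hpos, hz, ?_⟩
  rw [Interaction.gibbs, exp_neg_hamiltonian, trace_smul, smul_smul, smul_eq_mul, mul_inv,
    mul_right_comm, inv_mul_cancel₀ (Complex.exp_ne_zero _), one_mul, hz, ← Complex.ofReal_inv,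
    Complex.coe_smul, Complex.ofReal_re]

theorem isState_gibbs (Φ : Interaction d) (X : Finset ℤ) : IsState (Φ.gibbs X) := by
  obtain ⟨z, hz, htr, hgibbs⟩ := exists_pos_gibbs_eq_smul Φ X
  rw [hgibbs]
  refine ⟨smul_nonneg (inv_pos.2 hz).le (boltz_mul_boltz_posDef Φ X).posSemidef.nonneg, ?_⟩
  rw [trace_smul, htr, ← Complex.coe_smul, smul_eq_mul, ← Complex.ofReal_mul,
    inv_mul_cancel₀ hz.ne', Complex.ofReal_one]

theorem exists_conjTranspose_smul_boltz_mul_self_eq_gibbs (Φ : Interaction d) (X : Finset ℤ) :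
    ∃ z : ℝ, z ≠ 0 ∧ (z • boltz Φ X)ᴴ * z • boltz Φ X = Φ.gibbs X := by
  obtain ⟨z, hz, -, hgibbs⟩ := exists_pos_gibbs_eq_smul Φ X
  refine ⟨(√z)⁻¹, by positivity, ?_⟩
  rw [conjTranspose_smul, star_trivial, (isHermitian_boltz Φ X).eq, smul_mul_smul_comm, ← mul_inv,
    Real.mul_self_sqrt hz.le, hgibbs]

end GibbsStates

section FactorizedStates

variable {d : ℕ}

theorem embed_real_smul {X Λ : Finset ℤ} (h : X ⊆ Λ) (k : ℝ) (Q : Obs d X) :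
    embed h (k • Q) = k • embed h Q :=
  LinearMap.map_smul_of_tower (embedHom d h).toLinearMap k Q

theorem sliceDefect_smul {A C : Finset ℤ} (τA : Obs d A) (τC : Obs d C) (k : ℝ)
    (S : Obs d (A ∪ C)) : sliceDefect τA τC (k • S) = k ^ 2 • sliceDefect τA τC S := by
  have hA : slice A subset_union_right τC (k • S) = k • slice A subset_union_right τC S :=
    LinearMap.map_smul_of_tower _ k S
  have hC : slice C subset_union_left τA (k • S) = k • slice C subset_union_left τA S :=
    LinearMap.map_smul_of_tower _ k S
  rw [sliceDefect, sliceDefect, hA, hC, embed_real_smul, embed_real_smul, mul_smul_comm,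
    trace_smul, smul_mul_smul_comm,
    smul_assoc, smul_comm _ k S, smul_smul, ← pow_two, smul_sub]

theorem mutualInfo_chain_of_eq_conj {I A B C : Finset ℤ} (hAC : A ∪ C ⊆ I) (hB : B ⊆ I)
    (hd : Disjoint A C) (hdB : Disjoint (A ∪ C) B) (hu : I ⊆ A ∪ C ∪ B) {a : Obs d A} {b : Obs d B}
    {c : Obs d C} (ha : IsUnit a) (hc : IsUnit c) (hτA : IsState (aᴴ * a)) (hτB : IsState (bᴴ * b))
    (hτC : IsState (cᴴ * c)) {ρ W X : Obs d I} {k : ℝ} (hk : 0 < k)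
    (hX : X = embed hAC (embed subset_union_left a * embed subset_union_right c) * embed hB b)
    (hρ : ρ = k • (X * W * Xᴴ)) (htr : ρ.trace = 1) {g δ : ℝ} (hg : 0 < g)
    (hW : g • (1 : Obs d I) ≤ W)
    (hδ : ‖sliceDefect (aᴴ * a) (cᴴ * c) (slice (A ∪ C) hB (bᴴ * b) W)‖ ≤ δ) {q : ℝ}
    (hq : 1 ≤ q) :
    mutualInfo ρ A C ≤ bsMutualInfo ρ A C ∧ bsMutualInfo ρ A C ≤ renyiMutualInfo q ρ A C ∧
      renyiMutualInfo q ρ A C ≤ δ / g ^ 2 := by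
  have hR : reduced (A ∪ C) ρ = embed subset_union_left a * embed subset_union_right c *
      k • slice (A ∪ C) hB (bᴴ * b) W *
      (embed subset_union_left a * embed subset_union_right c)ᴴ := by
    rw [hρ, ← smul_mul_assoc, ← mul_smul_comm, hX, reduced_conj hAC hB hdB]
    congr 2
    exact LinearMap.map_smul_of_tower _ k W
  have hS : (k * g) • (1 : Obs d (A ∪ C)) ≤ k • slice (A ∪ C) hB (bᴴ * b) W := by
    rw [mul_smul]
    exact smul_le_smul_of_nonneg_left (smul_one_le_slice hAC hB hdB hu hτB hW) hk.le
  have hdefect :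
      ‖sliceDefect (aᴴ * a) (cᴴ * c) (k • slice (A ∪ C) hB (bᴴ * b) W)‖ ≤ k ^ 2 * δ := by
    rw [sliceDefect_smul, norm_smul, Real.norm_of_nonneg (by positivity)]
    gcongr
  have h := relEntropy_le_bsEntropy_le_geomRenyi_tensor_reduced_le hd ha hc hτA hτC hR
    ((trace_reduced hAC ρ).trans htr) (mul_pos hk hg) hS hdefect hq
  rwa [reduced_reduced subset_union_left hAC, reduced_reduced subset_union_right hAC, mul_pow,
    mul_div_mul_left _ _ (by positivity)] at h

theorem mutualInfo_chain_gibbs [NeZero d] {Φ : Interaction d} {I A B C : Finset ℤ}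
    (hAC : A ∪ C ⊆ I) (hB : B ⊆ I) (hd : Disjoint A C) (hdB : Disjoint (A ∪ C) B)
    (hu : I ⊆ A ∪ C ∪ B) {P W : Obs d I}
    (hP : P = embed hAC (embed subset_union_left (boltz Φ A) *
      embed subset_union_right (boltz Φ C)) * embed hB (boltz Φ B))
    (hPW : boltz Φ I * boltz Φ I = P * W * Pᴴ) {g δ : ℝ} (hg : 0 < g)
    (hW : g • (1 : Obs d I) ≤ W)
    (hδ : ‖sliceDefect (Φ.gibbs A) (Φ.gibbs C) (slice (A ∪ C) hB (Φ.gibbs B) W)‖ ≤ δ) {q : ℝ}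
    (hq : 1 ≤ q) :
    mutualInfo (Φ.gibbs I) A C ≤ bsMutualInfo (Φ.gibbs I) A C ∧
      bsMutualInfo (Φ.gibbs I) A C ≤ renyiMutualInfo q (Φ.gibbs I) A C ∧
      renyiMutualInfo q (Φ.gibbs I) A C ≤ δ / g ^ 2 := by
  obtain ⟨zI, hzI, -, hI⟩ := exists_pos_gibbs_eq_smul Φ I
  obtain ⟨zA, hzA, hA⟩ := exists_conjTranspose_smul_boltz_mul_self_eq_gibbs Φ A
  obtain ⟨zB, hzB, hB'⟩ := exists_conjTranspose_smul_boltz_mul_self_eq_gibbs Φ B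
  obtain ⟨zC, hzC, hC⟩ := exists_conjTranspose_smul_boltz_mul_self_eq_gibbs Φ C
  have hunit {z : ℝ} (hz : z ≠ 0) (X : Finset ℤ) : IsUnit (z • boltz Φ X) :=
    (isUnit_boltz Φ X).smul (Units.mk0 z hz)
  have hP' : (zA * zC * zB) • P = embed hAC (embed subset_union_left (zA • boltz Φ A) *
      embed subset_union_right (zC • boltz Φ C)) * embed hB (zB • boltz Φ B) := by
    simp only [embed_real_smul, smul_mul_smul_comm, hP]
  have hρ : Φ.gibbs I = (zI⁻¹ * ((zA * zC * zB) ^ 2)⁻¹) •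
      ((zA * zC * zB) • P * W * ((zA * zC * zB) • P)ᴴ) := by
    have hz : (zA * zC * zB) ^ 2 ≠ 0 := by positivity
    rw [conjTranspose_smul, star_trivial, smul_mul_assoc, smul_mul_smul_comm, smul_smul, ← pow_two,
      mul_assoc, inv_mul_cancel₀ hz, mul_one, ← hPW, hI]
  have hdef {τA : Obs d A} {τB : Obs d B} {τC : Obs d C} (hτA : τA = Φ.gibbs A)
      (hτB : τB = Φ.gibbs B) (hτC : τC = Φ.gibbs C) :
      ‖sliceDefect τA τC (slice (A ∪ C) hB τB W)‖ ≤ δ := by rwa [hτA, hτB, hτC]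
  exact mutualInfo_chain_of_eq_conj hAC hB hd hdB hu (hunit hzA A) (hunit hzC C)
    (hA ▸ isState_gibbs Φ A) (hB' ▸ isState_gibbs Φ B) (hC ▸ isState_gibbs Φ C) (by positivity) hP'
    hρ (isState_gibbs Φ I).trace_eq_one hg hW (hdef hA hB' hC) hq

end FactorizedStates

section MulConjTranspose

variable {n : Type*} [Fintype n] [DecidableEq n] {F F' : Matrix n n ℂ}

theorem norm_mul_conjTranspose_le {k : ℝ} (hF : ‖F‖ ≤ k) : ‖F * Fᴴ‖ ≤ k ^ 2 :=
  (norm_mul_le_of_le hF ((l2_opNorm_conjTranspose F).trans_le hF)).trans_eq (pow_two k).symm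

theorem inv_sq_smul_one_le_mul_conjTranspose (h : F * F' = 1) {k : ℝ} (hk : 0 < k)
    (hF' : ‖F'‖ ≤ k) : (k ^ 2)⁻¹ • (1 : Matrix n n ℂ) ≤ F * Fᴴ := by
  have hle : F' * F'ᴴ ≤ k ^ 2 • (1 : Matrix n n ℂ) :=
    (le_norm_smul_one (isHermitian_mul_conjTranspose_self F')).trans
      (smul_le_smul_of_nonneg_right (norm_mul_conjTranspose_le hF') zero_le_one)
  have hone : 1 ≤ k ^ 2 • (F * Fᴴ) :=
    calc 1 = F * (F' * F'ᴴ) * Fᴴ := by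
          rw [← mul_assoc F, h, one_mul, ← conjTranspose_mul, h, conjTranspose_one]
      _ ≤ F * k ^ 2 • (1 : Matrix n n ℂ) * Fᴴ := star_right_conjugate_le_conjugate hle F
      _ = k ^ 2 • (F * Fᴴ) := by rw [mul_smul_comm, mul_one, smul_mul_assoc]
  calc (k ^ 2)⁻¹ • (1 : Matrix n n ℂ) ≤ (k ^ 2)⁻¹ • k ^ 2 • (F * Fᴴ) :=
        smul_le_smul_of_nonneg_left hone (by positivity)
    _ = F * Fᴴ := inv_smul_smul₀ (by positivity) _

theorem exp_neg_mul_exp_neg_eq {H K : Matrix n n ℂ} (hK : K.IsHermitian) :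
    exp (-K) * exp (-K) =
      exp (-H) * (expansional H K * (expansional H K)ᴴ) * (exp (-H))ᴴ := by
  have hfactor : exp (-H) * expansional H K = exp (-K) := by
    rw [expansional, ← mul_assoc, exp_neg_mul_exp, one_mul]
  calc exp (-K) * exp (-K) = exp (-K) * (exp (-K))ᴴ := by rw [hK.neg.exp.eq]
    _ = _ := by rw [← hfactor, conjTranspose_mul]; simp only [mul_assoc]

theorem norm_mul_mul_conjTranspose_sub_le {F₁ F₂ e₁ e₂ : Matrix n n ℂ} {G η : ℝ} (hF₁ : ‖F₁‖ ≤ G)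
    (hF₂ : ‖F₂‖ ≤ G) (he₁ : ‖e₁‖ ≤ G) (he₂ : ‖e₂‖ ≤ G) (h₁ : ‖F₁ - e₁‖ ≤ G * η)
    (h₂ : ‖F₂ - e₂‖ ≤ G * η) :
    ‖F₂ * F₁ * (F₂ * F₁)ᴴ - e₂ * e₁ * (e₂ * e₁)ᴴ‖ ≤ 4 * G ^ 4 * η := by
  have hF : ‖(F₂ * F₁)ᴴ‖ ≤ G * G :=
    (l2_opNorm_conjTranspose _).trans_le (norm_mul_le_of_le hF₂ hF₁)
  have hdiff : ‖F₂ * F₁ - e₂ * e₁‖ ≤ G * η * G + G * (G * η) := by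
    rw [show F₂ * F₁ - e₂ * e₁ = (F₂ - e₂) * F₁ + e₂ * (F₁ - e₁) by noncomm_ring]
    exact norm_add_le_of_le (norm_mul_le_of_le h₂ hF₁) (norm_mul_le_of_le he₂ h₁)
  have hdiff' : ‖(F₂ * F₁ - e₂ * e₁)ᴴ‖ ≤ G * η * G + G * (G * η) :=
    (l2_opNorm_conjTranspose _).trans_le hdiff
  calc _ = ‖(F₂ * F₁ - e₂ * e₁) * (F₂ * F₁)ᴴ + e₂ * e₁ * (F₂ * F₁ - e₂ * e₁)ᴴ‖ := by
        congr 1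
        rw [conjTranspose_sub, mul_sub, sub_mul]
        abel
    _ ≤ (G * η * G + G * (G * η)) * (G * G) + G * G * (G * η * G + G * (G * η)) :=
        norm_add_le_of_le (norm_mul_le_of_le hdiff hF)
          (norm_mul_le_of_le (norm_mul_le_of_le he₂ he₁) hdiff')
    _ = 4 * G ^ 4 * η := by ring

end MulConjTranspose

section LocalHamiltonians

variable {d : ℕ}

theorem embed_halfSum {X I : Finset ℤ} (h : X ⊆ I) (Φ : Interaction d) :
    embed h (halfSum Φ X (subsets X)) = halfSum Φ I (subsets X) := by
  rw [halfSum, halfSum, ← embedHom_apply, map_sum]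
  refine sum_congr rfl fun Z hZ => ?_
  have hZX := (mem_subsets.1 hZ).2
  rw [embedHom_apply, halfTerm, halfTerm, dif_pos hZX, dif_pos (hZX.trans h), embed_embed]

theorem embed_boltz {X I : Finset ℤ} (h : X ⊆ I) (Φ : Interaction d) :
    embed h (boltz Φ X) = exp (-halfSum Φ I (subsets X)) := by
  rw [boltz, embed_exp, ← embed_halfSum h]
  exact congrArg exp (map_neg (embedHom d h) _)

theorem disjoint_subsets {X Y : Finset ℤ} (h : Disjoint X Y) : Disjoint (subsets X) (subsets Y) :=
  disjoint_left.2 fun _ hX hY => (mem_subsets.1 hX).1 <|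
    subset_empty.1 (h (mem_subsets.1 hX).2 (mem_subsets.1 hY).2)

theorem commute_halfSum {X Y I : Finset ℤ} (hX : X ⊆ I) (hY : Y ⊆ I) (h : Disjoint X Y)
    (Φ : Interaction d) : Commute (halfSum Φ I (subsets X)) (halfSum Φ I (subsets Y)) := by
  rw [← embed_halfSum hX, ← embed_halfSum hY]
  exact embed_commute hX hY h _ _

theorem exp_neg_halfSum {I A B C : Finset ℤ} (hAC : A ∪ C ⊆ I) (hB : B ⊆ I) (hd : Disjoint A C)
    (hdB : Disjoint (A ∪ C) B) (Φ : Interaction d) :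
    exp (-halfSum Φ I (subsets A ∪ subsets C ∪ subsets B)) =
      embed hAC (embed subset_union_left (boltz Φ A) * embed subset_union_right (boltz Φ C)) *
        embed hB (boltz Φ B) := by
  obtain ⟨hA, hC⟩ := union_subset_iff.1 hAC
  obtain ⟨hdA, hdC⟩ := disjoint_union_left.1 hdB
  have hsum : halfSum Φ I (subsets A ∪ subsets C ∪ subsets B) = halfSum Φ I (subsets A) +
      halfSum Φ I (subsets C) + halfSum Φ I (subsets B) := by
    rw [halfSum, sum_union (disjoint_union_left.2 ⟨disjoint_subsets hdA, disjoint_subsets hdC⟩),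
      sum_union (disjoint_subsets hd)]
    rfl
  have hcomm : Commute (-halfSum Φ I (subsets A)) (-halfSum Φ I (subsets C)) :=
    (commute_halfSum hA hC hd Φ).neg_left.neg_right
  have hcommB : Commute (-halfSum Φ I (subsets A) + -halfSum Φ I (subsets C))
      (-halfSum Φ I (subsets B)) :=
    ((commute_halfSum hA hB hdA Φ).neg_left.add_left
      (commute_halfSum hC hB hdC Φ).neg_left).neg_right
  rw [hsum, neg_add, neg_add, exp_add_of_commute_real hcommB, exp_add_of_commute_real hcomm,
    embed_mul, embed_embed, embed_embed, embed_boltz, embed_boltz, embed_boltz]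

end LocalHamiltonians

section Bridge

variable {d : ℕ} {Φ : Interaction d} {r J : ℝ} {x y z w : ℤ}

theorem subsets_mono {X Y : Finset ℤ} (h : X ⊆ Y) : subsets X ⊆ subsets Y := fun _ hZ =>
  mem_subsets.2 ⟨(mem_subsets.1 hZ).1, (mem_subsets.1 hZ).2.trans h⟩

theorem nonempty_of_mem_subsets {X Z : Finset ℤ} (hZ : Z ∈ subsets X) : Z.Nonempty :=
  nonempty_iff_ne_empty.2 (mem_subsets.1 hZ).1

theorem crossesCut_of_mem_subsets {Z : Finset ℤ} (hZ : Z ∈ subsets (Ico x w))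
    (hleft : Z ∉ subsets (Ico x y)) (hright : Z ∉ subsets (Ico y w)) : CrossesCut y Z := by
  obtain ⟨hne, hZI⟩ := mem_subsets.1 hZ
  simp only [mem_subsets, not_and, not_subset] at hleft hright
  obtain ⟨b, hb, hb'⟩ := hleft hne
  obtain ⟨a, ha, ha'⟩ := hright hne
  have hbI := mem_Ico.1 (hZI hb)
  have haI := mem_Ico.1 (hZI ha)
  rw [mem_Ico] at hb' ha'
  exact ⟨⟨a, ha, by omega⟩, b, hb, by omega⟩

/-- The nonempty subsets of one of the intervals `[x, y)`, `[y, z)`, `[z, w)`. -/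
def splitSubsets (x y z w : ℤ) : Finset (Finset ℤ) :=
  subsets (Ico x y) ∪ subsets (Ico z w) ∪ subsets (Ico y z)

theorem nonempty_of_mem_splitSubsets {Z : Finset ℤ} (hZ : Z ∈ splitSubsets x y z w) :
    Z.Nonempty := by
  rw [splitSubsets, mem_union, mem_union] at hZ
  exact hZ.elim (Or.rec nonempty_of_mem_subsets nonempty_of_mem_subsets) nonempty_of_mem_subsets

theorem splitSubsets_subset (hyz : y ≤ z) (hzw : z ≤ w) :
    splitSubsets x y z w ⊆ subsets (Ico x y) ∪ subsets (Ico y w) := by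
  rw [splitSubsets, union_assoc]
  exact union_subset_union_right (union_subset (subsets_mono (Ico_subset_Ico_left hyz))
    (subsets_mono (Ico_subset_Ico_right hzw)))

theorem union_subsets_subset (hxy : x ≤ y) (hyw : y ≤ w) :
    subsets (Ico x y) ∪ subsets (Ico y w) ⊆ subsets (Ico x w) :=
  union_subset (subsets_mono (Ico_subset_Ico_right hyw)) (subsets_mono (Ico_subset_Ico_left hxy))

theorem crossesCut_left_of_mem_sdiff :
    ∀ Z ∈ subsets (Ico x w) \ (subsets (Ico x y) ∪ subsets (Ico y w)), CrossesCut y Z := by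
  intro Z hZ
  rw [mem_sdiff, mem_union, not_or] at hZ
  exact crossesCut_of_mem_subsets hZ.1 hZ.2.1 hZ.2.2

theorem crossesCut_right_of_mem_sdiff :
    ∀ Z ∈ (subsets (Ico x y) ∪ subsets (Ico y w)) \ splitSubsets x y z w, CrossesCut z Z := by
  intro Z hZ
  rw [splitSubsets, mem_sdiff, mem_union, mem_union, mem_union, not_or, not_or] at hZ
  obtain ⟨hZ, ⟨hA, hC⟩, hB⟩ := hZ
  exact crossesCut_of_mem_subsets (hZ.resolve_left hA) hB hC

/-- The operator `e^{(H_A + H_B + H_C)/2} e^{-H_I/2}` for `I = ABC` with cuts at `y` and `z`. -/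
def bridge (Φ : Interaction d) (x y z w : ℤ) : Obs d (Ico x w) :=
  expansional (halfSum Φ _ (splitSubsets x y z w)) (halfSum Φ _ (subsets (Ico x w)))

theorem boltz_mul_boltz_eq (Φ : Interaction d) (x y z w : ℤ) :
    boltz Φ (Ico x w) * boltz Φ (Ico x w) = exp (-halfSum Φ _ (splitSubsets x y z w)) *
      (bridge Φ x y z w * (bridge Φ x y z w)ᴴ) *
      (exp (-halfSum Φ _ (splitSubsets x y z w)))ᴴ :=
  exp_neg_mul_exp_neg_eq (isHermitian_halfSum Φ _ _)

variable [NeZero d]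

theorem norm_bridge_le (hr : Φ.HasRange r) (hJ : Φ.HasStrength J) (hxy : x ≤ y) (hyz : y ≤ z)
    (hzw : z ≤ w) : ‖bridge Φ x y z w‖ ≤ expansionalBound r J ^ 2 := by
  rw [bridge, ← expansional_mul_expansional _ (halfSum Φ _ (subsets (Ico x y) ∪ subsets (Ico y w))),
    pow_two]
  have hsub := union_subsets_subset hxy (hyz.trans hzw)
  exact norm_mul_le_of_le
    (norm_expansional_cut_le hr hJ _ (splitSubsets_subset hyz hzw)
      (fun _ => nonempty_of_mem_splitSubsets) crossesCut_right_of_mem_sdiff)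
    (norm_expansional_cut_le hr hJ _ hsub (fun _ hZ => nonempty_of_mem_subsets (hsub hZ))
      crossesCut_left_of_mem_sdiff)

theorem norm_bridge_inv_le (hr : Φ.HasRange r) (hJ : Φ.HasStrength J) (hxy : x ≤ y) (hyz : y ≤ z)
    (hzw : z ≤ w) :
    ‖expansional (halfSum Φ (Ico x w) (subsets (Ico x w)))
      (halfSum Φ _ (splitSubsets x y z w))‖ ≤ expansionalBound r J ^ 2 := by
  rw [← expansional_mul_expansional _ (halfSum Φ _ (subsets (Ico x y) ∪ subsets (Ico y w))),
    pow_two]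
  have hsub := union_subsets_subset hxy (hyz.trans hzw)
  exact norm_mul_le_of_le
    (norm_expansional_cut_inv_le hr hJ _ hsub (fun _ hZ => nonempty_of_mem_subsets (hsub hZ))
      crossesCut_left_of_mem_sdiff)
    (norm_expansional_cut_inv_le hr hJ _ (splitSubsets_subset hyz hzw)
      (fun _ => nonempty_of_mem_splitSubsets) crossesCut_right_of_mem_sdiff)

theorem smul_one_le_bridge_mul_conjTranspose (hr : Φ.HasRange r) (hJ : Φ.HasStrength J)
    (hxy : x ≤ y) (hyz : y ≤ z) (hzw : z ≤ w) :
    (expansionalBound r J ^ 4)⁻¹ • (1 : Obs d (Ico x w)) ≤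
      bridge Φ x y z w * (bridge Φ x y z w)ᴴ := by
  have hG := expansionalBound_pos r ((norm_nonneg _).trans (hJ ∅))
  rw [show expansionalBound r J ^ 4 = (expansionalBound r J ^ 2) ^ 2 by ring]
  exact inv_sq_smul_one_le_mul_conjTranspose
    ((expansional_mul_expansional _ _ _).trans (expansional_self _)) (by positivity)
    (norm_bridge_inv_le hr hJ hxy hyz hzw)

theorem norm_bridge_mul_conjTranspose_le (hr : Φ.HasRange r) (hJ : Φ.HasStrength J)
    (hxy : x ≤ y) (hyz : y ≤ z) (hzw : z ≤ w) :
    ‖bridge Φ x y z w * (bridge Φ x y z w)ᴴ‖ ≤ expansionalBound r J ^ 4 :=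
  (norm_mul_conjTranspose_le (norm_bridge_le hr hJ hxy hyz hzw)).trans_eq (by ring)

theorem exists_norm_bridge_mul_conjTranspose_sub_le (hr : Φ.HasRange r) (hJ : Φ.HasStrength J)
    (hxy : x ≤ y) (hyz : y ≤ z) (hzw : z ≤ w) {M : ℕ}
    (hdis : Disjoint (nbhd r (Ico x w) y M) (nbhd r (Ico x w) z M)) :
    ∃ (w₁ : Obs d (nbhd r (Ico x w) y M)) (w₂ : Obs d (nbhd r (Ico x w) z M)),
      w₁.IsHermitian ∧ w₂.IsHermitian ∧ ‖w₁‖ ≤ expansionalBound r J ^ 2 ∧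
      ‖w₂‖ ≤ expansionalBound r J ^ 2 ∧
      ‖bridge Φ x y z w * (bridge Φ x y z w)ᴴ -
        embed (nbhd_subset r _ y M) w₁ * embed (nbhd_subset r _ z M) w₂‖ ≤
        4 * expansionalBound r J ^ 4 * Real.exp (-M) := by
  have hsub := union_subsets_subset hxy (hyz.trans hzw)
  have hne : ∀ Z ∈ subsets (Ico x y) ∪ subsets (Ico y w), Z.Nonempty := fun _ hZ =>
    nonempty_of_mem_subsets (hsub hZ)
  obtain ⟨f₁, hf₁, happrox₁⟩ :=
    exists_norm_expansional_cut_sub_le hr hJ _ hsub hne crossesCut_left_of_mem_sdiff M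
  obtain ⟨f₂, hf₂, happrox₂⟩ :=
    exists_norm_expansional_cut_sub_le hr hJ _ (splitSubsets_subset hyz hzw)
      (fun _ => nonempty_of_mem_splitSubsets) crossesCut_right_of_mem_sdiff M
  have hprod : embed (nbhd_subset r (Ico x w) y M) (f₁ * f₁ᴴ) *
      embed (nbhd_subset r (Ico x w) z M) (f₂ * f₂ᴴ) =
      embed (nbhd_subset r _ z M) f₂ * embed (nbhd_subset r _ y M) f₁ *
        (embed (nbhd_subset r _ z M) f₂ * embed (nbhd_subset r _ y M) f₁)ᴴ := by
    rw [conjTranspose_mul, ← embed_conjTranspose, ← embed_conjTranspose,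
      (embed_commute _ _ hdis f₁ f₂).symm.eq, embed_mul_embed_mul_embed_mul_embed _ _ hdis]
  refine ⟨f₁ * f₁ᴴ, f₂ * f₂ᴴ, isHermitian_mul_conjTranspose_self _,
    isHermitian_mul_conjTranspose_self _, norm_mul_conjTranspose_le hf₁,
    norm_mul_conjTranspose_le hf₂, ?_⟩
  rw [hprod, bridge,
    ← expansional_mul_expansional _ (halfSum Φ _ (subsets (Ico x y) ∪ subsets (Ico y w)))]
  exact norm_mul_mul_conjTranspose_sub_le
    (norm_expansional_cut_le hr hJ _ hsub hne crossesCut_left_of_mem_sdiff)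
    (norm_expansional_cut_le hr hJ _ (splitSubsets_subset hyz hzw)
      (fun _ => nonempty_of_mem_splitSubsets) crossesCut_right_of_mem_sdiff)
    ((norm_embed _ _).trans_le hf₁) ((norm_embed _ _).trans_le hf₂) happrox₁ happrox₂

end Bridge

section MatrixUnits

variable {d : ℕ} {X : Finset ℤ}

theorem single_eq_embed_mul_embed {X' X'' : Finset ℤ} (h' : X' ⊆ X) (h'' : X'' ⊆ X)
    (hd : Disjoint X' X'') (hu : X ⊆ X' ∪ X'') (s t : Config d X) :
    single s t (1 : ℂ) = embed h' (single (restr h' s) (restr h' t) 1) *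
      embed h'' (single (restr h'' s) (restr h'' t) 1) := by
  have eq_iff (a b : Config d X) : a = b ↔ restr h' a = restr h' b ∧ restr h'' a = restr h'' b :=
    ⟨fun h => h ▸ ⟨rfl, rfl⟩, fun h => funext fun x => (mem_union.1 (hu x.2)).elim
      (fun hx => congrFun h.1 ⟨x, hx⟩) fun hx => congrFun h.2 ⟨x, hx⟩⟩
  ext u v
  rw [embed_mul_embed_apply h' h'' hd, if_pos fun x h1 h2 =>
    ((mem_union.1 (hu x.2)).elim h1 h2).elim]
  simp only [single_apply, eq_iff, ite_mul, one_mul, zero_mul, ← ite_and]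
  exact if_congr (by tauto) rfl rfl

/-- The factor on `Y` of the matrix unit `|s⟩⟨t|` on `X`. -/
def unitPart (Y : Finset ℤ) (s t : Config d X) : Obs d Y :=
  embed inter_subset_right
    (single (restr (inter_subset_left (s₂ := Y)) s) (restr inter_subset_left t) 1)

theorem norm_unitPart [NeZero d] (Y : Finset ℤ) (s t : Config d X) : ‖unitPart Y s t‖ = 1 := by
  rw [unitPart, norm_embed, norm_single_one]

variable {A B I : Finset ℤ} (hA : A ⊆ I) (hB : B ⊆ I) (hX : X ⊆ I)

theorem embed_single_eq (hd : Disjoint A B) (hXu : X ⊆ A ∪ B) (s t : Config d X) :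
    embed hX (single s t 1) = embed hA (unitPart A s t) * embed hB (unitPart B s t) := by
  have hcover : X ⊆ X ∩ A ∪ X ∩ B := by
    rw [← inter_union_distrib_left]
    exact subset_inter (subset_refl X) hXu
  rw [single_eq_embed_mul_embed inter_subset_left inter_subset_left
    (hd.mono inter_subset_right inter_subset_right) hcover s t, embed_mul, unitPart, unitPart,
    embed_embed, embed_embed, embed_embed, embed_embed]

theorem embed_eq_sum (hd : Disjoint A B) (hXu : X ⊆ A ∪ B) (w : Obs d X) :
    embed hX w = ∑ p : Config d X × Config d X,
      w p.1 p.2 • (embed hA (unitPart A p.1 p.2) * embed hB (unitPart B p.1 p.2)) := by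
  conv_lhs => rw [matrix_eq_sum_single w]
  rw [← embedHom_apply, Fintype.sum_prod_type, map_sum]
  refine sum_congr rfl fun s _ => (map_sum _ _ _).trans (sum_congr rfl fun t _ => ?_)
  rw [← mul_one (w s t), ← smul_eq_mul, ← smul_single, map_smul, embedHom_apply,
    embed_single_eq hA hB hX hd hXu, smul_eq_mul, mul_one]

end MatrixUnits

section Clustering

/-- The covariance `τ(PQ) - τ(P) τ(Q)` in the state with density matrix `τ`. -/
def covariance {n : Type*} [Fintype n] (τ P Q : Matrix n n ℂ) : ℂ :=
  (τ * (P * Q)).trace - (τ * P).trace * (τ * Q).trace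

variable {d : ℕ} {A B C D I : Finset ℤ} (hA : A ⊆ D) (hC : C ⊆ D) (hD : D ⊆ I) (hB : B ⊆ I)
  (hdB : Disjoint D B) (hu : I ⊆ D ∪ B) (τ : Obs d B)

include hdB hu

theorem slice_embed_trans_mul_embed (a : Obs d A) (b : Obs d B) :
    slice D hB τ (embed (hA.trans hD) a * embed hB b) = (τ * b).trace • embed hA a := by
  rw [← embed_embed hA hD, slice_embed_mul_embed hD hB hdB hu]

theorem slice_mul_sub_slice_mul_slice (a : Obs d A) (b : Obs d B) (c : Obs d C) (b' : Obs d B) :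
    slice D hB τ (embed (hA.trans hD) a * embed hB b * (embed (hC.trans hD) c * embed hB b')) -
        slice D hB τ (embed (hA.trans hD) a * embed hB b) *
          slice D hB τ (embed (hC.trans hD) c * embed hB b') =
      covariance τ b b' • (embed hA a * embed hC c) := by
  have hcomm := embed_commute hB (hC.trans hD) (hdB.mono_left hC).symm b c
  have hprod : embed (hA.trans hD) a * embed hB b * (embed (hC.trans hD) c * embed hB b') =
      embed hD (embed hA a * embed hC c) * embed hB (b * b') := by
    rw [hcomm.mul_mul_mul_comm, embed_mul hD, embed_embed, embed_embed, embed_mul hB]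
  rw [hprod, slice_embed_mul_embed hD hB hdB hu,
    slice_embed_trans_mul_embed hA hD hB hdB hu, slice_embed_trans_mul_embed hC hD hB hdB hu,
    smul_mul_smul_comm, ← sub_smul, covariance]

include hA hD in
theorem exists_slice_embed_eq {X : Finset ℤ} (hX : X ⊆ I) (hXu : X ⊆ A ∪ B) (w : Obs d X) :
    ∃ P : Obs d A, slice D hB τ (embed hX w) = embed hA P := by
  refine ⟨∑ p : Config d X × Config d X,
    w p.1 p.2 • (τ * unitPart B p.1 p.2).trace • unitPart A p.1 p.2, ?_⟩
  rw [embed_eq_sum (hA.trans hD) hB hX (hdB.mono_left hA) hXu, map_sum, ← embedHom_apply, map_sum]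
  refine sum_congr rfl fun p _ => ?_
  rw [map_smul, slice_embed_trans_mul_embed hA hD hB hdB hu, map_smul, map_smul, embedHom_apply]

include hA hC hD in
theorem slice_embed_mul_embed_sub_eq_sum {X₁ X₂ : Finset ℤ} (hX₁ : X₁ ⊆ I) (hX₂ : X₂ ⊆ I)
    (hX₁u : X₁ ⊆ A ∪ B) (hX₂u : X₂ ⊆ C ∪ B) (w₁ : Obs d X₁) (w₂ : Obs d X₂) :
    slice D hB τ (embed hX₁ w₁ * embed hX₂ w₂) -
        slice D hB τ (embed hX₁ w₁) * slice D hB τ (embed hX₂ w₂) =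
      ∑ p : Config d X₁ × Config d X₁, ∑ p' : Config d X₂ × Config d X₂,
        (w₁ p.1 p.2 * w₂ p'.1 p'.2) • covariance τ (unitPart B p.1 p.2) (unitPart B p'.1 p'.2) •
          (embed hA (unitPart A p.1 p.2) * embed hC (unitPart C p'.1 p'.2)) := by
  rw [embed_eq_sum (hA.trans hD) hB hX₁ (hdB.mono_left hA) hX₁u,
    embed_eq_sum (hC.trans hD) hB hX₂ (hdB.mono_left hC) hX₂u, sum_mul_sum, map_sum, map_sum,
    map_sum, sum_mul_sum, ← sum_sub_distrib]
  simp only [map_sum, ← sum_sub_distrib, smul_mul_smul_comm, map_smul, ← smul_sub,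
    slice_mul_sub_slice_mul_slice hA hC hD hB hdB hu]

include hA hC hD in
theorem norm_slice_embed_mul_embed_sub_le [NeZero d] {X₁ X₂ : Finset ℤ} (hX₁ : X₁ ⊆ I)
    (hX₂ : X₂ ⊆ I) (hX₁u : X₁ ⊆ A ∪ B) (hX₂u : X₂ ⊆ C ∪ B) {w₁ : Obs d X₁} {w₂ : Obs d X₂}
    {k ε : ℝ} (hk₁ : ‖w₁‖ ≤ k) (hk₂ : ‖w₂‖ ≤ k)
    (hε : ∀ (Q : Obs d (X₁ ∩ B)) (R : Obs d (X₂ ∩ B)), ‖Q‖ = 1 → ‖R‖ = 1 →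
      ‖covariance τ (embed inter_subset_right Q) (embed inter_subset_right R)‖ ≤ ε) :
    ‖slice D hB τ (embed hX₁ w₁ * embed hX₂ w₂) -
        slice D hB τ (embed hX₁ w₁) * slice D hB τ (embed hX₂ w₂)‖ ≤
      (d : ℝ) ^ (2 * (#X₁ + #X₂)) * k ^ 2 * ε := by
  have hk : 0 ≤ k := (norm_nonneg _).trans hk₁
  have term_le (p : Config d X₁ × Config d X₁) (p' : Config d X₂ × Config d X₂) :
      ‖(w₁ p.1 p.2 * w₂ p'.1 p'.2) • covariance τ (unitPart B p.1 p.2) (unitPart B p'.1 p'.2) •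
        (embed hA (unitPart A p.1 p.2) * embed hC (unitPart C p'.1 p'.2))‖ ≤ k * k * (ε * 1) := by
    have coeff_le := norm_mul_le_of_le ((norm_apply_le_norm w₁ p.1 p.2).trans hk₁)
      ((norm_apply_le_norm w₂ p'.1 p'.2).trans hk₂)
    have cov_le : ‖covariance τ (unitPart B p.1 p.2) (unitPart B p'.1 p'.2)‖ ≤ ε :=
      hε _ _ (norm_single_one _ _) (norm_single_one _ _)
    have prod_le := norm_mul_le (embed hA (unitPart A p.1 p.2)) (embed hC (unitPart C p'.1 p'.2))
    rw [norm_embed, norm_embed, norm_unitPart, norm_unitPart, one_mul] at prod_le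
    rw [norm_smul, norm_smul]
    gcongr
    exact (norm_nonneg _).trans cov_le
  rw [slice_embed_mul_embed_sub_eq_sum hA hC hD hB hdB hu τ hX₁ hX₂ hX₁u hX₂u]
  calc _ ≤ ∑ _p : Config d X₁ × Config d X₁, ∑ _p' : Config d X₂ × Config d X₂, k * k * (ε * 1) :=
        norm_sum_le_of_le _ fun p _ => norm_sum_le_of_le _ fun p' _ => term_le p p'
    _ = (d : ℝ) ^ (2 * (#X₁ + #X₂)) * k ^ 2 * ε := by
        simp only [sum_const, card_univ, Fintype.card_prod, Fintype.card_fun, Fintype.card_fin,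
          Fintype.card_coe, nsmul_eq_mul]
        push_cast
        ring

end Clustering

section Correlations

variable {d : ℕ} {B X₁ X₂ : Finset ℤ} (hd : Disjoint X₁ X₂)

include hd

theorem trace_tensor_mul_reduced_sub (h₁ : X₁ ⊆ B) (h₂ : X₂ ⊆ B) (τ : Obs d B) (Q : Obs d X₁)
    (R : Obs d X₂) :
    (tensor Q R * (reduced (X₁ ∪ X₂) τ - tensor (reduced X₁ τ) (reduced X₂ τ))).trace =
      covariance τ (embed h₁ Q) (embed h₂ R) := by
  have joint : (tensor Q R * reduced (X₁ ∪ X₂) τ).trace =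
      (τ * (embed h₁ Q * embed h₂ R)).trace := by
    rw [trace_mul_comm, trace_reduced_mul (union_subset h₁ h₂), tensor_eq hd, embed_mul,
      embed_embed, embed_embed]
  have product : (tensor Q R * tensor (reduced X₁ τ) (reduced X₂ τ)).trace =
      (τ * embed h₁ Q).trace * (τ * embed h₂ R).trace := by
    have hcomm := embed_commute subset_union_left subset_union_right hd (reduced X₁ τ) R
    rw [tensor_eq hd, tensor_eq hd, hcomm.symm.mul_mul_mul_comm,
      ← embed_mul, ← embed_mul, trace_embed_mul_embed _ _ hd (subset_refl _),
      trace_mul_comm, trace_reduced_mul h₁, trace_mul_comm R, trace_reduced_mul h₂]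
  rw [mul_sub, trace_sub, joint, product, covariance]

variable [NeZero d]

theorem norm_trace_tensor_mul_le {Q : Obs d X₁} {R : Obs d X₂} (hQ : ‖Q‖ = 1) (hR : ‖R‖ = 1)
    (M : Obs d (X₁ ∪ X₂)) : ‖(tensor Q R * M).trace‖ ≤ ∑ i, ∑ j, ‖M j i‖ := by
  have norm_tensor_le : ‖tensor Q R‖ ≤ 1 := by
    rw [tensor_eq hd]
    refine (norm_mul_le _ _).trans_eq ?_
    rw [norm_embed, norm_embed, hQ, hR, one_mul]
  refine norm_sum_le_of_le _ fun i _ => norm_sum_le_of_le _ fun j _ => ?_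
  rw [norm_mul]
  exact mul_le_of_le_one_left (norm_nonneg _) ((norm_apply_le_norm _ _ _).trans norm_tensor_le)

theorem norm_covariance_le_corr (h₁ : X₁ ⊆ B) (h₂ : X₂ ⊆ B) (τ : Obs d B) {Q : Obs d X₁}
    {R : Obs d X₂} (hQ : ‖Q‖ = 1) (hR : ‖R‖ = 1) :
    ‖covariance τ (embed h₁ Q) (embed h₂ R)‖ ≤ corr τ X₁ X₂ := by
  rw [← trace_tensor_mul_reduced_sub hd]
  refine le_csSup ?_ ⟨Q, R, hQ, hR, rfl⟩
  refine ⟨∑ i, ∑ j, ‖(reduced (X₁ ∪ X₂) τ - tensor (reduced X₁ τ) (reduced X₂ τ)) j i‖, ?_⟩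
  rintro _ ⟨Q, R, hQ, hR, rfl⟩
  exact norm_trace_tensor_mul_le hd hQ hR _

end Correlations

section NearProducts

variable {d : ℕ}

theorem isHermitian_of_isHermitian_embed {X Λ : Finset ℤ} [NeZero d] (h : X ⊆ Λ) {Q : Obs d X}
    (hQ : (embed h Q).IsHermitian) : Q.IsHermitian :=
  embed_injective h ((embed_conjTranspose h Q).trans hQ.eq)

variable [NeZero d] {A B C I X₁ X₂ : Finset ℤ} (hAC : A ∪ C ⊆ I) (hB : B ⊆ I) (hd : Disjoint A C)
  (hdB : Disjoint (A ∪ C) B) (hu : I ⊆ A ∪ C ∪ B) {τA : Obs d A} {τB : Obs d B} {τC : Obs d C}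
  (hτA : IsState τA) (hτB : IsState τB) (hτC : IsState τC)

include hAC hd hdB hu hτA hτB hτC

theorem norm_sliceDefect_slice_le {W : Obs d I} (hW : W.IsHermitian) {k : ℝ} (hk : ‖W‖ ≤ k) :
    ‖sliceDefect τA τC (slice (A ∪ C) hB τB W)‖ ≤ 2 * k ^ 2 :=
  norm_sliceDefect_le hd hτA hτC (isHermitian_slice hAC hB hdB hτB.nonneg hW)
    ((norm_slice_le hAC hB hdB hu hτB hW).trans hk)

theorem norm_sliceDefect_slice_le_of_near_product (hX₁ : X₁ ⊆ I) (hX₂ : X₂ ⊆ I)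
    (hdX : Disjoint X₁ X₂) (hX₁u : X₁ ⊆ A ∪ B) (hX₂u : X₂ ⊆ C ∪ B) {W : Obs d I}
    {w₁ : Obs d X₁} {w₂ : Obs d X₂} (hW : W.IsHermitian) (hw₁ : w₁.IsHermitian)
    (hw₂ : w₂.IsHermitian) {k η ε : ℝ} (hk : ‖W‖ ≤ k ^ 2) (hk₁ : ‖w₁‖ ≤ k) (hk₂ : ‖w₂‖ ≤ k)
    (hη : ‖W - embed hX₁ w₁ * embed hX₂ w₂‖ ≤ η)
    (hε : ∀ (Q : Obs d (X₁ ∩ B)) (R : Obs d (X₂ ∩ B)), ‖Q‖ = 1 → ‖R‖ = 1 →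
      ‖covariance τB (embed inter_subset_right Q) (embed inter_subset_right R)‖ ≤ ε) :
    ‖sliceDefect τA τC (slice (A ∪ C) hB τB W)‖ ≤
      4 * k ^ 2 * (η + (d : ℝ) ^ (2 * (#X₁ + #X₂)) * k ^ 2 * ε) := by
  obtain ⟨P, hP⟩ := exists_slice_embed_eq subset_union_left hAC hB hdB hu τB hX₁ hX₁u w₁
  obtain ⟨Q, hQ⟩ := exists_slice_embed_eq subset_union_right hAC hB hdB hu τB hX₂ hX₂u w₂
  have isHermitian_slice {M : Obs d I} := isHermitian_slice (M := M) hAC hB hdB hτB.nonneg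
  have norm_slice_le {M : Obs d I} := norm_slice_le (M := M) hAC hB hdB hu hτB
  have hW₁ := isHermitian_embed hX₁ hw₁
  have hW₂ := isHermitian_embed hX₂ hw₂
  have norm_P_le : ‖P‖ ≤ k := calc
    ‖P‖ = ‖slice (A ∪ C) hB τB (embed hX₁ w₁)‖ := by rw [hP, norm_embed]
    _ ≤ ‖embed hX₁ w₁‖ := norm_slice_le hW₁
    _ ≤ k := (norm_embed hX₁ w₁).trans_le hk₁
  have norm_Q_le : ‖Q‖ ≤ k := calc
    ‖Q‖ = ‖slice (A ∪ C) hB τB (embed hX₂ w₂)‖ := by rw [hQ, norm_embed]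
    _ ≤ ‖embed hX₂ w₂‖ := norm_slice_le hW₂
    _ ≤ k := (norm_embed hX₂ w₂).trans_le hk₂
  refine norm_sliceDefect_le_of_near_product hd hτA hτC (isHermitian_slice hW)
    (isHermitian_of_isHermitian_embed subset_union_left (hP ▸ isHermitian_slice hW₁))
    (isHermitian_of_isHermitian_embed subset_union_right (hQ ▸ isHermitian_slice hW₂))
    ((norm_slice_le hW).trans hk) norm_P_le norm_Q_le ?_
  have near := (norm_slice_le
    (hW.sub (isHermitian_embed_mul_embed hX₁ hX₂ hdX hw₁ hw₂))).trans hη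
  rw [map_sub] at near
  have factorizes := norm_slice_embed_mul_embed_sub_le subset_union_left subset_union_right hAC hB
    hdB hu τB hX₁ hX₂ hX₁u hX₂u hk₁ hk₂ hε
  rw [← hP, ← hQ]
  exact norm_sub_le_norm_sub_add_norm_sub _ _ _ |>.trans (add_le_add near factorizes)

end NearProducts

section Cuts

variable {r : ℝ} {n : ℕ} {x y z w : ℤ}

/-- The distance from a cut which its `n`-th neighbourhood reaches. -/
def cutRadius (r : ℝ) (n : ℕ) : ℕ := (n + 1) * rangeLen r

theorem nbhd_eq (r : ℝ) (I : Finset ℤ) (y : ℤ) (n : ℕ) :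
    nbhd r I y n = I ∩ Ico (y - cutRadius r n) (y + cutRadius r n) := by
  rw [nbhd, window, cutRadius, Nat.cast_mul]

theorem card_nbhd_le (r : ℝ) (I : Finset ℤ) (y : ℤ) (n : ℕ) :
    #(nbhd r I y n) ≤ 2 * cutRadius r n := by
  rw [nbhd_eq]
  refine (card_le_card inter_subset_right).trans ?_
  rw [Int.card_Ico]
  omega

theorem disjoint_Ico_Ico (hyz : y ≤ z) : Disjoint (Ico x y) (Ico z w) := by
  simp only [disjoint_left, mem_Ico]
  omega

theorem disjoint_Ico_union_Ico_Ico : Disjoint (Ico x y ∪ Ico z w) (Ico y z) := by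
  simp only [disjoint_left, mem_union, mem_Ico]
  omega

theorem Ico_subset_Ico_union_Ico_union_Ico : Ico x w ⊆ Ico x y ∪ Ico z w ∪ Ico y z := by
  simp only [subset_iff, mem_union, mem_Ico]
  omega

theorem Ico_union_Ico_subset_Ico (hxy : x ≤ y) (hyz : y ≤ z) (hzw : z ≤ w) :
    Ico x y ∪ Ico z w ⊆ Ico x w :=
  union_subset (Ico_subset_Ico_right (hyz.trans hzw)) (Ico_subset_Ico_left (hxy.trans hyz))

variable (hlen : y + cutRadius r n ≤ z - cutRadius r n)

include hlen

theorem disjoint_nbhd (I : Finset ℤ) : Disjoint (nbhd r I y n) (nbhd r I z n) := by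
  rw [nbhd_eq, nbhd_eq]
  exact (disjoint_Ico_Ico hlen).mono inter_subset_right inter_subset_right

theorem nbhd_left_subset : nbhd r (Ico x w) y n ⊆ Ico x y ∪ Ico y z := by
  simp only [nbhd_eq, subset_iff, mem_inter, mem_union, mem_Ico]
  omega

theorem nbhd_right_subset : nbhd r (Ico x w) z n ⊆ Ico z w ∪ Ico y z := by
  simp only [nbhd_eq, subset_iff, mem_inter, mem_union, mem_Ico]
  omega

theorem nbhd_left_inter (hxy : x ≤ y) (hzw : z ≤ w) :
    nbhd r (Ico x w) y n ∩ Ico y z = Ico y (y + cutRadius r n) := by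
  ext a
  simp only [nbhd_eq, mem_inter, mem_Ico]
  omega

theorem nbhd_right_inter (hxy : x ≤ y) (hzw : z ≤ w) :
    nbhd r (Ico x w) z n ∩ Ico y z = Ico (z - cutRadius r n) z := by
  ext a
  simp only [nbhd_eq, mem_inter, mem_Ico]
  omega

end Cuts

section BridgeDefect

variable {d : ℕ} {Φ : Interaction d} {r J : ℝ} {x y z w : ℤ}

/-- The slice defect of `Tr_B[ρ^B E E*]` for the bridge `E` of the interval `I = ABC` with cuts at
`y` and `z`; it vanishes if that operator is a product over `A` and `C`. -/
def bridgeDefect (Φ : Interaction d) (x y z w : ℤ) (hB : Ico y z ⊆ Ico x w) :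
    Obs d (Ico x y ∪ Ico z w) :=
  sliceDefect (Φ.gibbs (Ico x y)) (Φ.gibbs (Ico z w)) (slice (Ico x y ∪ Ico z w) hB
    (Φ.gibbs (Ico y z)) (bridge Φ x y z w * (bridge Φ x y z w)ᴴ))

variable [NeZero d] (hr : Φ.HasRange r) (hJ : Φ.HasStrength J) (hxy : x ≤ y) (hyz : y ≤ z)
  (hzw : z ≤ w)

include hr hJ hxy hyz hzw

theorem mutualInfo_chain_le_of_norm_bridgeDefect_le {δ : ℝ}
    (hδ : ‖bridgeDefect Φ x y z w (Ico_subset_Ico hxy hzw)‖ ≤ δ) {q : ℝ} (hq : 1 ≤ q) :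
    mutualInfo (Φ.gibbs (Ico x w)) (Ico x y) (Ico z w) ≤
        bsMutualInfo (Φ.gibbs (Ico x w)) (Ico x y) (Ico z w) ∧
      bsMutualInfo (Φ.gibbs (Ico x w)) (Ico x y) (Ico z w) ≤
        renyiMutualInfo q (Φ.gibbs (Ico x w)) (Ico x y) (Ico z w) ∧
      renyiMutualInfo q (Φ.gibbs (Ico x w)) (Ico x y) (Ico z w) ≤
        δ * expansionalBound r J ^ 8 := by
  have hAC := Ico_union_Ico_subset_Ico hxy hyz hzw
  have hG := expansionalBound_pos r ((norm_nonneg _).trans (hJ ∅))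
  have chain := mutualInfo_chain_gibbs hAC (Ico_subset_Ico hxy hzw) (disjoint_Ico_Ico hyz)
    disjoint_Ico_union_Ico_Ico Ico_subset_Ico_union_Ico_union_Ico
    (exp_neg_halfSum hAC (Ico_subset_Ico hxy hzw) (disjoint_Ico_Ico hyz)
      disjoint_Ico_union_Ico_Ico Φ) (boltz_mul_boltz_eq Φ x y z w) (inv_pos.2 (pow_pos hG 4))
    (smul_one_le_bridge_mul_conjTranspose hr hJ hxy hyz hzw) hδ hq
  rwa [inv_pow, div_inv_eq_mul, ← pow_mul] at chain

theorem norm_bridgeDefect_le :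
    ‖bridgeDefect Φ x y z w (Ico_subset_Ico hxy hzw)‖ ≤ 2 * expansionalBound r J ^ 8 := by
  refine (norm_sliceDefect_slice_le (Ico_union_Ico_subset_Ico hxy hyz hzw) _
    (disjoint_Ico_Ico hyz) disjoint_Ico_union_Ico_Ico Ico_subset_Ico_union_Ico_union_Ico
    (isState_gibbs Φ _) (isState_gibbs Φ _) (isState_gibbs Φ _)
    (isHermitian_mul_conjTranspose_self _)
    (norm_bridge_mul_conjTranspose_le hr hJ hxy hyz hzw)).trans_eq ?_
  rw [← pow_mul]

theorem norm_bridgeDefect_le_of_corr_le {M : ℕ} (hlen : y + cutRadius r M ≤ z - cutRadius r M)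
    {ε : ℝ} (hε : corr (Φ.gibbs (Ico y z)) (Ico y (y + cutRadius r M))
      (Ico (z - cutRadius r M) z) ≤ ε) :
    ‖bridgeDefect Φ x y z w (Ico_subset_Ico hxy hzw)‖ ≤ 16 * expansionalBound r J ^ 8 *
      (Real.exp (-M) + (d : ℝ) ^ (8 * cutRadius r M) * ε) := by
  have hdis := disjoint_nbhd hlen (Ico x w)
  rw [← nbhd_left_inter hlen hxy hzw, ← nbhd_right_inter hlen hxy hzw] at hε
  have clustering {Q : Obs d (nbhd r (Ico x w) y M ∩ Ico y z)}
      {R : Obs d (nbhd r (Ico x w) z M ∩ Ico y z)} (hQ : ‖Q‖ = 1) (hR : ‖R‖ = 1) :=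
    (norm_covariance_le_corr (hdis.mono inter_subset_left inter_subset_left) inter_subset_right
      inter_subset_right (Φ.gibbs (Ico y z)) hQ hR).trans hε
  have hε0 : 0 ≤ ε := (norm_nonneg _).trans (clustering CStarRing.norm_one CStarRing.norm_one)
  obtain ⟨w₁, w₂, hw₁, hw₂, hk₁, hk₂, hη⟩ :=
    exists_norm_bridge_mul_conjTranspose_sub_le hr hJ hxy hyz hzw hdis
  set G := expansionalBound r J
  have hk := norm_bridge_mul_conjTranspose_le hr hJ hxy hyz hzw
  rw [show expansionalBound r J ^ 4 = (G ^ 2) ^ 2 by rw [← pow_mul]] at hk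
  have card_le : 2 * (#(nbhd r (Ico x w) y M) + #(nbhd r (Ico x w) z M)) ≤ 8 * cutRadius r M := by
    linarith [card_nbhd_le r (Ico x w) y M, card_nbhd_le r (Ico x w) z M]
  have hd1 : (1 : ℝ) ≤ d := mod_cast NeZero.one_le
  calc _ ≤ 4 * (G ^ 2) ^ 2 * (4 * G ^ 4 * Real.exp (-M) +
        (d : ℝ) ^ (2 * (#(nbhd r (Ico x w) y M) + #(nbhd r (Ico x w) z M))) * (G ^ 2) ^ 2 * ε) :=
        norm_sliceDefect_slice_le_of_near_product (Ico_union_Ico_subset_Ico hxy hyz hzw) _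
          (disjoint_Ico_Ico hyz) disjoint_Ico_union_Ico_Ico Ico_subset_Ico_union_Ico_union_Ico
          (isState_gibbs Φ _) (isState_gibbs Φ _) (isState_gibbs Φ _) (nbhd_subset r _ y M)
          (nbhd_subset r _ z M) hdis (nbhd_left_subset hlen) (nbhd_right_subset hlen)
          (isHermitian_mul_conjTranspose_self _) hw₁ hw₂ hk hk₁ hk₂ hη
          fun _ _ hQ hR => clustering hQ hR
    _ ≤ 4 * (G ^ 2) ^ 2 * (4 * G ^ 4 * Real.exp (-M) +
        4 * (d : ℝ) ^ (8 * cutRadius r M) * (G ^ 2) ^ 2 * ε) := by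
        gcongr
        exact (pow_le_pow_right₀ hd1 card_le).trans
          (le_mul_of_one_le_left (by positivity) (by norm_num))
    _ = _ := by ring

end BridgeDefect

section DecayRate

variable {d : ℕ} {r K α l : ℝ}

/-- The rate at which the correlations between the ends of a middle piece of length `3 * l` decay
if the Gibbs states cluster with rate `α`. The neighbourhoods of the cuts have radius of order
`l` times this rate, so that the number `d ^ (8 * cutRadius r M)` of matrix units to which
clustering is applied costs only part of the rate `α`. -/
def decayRate (d : ℕ) (r α : ℝ) : ℝ := min 1 α / (16 * rangeLen r * (1 + Real.log d))

theorem one_le_cast_rangeLen (r : ℝ) : (1 : ℝ) ≤ rangeLen r := mod_cast one_le_rangeLen r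

theorem decayRate_pos (d : ℕ) (r : ℝ) (hα : 0 < α) : 0 < decayRate d r α := by
  have := one_le_cast_rangeLen r
  have := Real.log_natCast_nonneg d
  have := lt_min one_pos hα
  rw [decayRate]
  positivity

theorem decayRate_mul (d : ℕ) (r α : ℝ) :
    decayRate d r α * (16 * rangeLen r * (1 + Real.log d)) = min 1 α := by
  have := one_le_cast_rangeLen r
  have := Real.log_natCast_nonneg d
  exact div_mul_cancel₀ _ (by positivity)

theorem decayRate_mul_rangeLen_le_one (d : ℕ) (r : ℝ) (hα : 0 < α) :
    decayRate d r α * rangeLen r ≤ 1 := by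
  have hρ := one_le_cast_rangeLen r
  have hlog := Real.log_natCast_nonneg d
  refine le_trans ?_ ((decayRate_mul d r α).trans_le (min_le_left 1 α))
  have := decayRate_pos d r hα
  gcongr
  nlinarith

theorem decayRate_mul_le (d : ℕ) (r : ℝ) (hα : 0 < α) :
    decayRate d r α * (8 * rangeLen r * Real.log d + 1) ≤ α := by
  have hρ := one_le_cast_rangeLen r
  have hlog := Real.log_natCast_nonneg d
  refine le_trans ?_ ((decayRate_mul d r α).trans_le (min_le_right 1 α))
  have := decayRate_pos d r hα
  gcongr
  nlinarith

theorem exists_nat_add_one_le_lt_add_two {t : ℝ} (ht : 1 ≤ t) :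
    ∃ M : ℕ, (M : ℝ) + 1 ≤ t ∧ t < M + 2 := by
  obtain ⟨M, hM⟩ := Nat.exists_eq_succ_of_ne_zero (Nat.floor_pos.2 ht).ne'
  have := (Nat.floor_eq_iff (zero_le_one.trans ht)).1 hM
  push_cast at this
  exact ⟨M, this.1, by linarith⟩

theorem natCast_pow_mul_exp_le (hd : 0 < d) (hα : 0 < α) (hl : 0 ≤ l) {M : ℕ}
    (hM : (M : ℝ) + 1 ≤ decayRate d r α * l) :
    (d : ℝ) ^ (8 * cutRadius r M) * Real.exp (-α * l) ≤ Real.exp (-decayRate d r α * l) := by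
  have := Real.log_natCast_nonneg d
  rw [← Real.exp_log (Nat.cast_pos.2 hd), ← Real.exp_nat_mul, ← Real.exp_add, Real.exp_le_exp]
  have hradius : ((8 * cutRadius r M : ℕ) : ℝ) * Real.log d ≤
      8 * (decayRate d r α * l * rangeLen r) * Real.log d := by
    rw [cutRadius]
    push_cast
    gcongr
  linarith [mul_le_mul_of_nonneg_right (decayRate_mul_le d r hα) hl]

theorem exists_cutRadius_le_and_exp_add_le (hd : 0 < d) (hK : 0 ≤ K) (hα : 0 < α) (hl : 0 ≤ l)
    (hlarge : 1 ≤ decayRate d r α * l) :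
    ∃ M : ℕ, (cutRadius r M : ℝ) ≤ l ∧
      Real.exp (-M) + (d : ℝ) ^ (8 * cutRadius r M) * (K * Real.exp (-α * l)) ≤
        (Real.exp 2 + K) * Real.exp (-decayRate d r α * l) := by
  obtain ⟨M, hM, hM'⟩ := exists_nat_add_one_le_lt_add_two hlarge
  refine ⟨M, ?_, ?_⟩
  · calc (cutRadius r M : ℝ) = (M + 1) * rangeLen r := by rw [cutRadius]; push_cast; rfl
      _ ≤ decayRate d r α * l * rangeLen r := by gcongr
      _ = decayRate d r α * rangeLen r * l := mul_right_comm _ _ _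
      _ ≤ l := mul_le_of_le_one_left hl (decayRate_mul_rangeLen_le_one d r hα)
  · have hexp : Real.exp (-M) ≤ Real.exp 2 * Real.exp (-decayRate d r α * l) := by
      rw [← Real.exp_add, Real.exp_le_exp]
      linarith
    linarith [mul_le_mul_of_nonneg_left (natCast_pow_mul_exp_le hd hα hl hM) hK]

theorem cast_card_Ico {a b : ℤ} (hab : a ≤ b) : (#(Ico a b) : ℝ) = b - a := by
  rw [← Int.cast_natCast, Int.card_Ico_of_le a b hab, Int.cast_sub]

theorem norm_bridgeDefect_le_of_uniformClustering (hd : 0 < d) {Φ : Interaction d} {J : ℝ}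
    (hr : Φ.HasRange r) (hJ : Φ.HasStrength J)
    (hΦ : Φ.UniformClustering fun l => K * Real.exp (-α * l)) (hK : 0 ≤ K) (hα : 0 < α)
    {x y z w : ℤ} (hxy : x ≤ y) (hyz : y ≤ z) (hzw : z ≤ w) (hl : 0 ≤ l)
    (hlB : 3 * l ≤ #(Ico y z)) :
    ‖bridgeDefect Φ x y z w (Ico_subset_Ico hxy hzw)‖ ≤ 16 * expansionalBound r J ^ 8 *
      ((Real.exp 2 + K) * Real.exp (-decayRate d r α * l)) := by
  have : NeZero d := ⟨hd.ne'⟩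
  have hG := expansionalBound_pos r ((norm_nonneg _).trans (hJ ∅))
  rcases lt_or_ge (decayRate d r α * l) 1 with hsmall | hlarge
  · have one_le : 1 ≤ Real.exp 2 * Real.exp (-decayRate d r α * l) := by
      rw [← Real.exp_add]
      exact Real.one_le_exp (by linarith)
    refine (norm_bridgeDefect_le hr hJ hxy hyz hzw).trans ?_
    have hKexp := mul_nonneg hK (Real.exp_pos (-decayRate d r α * l)).le
    nlinarith [pow_pos hG 8]
  · obtain ⟨M, hM, hbound⟩ := exists_cutRadius_le_and_exp_add_le hd hK hα hl hlarge
    rw [cast_card_Ico hyz] at hlB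
    have hlen' : ((y + cutRadius r M : ℤ) : ℝ) + l ≤ (z - cutRadius r M : ℤ) := by
      push_cast
      linarith
    have hlen : y + cutRadius r M ≤ z - cutRadius r M := by
      exact_mod_cast (le_add_of_nonneg_right hl).trans hlen'
    have hcorr := hΦ.2.2 _ _ _ _ ⟨y, y + cutRadius r M, z - cutRadius r M, z, by omega, hlen,
      by omega, rfl, rfl, rfl, rfl⟩ l hl (by rw [cast_card_Ico hlen]; linarith)
    refine (norm_bridgeDefect_le_of_corr_le hr hJ hxy hyz hzw hlen hcorr).trans ?_
    gcongr

end DecayRate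

end SpinChain

end

theorem theorem8p2 (d : ℕ) (hd : 0 < d) (r J K α : ℝ)
    (hr : 0 < r) (hJ : 0 < J) (hK : 0 < K) (hα : 0 < α) :
    ∃ K' α' : ℝ, 0 < K' ∧ 0 < α' ∧
      ∀ Φ : SpinChain.Interaction d, Φ.HasRange r → Φ.HasStrength J →
        Φ.UniformClustering (fun l => K * Real.exp (-α * l)) →
        ∀ I A B C : Finset ℤ, SpinChain.IsSplit I A B C →
          ∀ l : ℝ, 0 ≤ l → 3 * l ≤ (B.card : ℝ) → ∀ q : ℝ, 1 ≤ q →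
            SpinChain.mutualInfo (Φ.gibbs I) A C ≤ SpinChain.bsMutualInfo (Φ.gibbs I) A C ∧
            SpinChain.bsMutualInfo (Φ.gibbs I) A C
              ≤ SpinChain.renyiMutualInfo q (Φ.gibbs I) A C ∧
            SpinChain.renyiMutualInfo q (Φ.gibbs I) A C ≤ K' * Real.exp (-α' * l) := by
  have : NeZero d := ⟨hd.ne'⟩
  have hG := SpinChain.expansionalBound_pos r hJ.le
  refine ⟨16 * SpinChain.expansionalBound r J ^ 16 * (Real.exp 2 + K), SpinChain.decayRate d r α,
    by positivity, SpinChain.decayRate_pos d r hα, ?_⟩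
  rintro Φ hΦr hΦJ hΦ _ _ _ _ ⟨x, y, z, w, hxy, hyz, hzw, rfl, rfl, rfl, rfl⟩ l hl hlB q hq
  have defect_le := SpinChain.norm_bridgeDefect_le_of_uniformClustering hd hΦr hΦJ hΦ hK.le hα
    hxy hyz hzw hl hlB
  obtain ⟨h₁, h₂, h₃⟩ := SpinChain.mutualInfo_chain_le_of_norm_bridgeDefect_le hΦr hΦJ hxy hyz hzw
    defect_le hq
  exact ⟨h₁, h₂, h₃.trans_eq (by ring)⟩
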